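/- For a trigonometric polynomial $F(t)=\sum_{m\in\mathbb Z} f_m e^{imt}$ (finitely many non-zero complex coefficients) and $p\in[1,\infty)$ put $|F|_{A_p}=\bigl(\sum_m |f_m|^p\bigr)^{1/p}$, and for an integer $N\ge 0$ let $S_N(F)=\sum_{m=-N}^{N} f_m e^{imt}$ be the $N$-th partial Fourier sum. Let $1<p<\frac{1+\sqrt5}{2}$. Then there is no constant $C_p$ (depending only on $p$) with the following property: for every $\epsilon>0$ there exist trigonometric polynomials $P=\sum_m p_m e^{imt}$ and $Q=\sum_m q_m e^{imt}$ such that 1. $q_0=0$ and $\max_j |q_j|<\epsilon$; 2. $|P-1|_{A_p}<\epsilon$; 3. $|PQ-1|_{A_p}<\epsilon$; 4. $|P\,S_m(Q)|_{A_p}<C_p$ for all integers $m\ge 0$. In other words, the conclusion of the Lev–Tselishchev localization lemma fails for every $p\in\bigl(1,\frac{1+\sqrt5}{2}\bigr)$. -/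

import Mathlib

open scoped Real

noncomputable section

instance factTwoPiPos : Fact (0 < 2 * π) := ⟨Real.two_pi_pos⟩

/-- Trigonometric polynomials `∑ m, q m * exp (i m t)` on the circle `ℝ / 2πℤ`: finite complex
linear combinations of the characters `fourier m : t ↦ exp (i m t)`, `m : ℤ`. -/
def IsTrigPoly (f : C(AddCircle (2 * π), ℂ)) : Prop :=
  f ∈ Submodule.span ℂ (Set.range (fourier (T := 2 * π)))

/-- The norm `|f|_{A_p} = (∑ m, |f_m| ^ p) ^ (1 / p)`, where `f_m` are the Fourier coefficients.
For a trigonometric polynomial and `p > 0` the sum has only finitely many non-zero terms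
(`IsTrigPoly.finite_support`). -/
def ApNorm (p : ℝ) (f : C(AddCircle (2 * π), ℂ)) : ℝ :=
  (∑' m : ℤ, ‖fourierCoeff f m‖ ^ p) ^ (1 / p)

/-- The partial Fourier sum `S_N(f) = ∑_{m = -N}^{N} f_m exp (i m t)`. -/
def partialFourierSum (N : ℕ) (f : C(AddCircle (2 * π), ℂ)) : C(AddCircle (2 * π), ℂ) :=
  ∑ m ∈ Finset.Icc (-(N : ℤ)) (N : ℤ), fourierCoeff f m • fourier m

theorem IsTrigPoly.finite_support {f : C(AddCircle (2 * π), ℂ)} (hf : IsTrigPoly f) :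
    (Function.support fun m : ℤ => fourierCoeff f m).Finite := by
  have hint : ∀ g : C(AddCircle (2 * π), ℂ), MeasureTheory.Integrable g
      (AddCircle.haarAddCircle (T := 2 * π)) := fun g =>
    g.continuous.integrable_of_hasCompactSupport (HasCompactSupport.of_compactSpace _)
  induction hf using Submodule.span_induction with
  | mem x hx =>
    obtain ⟨n, rfl⟩ := hx
    refine (Set.finite_singleton n).subset fun m hm => ?_
    by_contra h
    exact hm (by rw [fourierCoeff_fourier]; exact Pi.single_eq_of_ne h 1)
  | zero => simp [fourierCoeff]
  | add x y _ _ hx hy =>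
    refine (hx.union hy).subset fun m hm => ?_
    by_contra h
    simp only [Set.mem_union, Function.mem_support, not_or, not_not] at h
    refine hm ?_
    change fourierCoeff (⇑x + ⇑y) m = 0
    rw [fourierCoeff.add (hint x) (hint y), Pi.add_apply, h.1, h.2, add_zero]
  | smul a x _ hx =>
    refine hx.subset fun m hm h0 => hm ?_
    change fourierCoeff (a • ⇑x) m = 0
    rw [fourierCoeff.const_smul]
    simp [h0]

end

/-! Let `q` be the exponent conjugate to `p`. By Hausdorff–Young, bounds in `A_p` become bounds in
`L^q`. Suppose `P`, `Q` satisfy the four conditions with `ε` small. Then `P (Q - 1) = (P Q - 1) - (P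
- 1)` is small in `L²`, so `Q` is close to one wherever `P` is not too small, while `Q` has mean
zero. The proof builds a weight `0 ≤ X ≤ 1` with `∫ (1 - X) = O(ε^p)`, with `∫ X / |P|^(2n) = O(1)`
and with `∫ X Q = O(ε^p)`, up to replacing `P` and `Q` by arbitrarily good approximations. The first
two properties force `∫ X Q` to be close to `2π`, which contradicts the third (`exists_weight`,
`exists_not_localizingPair`).

Construction of `X`. Let `P_k` be the Gaussian low-pass part of `P` at frequency `L_k = 8 * 2^k`. A
function `G_k`, slowly varying at scale `1 / L_k`, is found such that `√G_k` dominates, up to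
constants, `P_(k+1) - P_k`, its normalized primitive and the normalized derivatives of `P_k`. With
`b_k = min(1, a² G_k / |P_k|²)`, the weight is updated by `X_(k+1) = X_k (1 - b_k)^3`: points where
`P_k` does not dominate its own oscillation are killed smoothly.

Negative moments. Expanding `|P_(k+1)|^(-2n)` around `P_k`, the linear term is integrated by parts,
gaining a factor `1 / a`, and the quadratic term is `O(b_k / a²)`. For large `a` both are paid for
by the mass killed at the same step and at earlier ones, so `∫ X_k / |P_k|^(2n)` never exceeds its
initial value (`exists_moment_bound`).

Losses, and the golden ratio. For `T` bounded in `L^q`, the loss `∫ X b T / |P|` is at most a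
multiple of `∫ X G^(p/2) |P|^(-(p+1)) T`. Hölder with exponents `p/q`, `θ`, `1/q` bounds it by a
multiple of `(∫ G^(q/2))^(p/q)`, which, apart from an arbitrarily small error, is proportional to
the `ℓ^p` mass of the coefficients of `P` around frequency `L_k`. These masses sum to at most `ε^p`.
A positive `θ` exists exactly when `(p + 1) / q < 1`, that is `p² < p + 1` (`integral_loss_mul_le`).

Pairing with `Q`. By Abel summation the bound on `P S_m(Q)` passes to `P` times any monotone cut-off
of `Q`. Filtering such a product by a Gaussian at four times the cut-off frequency and expanding the
cross term expresses it through `P_k`, its derivatives and the cut-off of `Q`. Where `P_k` dominates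
its derivatives this can be inverted: the cut-off is at most `2 T / |P_k|` with `T` bounded in `L^q`
(`exists_majorant`). For quadratic tapers `Q_k` of `Q`, the increment `Q_(k+1) - Q_k` is `4^(-k)`
times a second derivative of such a cut-off; two integrations by parts move the derivatives to
`X_(k+1)`, and the telescoped integral is bounded by the sum of the losses
(`norm_integral_X_mul_le`). -/

open Complex MeasureTheory

/-! ### Trigonometric sums on the line and Parseval's identity. -/

/-- The exponential `e^{inx}`. -/
noncomputable def ex (n : ℤ) (x : ℝ) : ℂ := Complex.exp (n * x * I)

/-- The trigonometric sum `∑_{n ∈ s} c n e^{inx}`. -/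
noncomputable def trig (s : Finset ℤ) (c : ℤ → ℂ) (x : ℝ) : ℂ := ∑ n ∈ s, c n * ex n x

lemma ex_add (m n : ℤ) (x : ℝ) : ex (m + n) x = ex m x * ex n x := by
  simp only [ex, ← Complex.exp_add]; congr 1; push_cast; ring

@[simp] lemma norm_ex (n : ℤ) (x : ℝ) : ‖ex n x‖ = 1 := by
  have : (n * x * I : ℂ) = ((n * x : ℝ) : ℂ) * I := by push_cast; ring
  rw [ex, this, Complex.norm_exp_ofReal_mul_I]

@[simp] lemma ex_zero_left (x : ℝ) : ex 0 x = 1 := by simp [ex]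

@[fun_prop] lemma continuous_ex (n : ℤ) : Continuous (ex n) := by unfold ex; fun_prop

@[fun_prop] lemma continuous_trig (s : Finset ℤ) (c : ℤ → ℂ) : Continuous (trig s c) := by
  unfold trig; fun_prop

lemma hasDerivAt_ex (n : ℤ) (x : ℝ) : HasDerivAt (ex n) (n * I * ex n x) x := by
  have h : HasDerivAt (fun x : ℝ => (n * x * I : ℂ)) (n * 1 * I) x :=
    ((Complex.ofRealCLM.hasDerivAt (x := x)).const_mul (n : ℂ)).mul_const I
  have := h.cexp
  unfold ex
  convert this using 1; ring

lemma hasDerivAt_trig (s : Finset ℤ) (c : ℤ → ℂ) (x : ℝ) :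
    HasDerivAt (trig s c) (trig s (fun n => n * I * c n) x) x := by
  have := HasDerivAt.fun_sum (u := s) (A := fun n => fun x => c n * ex n x)
    (fun n _ => (hasDerivAt_ex n x).const_mul (c n))
  unfold trig
  refine this.congr_deriv ?_
  exact Finset.sum_congr rfl fun n _ => by ring

lemma ex_periodic (n : ℤ) (x : ℝ) : ex n (x + 2 * π) = ex n x := by
  unfold ex
  rw [show (n * ((x + 2 * π : ℝ) : ℂ) * I) = n * x * I + n * (2 * π * I) by push_cast; ring]
  exact Complex.exp_periodic.int_mul n _

lemma trig_periodic (s : Finset ℤ) (c : ℤ → ℂ) : Function.Periodic (trig s c) (2 * π) :=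
  fun x => by simp [trig, ex_periodic]

lemma norm_trig_le (s : Finset ℤ) (c : ℤ → ℂ) (x : ℝ) : ‖trig s c x‖ ≤ ∑ n ∈ s, ‖c n‖ :=
  (norm_sum_le _ _).trans (Finset.sum_le_sum fun n _ => by simp)

lemma conj_ex (n : ℤ) (x : ℝ) : (starRingEnd ℂ) (ex n x) = ex (-n) x := by
  simp [ex, ← Complex.exp_conj]

lemma integral_ex (n : ℤ) : ∫ x in (0:ℝ)..2 * π, ex n x = if n = 0 then 2 * π else 0 := by
  split_ifs with h
  · subst h; simp
  · have h0 : (n * I : ℂ) ≠ 0 := by simp [h]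
    have := integral_exp_mul_complex (a := 0) (b := 2 * π) h0
    have h1 : ∀ x : ℝ, ex n x = Complex.exp (n * I * x) := fun x => by
      unfold ex; congr 1; ring
    simp only [h1, this]
    have : Complex.exp (n * I * ((2 * π : ℝ) : ℂ)) = 1 := by
      rw [Complex.exp_eq_one_iff]; exact ⟨n, by push_cast; ring⟩
    rw [this]; simp

lemma integral_norm_trig_sq (s : Finset ℤ) (c : ℤ → ℂ) :
    ∫ x in (0:ℝ)..2 * π, ‖trig s c x‖ ^ 2 = 2 * π * ∑ n ∈ s, ‖c n‖ ^ 2 := by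
  have key : ∫ x in (0:ℝ)..2 * π, ((‖trig s c x‖ ^ 2 : ℝ) : ℂ) =
      ((2 * π * ∑ n ∈ s, ‖c n‖ ^ 2 : ℝ) : ℂ) := by
    have h1 : ∀ x, ((‖trig s c x‖ ^ 2 : ℝ) : ℂ) =
        ∑ n ∈ s, ∑ m ∈ s, (c n * (starRingEnd ℂ) (c m)) * ex (n - m) x := by
      intro x
      push_cast
      rw [← Complex.mul_conj', trig, map_sum, Finset.sum_mul_sum]
      refine Finset.sum_congr rfl fun n _ => Finset.sum_congr rfl fun m _ => ?_
      rw [map_mul, conj_ex, sub_eq_add_neg, ex_add]; ring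
    simp only [h1]
    rw [intervalIntegral.integral_finsetSum
      (fun n _ => Continuous.intervalIntegrable (by fun_prop) _ _)]
    have h2 : ∀ n ∈ s, ∫ x in (0:ℝ)..2 * π, ∑ m ∈ s, (c n * (starRingEnd ℂ) (c m)) * ex (n - m) x
        = 2 * π * ((‖c n‖ ^ 2 : ℝ) : ℂ) := by
      intro n hn
      rw [intervalIntegral.integral_finsetSum
        (fun n _ => Continuous.intervalIntegrable (by fun_prop) _ _)]
      simp only [intervalIntegral.integral_const_mul, integral_ex]
      rw [Finset.sum_eq_single n]
      · simp [Complex.mul_conj']; ring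
      · intro m _ hm; rw [if_neg (by omega)]; simp
      · simp [hn]
    rw [Finset.sum_congr rfl h2, ← Finset.mul_sum]
    push_cast; ring
  rw [intervalIntegral.integral_ofReal] at key
  exact_mod_cast key

/-! ### Convexity and the Hausdorff–Young inequality. -/

/-- Weighted convexity of `t ↦ t ^ p`. -/
lemma rpow_sum_mul_le {ι : Type*} (s : Finset ι) {p : ℝ} (hp : 1 ≤ p) (w a : ι → ℝ)
    (hw : ∀ i ∈ s, 0 ≤ w i) (ha : ∀ i ∈ s, 0 ≤ a i) :
    (∑ i ∈ s, w i * a i) ^ p ≤ (∑ i ∈ s, w i) ^ (p - 1) * ∑ i ∈ s, w i * a i ^ p := by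
  have hp0 : 0 < p := by linarith
  classical
  let w' : ι → ℝ := fun i => if i ∈ s then w i else 0
  let a' : ι → ℝ := fun i => if i ∈ s then a i else 0
  have h := Real.inner_le_weight_mul_Lp_of_nonneg s hp w' a'
    (fun i => by dsimp [w']; split_ifs with h; exacts [hw i h, le_rfl])
    (fun i => by dsimp [a']; split_ifs with h; exacts [ha i h, le_rfl])
  have e1 : ∑ i ∈ s, w' i * a' i = ∑ i ∈ s, w i * a i :=
    Finset.sum_congr rfl fun i hi => by simp [w', a', hi]
  have e2 : ∑ i ∈ s, w' i = ∑ i ∈ s, w i := Finset.sum_congr rfl fun i hi => by simp [w', hi]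
  have e3 : ∑ i ∈ s, w' i * a' i ^ p = ∑ i ∈ s, w i * a i ^ p :=
    Finset.sum_congr rfl fun i hi => by simp [w', a', hi]
  rw [e1, e2, e3] at h
  have n1 : 0 ≤ ∑ i ∈ s, w i * a i := Finset.sum_nonneg fun i hi => mul_nonneg (hw i hi) (ha i hi)
  have n2 : 0 ≤ ∑ i ∈ s, w i := Finset.sum_nonneg hw
  have n3 : 0 ≤ ∑ i ∈ s, w i * a i ^ p :=
    Finset.sum_nonneg fun i hi => mul_nonneg (hw i hi) (Real.rpow_nonneg (ha i hi) _)
  refine (Real.rpow_le_rpow n1 h hp0.le).trans_eq ?_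
  rw [Real.mul_rpow (Real.rpow_nonneg n2 _) (Real.rpow_nonneg n3 _), ← Real.rpow_mul n2,
    ← Real.rpow_mul n3, inv_mul_cancel₀ hp0.ne', Real.rpow_one, sub_mul, one_mul,
    inv_mul_cancel₀ hp0.ne']

lemma lintegral_rpow_Ioc {a τ : ℝ} (ha : -1 < a) (hτ : 0 ≤ τ) :
    ∫⁻ t in Set.Ioc 0 τ, ENNReal.ofReal (t ^ a) = ENNReal.ofReal (τ ^ (a + 1) / (a + 1)) := by
  rw [← ofReal_integral_eq_lintegral_ofReal]
  · rw [← intervalIntegral.integral_of_le hτ, integral_rpow (Or.inl ha),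
      Real.zero_rpow (by linarith), sub_zero]
  · exact ((intervalIntegral.intervalIntegrable_rpow' ha).1)
  · exact (ae_restrict_mem measurableSet_Ioc).mono fun t ht => Real.rpow_nonneg ht.1.le _

/-- The part of a trigonometric sum above a given height. -/
lemma measure_lt_norm_trig_le {p : ℝ} (s : Finset ℤ) (c : ℤ → ℂ)
    (hc : ∑ n ∈ s, ‖c n‖ ^ p = 1) {t : ℝ} (ht : 0 < t) :
    (volume.restrict (Set.Ioc 0 (2 * π))) {x | t < ‖trig s c x‖} ≤
      ENNReal.ofReal (∑ n ∈ s, if t ≤ 2 * ‖c n‖ ^ (1 - p) then 8 * π * ‖c n‖ ^ 2 / t ^ 2 else 0) := by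
  classical
  -- Coefficients outside `A` satisfy `‖c n‖ ≤ (t / 2) * ‖c n‖ ^ p`, so their sum is at most `t / 2`
  -- everywhere. Those in `A` must then exceed `t / 2`, and Parseval with Chebyshev's inequality
  -- applies to them.
  let A : ℤ → Prop := fun n => t ≤ 2 * ‖c n‖ ^ (1 - p)
  let c1 : ℤ → ℂ := fun n => if A n then c n else 0
  let c2 : ℤ → ℂ := fun n => if A n then 0 else c n
  have hsum : ∀ x, trig s c x = trig s c1 x + trig s c2 x := by
    intro x
    simp only [trig, ← Finset.sum_add_distrib, c1, c2]
    refine Finset.sum_congr rfl fun n _ => ?_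
    split_ifs <;> simp
  have hlarge : ∀ x, ‖trig s c2 x‖ ≤ t / 2 := by
    intro x
    refine (norm_trig_le _ _ _).trans ?_
    have : ∀ n ∈ s, ‖c2 n‖ ≤ (t / 2) * ‖c n‖ ^ p := by
      intro n _
      dsimp only [c2]
      split_ifs with h
      · simp; positivity
      · rcases (norm_nonneg (c n)).eq_or_lt with h0 | h0
        · rw [← h0]; positivity
        · have h1 : ‖c n‖ ^ (1 - p) ≤ t / 2 := by
            have := not_le.1 h; linarith
          calc ‖c n‖ = ‖c n‖ ^ (1 - p) * ‖c n‖ ^ p := by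
                rw [← Real.rpow_add h0]; simp
            _ ≤ _ := by gcongr
    refine (Finset.sum_le_sum this).trans ?_
    rw [← Finset.mul_sum, hc, mul_one]
  have hsub : {x | t < ‖trig s c x‖} ⊆ {x | ENNReal.ofReal ((t / 2) ^ 2) ≤
      ENNReal.ofReal (‖trig s c1 x‖ ^ 2)} := by
    intro x hx
    have h1 : t < ‖trig s c x‖ := hx
    rw [hsum] at h1
    have := norm_add_le (trig s c1 x) (trig s c2 x)
    have h2 := hlarge x
    refine ENNReal.ofReal_le_ofReal ?_
    gcongr
    linarith
  refine (measure_mono hsub).trans ?_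
  have hm := mul_meas_ge_le_lintegral₀ (μ := volume.restrict (Set.Ioc 0 (2 * π)))
    (f := fun x => ENNReal.ofReal (‖trig s c1 x‖ ^ 2))
    (ENNReal.continuous_ofReal.comp (by fun_prop)).aemeasurable (ENNReal.ofReal ((t / 2) ^ 2))
  rw [← ofReal_integral_eq_lintegral_ofReal, ← intervalIntegral.integral_of_le (by positivity),
    integral_norm_trig_sq] at hm
  · have h0 : ENNReal.ofReal ((t / 2) ^ 2) ≠ 0 := by
      simp only [ne_eq, ENNReal.ofReal_eq_zero, not_le]; positivity
    rw [mul_comm, ← ENNReal.le_div_iff_mul_le (Or.inl h0) (Or.inl ENNReal.ofReal_ne_top),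
      ← ENNReal.ofReal_div_of_pos (by positivity)] at hm
    refine hm.trans (ENNReal.ofReal_le_ofReal ?_)
    rw [mul_div_assoc, Finset.sum_div, Finset.mul_sum]
    refine (Finset.sum_le_sum fun n _ => ?_)
    dsimp only [c1, A]
    split_ifs
    · apply le_of_eq; field_simp; ring
    · simp
  · exact (Continuous.intervalIntegrable (by fun_prop) 0 (2 * π)).1
  · exact Filter.Eventually.of_forall fun x => by positivity

/-- Layer-cake formula combined with the distributional bound. The coefficient `c n` contributes a
multiple of `‖c n‖² t^(q-3)`, only for `t ≤ 2 ‖c n‖^(1-p)`; integration in `t` gives a multiple of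
`‖c n‖^(2 + (1-p)(q-2)) = ‖c n‖^p`. -/
lemma hausdorff_young_normalized {p q : ℝ} (hp : 1 < p) (hp2 : p < 2) (hq : q = p / (p - 1))
    (s : Finset ℤ) (c : ℤ → ℂ) (hc : ∑ n ∈ s, ‖c n‖ ^ p = 1) :
    ∫ x in (0:ℝ)..2 * π, ‖trig s c x‖ ^ q ≤ q * (8 * π * 2 ^ (q - 2) / (q - 2)) := by
  have hp1 : 0 < p - 1 := by linarith
  have hq2 : 2 < q := by rw [hq, lt_div_iff₀ hp1]; linarith
  have hexp : 2 + (1 - p) * (q - 2) = p := by rw [hq]; field_simp; ring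
  have hf : Continuous fun x => ‖trig s c x‖ ^ q :=
    Continuous.rpow_const (by fun_prop) fun x => Or.inr (by linarith)
  rw [intervalIntegral.integral_of_le (by positivity)]
  have hint : Integrable (fun x => ‖trig s c x‖ ^ q) (volume.restrict (Set.Ioc 0 (2 * π))) :=
    (hf.intervalIntegrable 0 (2 * π)).1
  have hnn : 0 ≤ q * (8 * π * 2 ^ (q - 2) / (q - 2)) := by
    have : 0 < q - 2 := by linarith
    positivity
  rw [← ENNReal.ofReal_le_ofReal_iff hnn, ofReal_integral_eq_lintegral_ofReal hint
    (Filter.Eventually.of_forall fun x => by positivity),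
    lintegral_rpow_eq_lintegral_meas_lt_mul _ (Filter.Eventually.of_forall fun x => norm_nonneg _)
      (Continuous.aemeasurable (by fun_prop)) (by linarith), ENNReal.ofReal_mul (by linarith)]
  gcongr
  set τ : ℤ → ℝ := fun n => 2 * ‖c n‖ ^ (1 - p) with hτ
  have hτ0 : ∀ n, 0 ≤ τ n := fun n => by positivity
  calc ∫⁻ t in Set.Ioi 0, (volume.restrict (Set.Ioc 0 (2 * π))) {a | t < ‖trig s c a‖} *
        ENNReal.ofReal (t ^ (q - 1))
      ≤ ∫⁻ t in Set.Ioi 0, ∑ n ∈ s, ENNReal.ofReal (8 * π * ‖c n‖ ^ 2) *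
        (Set.Ioc 0 (τ n)).indicator (fun t => ENNReal.ofReal (t ^ (q - 3))) t := by
        refine setLIntegral_mono_ae' measurableSet_Ioi (Filter.Eventually.of_forall fun t ht => ?_)
        have ht : 0 < t := ht
        refine (mul_le_mul_left (measure_lt_norm_trig_le s c hc ht) _).trans_eq ?_
        rw [ENNReal.ofReal_sum_of_nonneg (fun n _ => by split_ifs <;> positivity), Finset.sum_mul]
        refine Finset.sum_congr rfl fun n _ => ?_
        simp only [Set.indicator, Set.mem_Ioc, ht, true_and, hτ]
        split_ifs with h
        · rw [← ENNReal.ofReal_mul (by positivity), ← ENNReal.ofReal_mul (by positivity)]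
          congr 1
          rw [show q - 3 = (q - 1) - (2:ℕ) by push_cast; ring, Real.rpow_sub_natCast ht.ne']
          ring
        · simp
    _ = ∑ n ∈ s, ENNReal.ofReal (8 * π * ‖c n‖ ^ 2) *
        ENNReal.ofReal (τ n ^ (q - 2) / (q - 2)) := by
        have hmeas : Measurable fun t : ℝ => ENNReal.ofReal (t ^ (q - 3)) := by fun_prop
        rw [lintegral_finsetSum _ fun n _ =>
          (hmeas.indicator measurableSet_Ioc).const_mul _]
        refine Finset.sum_congr rfl fun n _ => ?_
        rw [lintegral_const_mul _ (hmeas.indicator measurableSet_Ioc),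
          lintegral_indicator measurableSet_Ioc, Measure.restrict_restrict measurableSet_Ioc,
          Set.inter_eq_self_of_subset_left Set.Ioc_subset_Ioi_self,
          lintegral_rpow_Ioc (by linarith) (hτ0 n)]
        ring_nf
    _ ≤ ENNReal.ofReal (8 * π * 2 ^ (q - 2) / (q - 2)) := by
        have h2 : 0 < q - 2 := by linarith
        rw [Finset.sum_congr rfl fun n _ => (ENNReal.ofReal_mul (p := 8 * π * ‖c n‖ ^ 2)
          (q := τ n ^ (q - 2) / (q - 2)) (by positivity)).symm]
        rw [← ENNReal.ofReal_sum_of_nonneg]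
        · refine ENNReal.ofReal_le_ofReal ?_
          rw [show 8 * π * 2 ^ (q - 2) / (q - 2) = 8 * π * 2 ^ (q - 2) / (q - 2) * ∑ n ∈ s, ‖c n‖ ^ p
            by rw [hc, mul_one], Finset.mul_sum]
          refine Finset.sum_le_sum fun n _ => ?_
          rcases (norm_nonneg (c n)).eq_or_lt with h0 | h0
          · rw [← h0, Real.zero_rpow (by linarith)]; simp
          · simp only [hτ]
            rw [Real.mul_rpow (by norm_num) (by positivity), ← Real.rpow_mul h0.le]
            apply le_of_eq
            have : ‖c n‖ ^ p = ‖c n‖ ^ 2 * ‖c n‖ ^ ((1 - p) * (q - 2)) := by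
              rw [← Real.rpow_natCast, ← Real.rpow_add h0]; push_cast; rw [hexp]
            rw [this]; ring
        · intro n _
          have := hτ0 n
          positivity

/-- The Hausdorff–Young inequality for trigonometric sums, with a non-sharp constant. -/
lemma exists_hausdorff_young {p q : ℝ} (hp : 1 < p) (hp2 : p < 2) (hq : q = p / (p - 1)) :
    ∃ K : ℝ, 0 < K ∧ ∀ (s : Finset ℤ) (c : ℤ → ℂ),
      ∫ x in (0:ℝ)..2 * π, ‖trig s c x‖ ^ q ≤ K * (∑ n ∈ s, ‖c n‖ ^ p) ^ (q / p) := by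
  have hp1 : 0 < p - 1 := by linarith
  have hq2 : 2 < q := by rw [hq, lt_div_iff₀ hp1]; linarith
  have h2 : 0 < q - 2 := by linarith
  refine ⟨q * (8 * π * 2 ^ (q - 2) / (q - 2)), by positivity, fun s c => ?_⟩
  set B := ∑ n ∈ s, ‖c n‖ ^ p with hB
  have hB0 : 0 ≤ B := Finset.sum_nonneg fun n _ => by positivity
  rcases hB0.eq_or_lt with h0 | h0
  · have hz : ∀ n ∈ s, c n = 0 := by
      intro n hn
      have := (Finset.sum_eq_zero_iff_of_nonneg
        (fun n _ => Real.rpow_nonneg (norm_nonneg (c n)) p)).1 (hB.symm.trans h0.symm) n hn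
      rwa [Real.rpow_eq_zero (norm_nonneg _) (by linarith), norm_eq_zero] at this
    have : ∀ x, trig s c x = 0 := fun x => Finset.sum_eq_zero fun n hn => by simp [hz n hn]
    simp only [this, norm_zero, Real.zero_rpow (show q ≠ 0 by linarith),
      intervalIntegral.integral_zero]
    positivity
  · set b := B ^ (1 / p) with hb
    have hb0 : 0 < b := by positivity
    have hbp : b ^ p = B := by
      rw [hb, ← Real.rpow_mul hB0, one_div_mul_cancel (by linarith), Real.rpow_one]
    have hbq : b ^ q = B ^ (q / p) := by
      rw [hb, ← Real.rpow_mul hB0]; congr 1; ring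
    have h := hausdorff_young_normalized hp hp2 hq s (fun n => c n / b) (by
      have : ∀ n, ‖c n / b‖ ^ p = ‖c n‖ ^ p / B := fun n => by
        rw [norm_div, Complex.norm_real, Real.norm_of_nonneg hb0.le,
          Real.div_rpow (norm_nonneg _) hb0.le, hbp]
      simp only [this, ← Finset.sum_div, ← hB]
      exact div_self h0.ne')
    have h3 : ∀ x, ‖trig s c x‖ ^ q = B ^ (q / p) * ‖trig s (fun n => c n / b) x‖ ^ q := by
      intro x
      rw [← hbq, ← Real.mul_rpow hb0.le (norm_nonneg _)]
      congr 1
      have : trig s c x = b * trig s (fun n => c n / b) x := by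
        simp only [trig, Finset.mul_sum]
        refine Finset.sum_congr rfl fun n _ => ?_
        have : (b : ℂ) ≠ 0 := by exact_mod_cast hb0.ne'
        field_simp
      rw [this, norm_mul, Complex.norm_real, Real.norm_of_nonneg hb0.le]
    simp only [h3, intervalIntegral.integral_const_mul]
    rw [mul_comm]
    gcongr


/-! ### Products of `P` with cut-offs of `Q`: Abel summation. -/

/-- The convolution of the coefficients `a` on `s` with `b`. -/
noncomputable def cv (s : Finset ℤ) (a b : ℤ → ℂ) (n : ℤ) : ℂ := ∑ m ∈ s, a m * b (n - m)

lemma sum_mul_cv {s S : Finset ℤ} (hS : ∀ a ∈ s, ∀ b ∈ s, a + b ∈ S) (a b : ℤ → ℂ)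
    (hb : ∀ n, n ∉ s → b n = 0) (F : ℤ → ℂ) :
    ∑ n ∈ S, F n * cv s a b n = ∑ m ∈ s, ∑ l ∈ s, F (m + l) * (a m * b l) := by
  simp only [cv, Finset.mul_sum]
  rw [Finset.sum_comm]
  refine Finset.sum_congr rfl fun m hm => ?_
  symm
  refine Finset.sum_of_injOn (fun l => m + l) (fun x _ y _ h => by simpa using h)
    (fun l hl => by simpa using hS m hm l hl) ?_ (fun l _ => by simp)
  intro n hn h
  rw [hb (n - m) (fun h' => h ⟨n - m, by simpa using h', by simp⟩)]
  simp

/-- Abel summation: `μ |j|` is the sum of `μ m - μ (m + 1)` over `|j| ≤ m < M`. -/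
lemma cv_eq_sum_truncations (s : Finset ℤ) (q b : ℤ → ℂ) (μ : ℕ → ℝ) (M : ℕ)
    (hμ : ∀ m, M ≤ m → μ m = 0) (n : ℤ) :
    cv s (fun j => (μ j.natAbs : ℂ) * q j) b n =
      ∑ m ∈ Finset.range M, ((μ m - μ (m + 1) : ℝ) : ℂ) *
        cv s (fun j => if j.natAbs ≤ m then q j else 0) b n := by
  simp only [cv, Finset.mul_sum]
  rw [Finset.sum_comm]
  refine Finset.sum_congr rfl fun j _ => ?_
  have h1 : (μ j.natAbs : ℂ) =
      ∑ m ∈ Finset.range M, if j.natAbs ≤ m then ((μ m - μ (m + 1) : ℝ) : ℂ) else 0 := by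
    have : μ j.natAbs = ∑ m ∈ Finset.range M, if j.natAbs ≤ m then (μ m - μ (m + 1)) else 0 := by
      rw [← Finset.sum_filter]
      have : Finset.filter (fun m => j.natAbs ≤ m) (Finset.range M) = Finset.Ico j.natAbs M := by
        ext m; simp; tauto
      rw [this]
      rcases le_total j.natAbs M with h | h
      · have := Finset.sum_Ico_sub μ h
        rw [hμ M le_rfl] at this
        rw [← neg_inj, ← Finset.sum_neg_distrib]; simpa using this.symm
      · rw [Finset.Ico_eq_empty_of_le h, hμ _ h]; simp
    rw [this]; push_cast
    exact Finset.sum_congr rfl fun m _ => by split_ifs <;> simp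
  rw [h1, Finset.sum_mul, Finset.sum_mul]
  refine Finset.sum_congr rfl fun m _ => ?_
  split_ifs <;> ring

/-- The triangle inequality in `ℓ^p`, in the convexity form `rpow_sum_mul_le`, applied to the Abel
summation. A bound for all partial sums thus passes to any multiplier in `|j|`, at the price of its
total variation. -/
lemma sum_norm_cv_rpow_le {s S : Finset ℤ} {q b : ℤ → ℂ} {p C : ℝ} (hp : 1 < p) (hC : 0 ≤ C)
    (hT : ∀ m : ℕ, ∑ n ∈ S, ‖cv s (fun j => if j.natAbs ≤ m then q j else 0) b n‖ ^ p ≤ C ^ p)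
    (μ : ℕ → ℝ) (M : ℕ) (hμ : ∀ m, M ≤ m → μ m = 0) (V : ℝ)
    (hV : ∑ m ∈ Finset.range M, |μ m - μ (m + 1)| ≤ V) :
    ∑ n ∈ S, ‖cv s (fun j => (μ j.natAbs : ℂ) * q j) b n‖ ^ p ≤ (V * C) ^ p := by
  have hV0 : 0 ≤ ∑ m ∈ Finset.range M, |μ m - μ (m + 1)| := by positivity
  set W := ∑ m ∈ Finset.range M, |μ m - μ (m + 1)| with hW
  have h1 : ∀ n, ‖cv s (fun j => (μ j.natAbs : ℂ) * q j) b n‖ ^ p ≤ W ^ (p - 1) *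
      ∑ m ∈ Finset.range M, |μ m - μ (m + 1)| *
        ‖cv s (fun j => if j.natAbs ≤ m then q j else 0) b n‖ ^ p := by
    intro n
    refine le_trans ?_ (rpow_sum_mul_le (Finset.range M) hp.le (fun m => |μ m - μ (m + 1)|)
      (fun m => ‖cv s (fun j => if j.natAbs ≤ m then q j else 0) b n‖)
      (fun _ _ => abs_nonneg _) (fun _ _ => norm_nonneg _))
    refine Real.rpow_le_rpow (norm_nonneg _) ?_ (by linarith)
    rw [cv_eq_sum_truncations s q b μ M hμ]
    refine (norm_sum_le _ _).trans_eq (Finset.sum_congr rfl fun m _ => ?_)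
    rw [norm_mul, Complex.norm_real, Real.norm_eq_abs]
  refine (Finset.sum_le_sum fun n _ => h1 n).trans ?_
  rw [← Finset.mul_sum, Finset.sum_comm]
  simp only [← Finset.mul_sum]
  have h2 : ∑ m ∈ Finset.range M, |μ m - μ (m + 1)| * ∑ n ∈ S,
      ‖cv s (fun j => if j.natAbs ≤ m then q j else 0) b n‖ ^ p ≤ W * C ^ p := by
    rw [hW, Finset.sum_mul]
    exact Finset.sum_le_sum fun m _ => mul_le_mul_of_nonneg_left (hT m) (abs_nonneg _)
  refine (mul_le_mul_of_nonneg_left h2 (Real.rpow_nonneg hV0 _)).trans ?_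
  rw [← mul_assoc]
  have h3 : W ^ (p - 1) * W = W ^ p := by
    rw [← Real.rpow_add_one' hV0 (by linarith)]; congr 1; ring
  rw [h3, ← Real.mul_rpow hV0 hC]
  exact Real.rpow_le_rpow (by positivity) (by gcongr) (by linarith)

/-- Total variation of a decreasing cut-off times an increasing function. -/
lemma sum_abs_sub_mul_le (ρ β : ℕ → ℝ) (M : ℕ) (hρ : Antitone ρ) (hρ1 : ∀ m, ρ m ≤ 1)
    (hρ0 : ∀ m, 0 ≤ ρ m) (hβ : Monotone β) (hβ0 : 0 ≤ β 0) {B : ℝ}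
    (hβM : β M ≤ B) :
    ∑ m ∈ Finset.range M, |ρ m * β m - ρ (m + 1) * β (m + 1)| ≤ 2 * B := by
  have h : ∀ m ∈ Finset.range M, |ρ m * β m - ρ (m + 1) * β (m + 1)| ≤
      (β (m + 1) - β m) + B * (ρ m - ρ (m + 1)) := by
    intro m hm
    have h1 : β m ≤ β (m + 1) := hβ (Nat.le_succ m)
    have h2 : ρ (m + 1) ≤ ρ m := hρ (Nat.le_succ m)
    have h3 : 0 ≤ β m := hβ0.trans (hβ (Nat.zero_le m))
    have h4 : β m ≤ B := (hβ (Finset.mem_range.1 hm).le).trans hβM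
    have h5 := hρ1 (m + 1)
    have h6 := hρ0 (m + 1)
    rw [show ρ m * β m - ρ (m + 1) * β (m + 1) =
      (ρ m - ρ (m + 1)) * β m - ρ (m + 1) * (β (m + 1) - β m) by ring]
    refine (abs_sub _ _).trans ?_
    rw [abs_of_nonneg (by apply mul_nonneg <;> linarith),
      abs_of_nonneg (by apply mul_nonneg <;> linarith)]
    have h7 : (ρ m - ρ (m + 1)) * β m ≤ B * (ρ m - ρ (m + 1)) := by
      rw [mul_comm]; gcongr
    have h8 : ρ (m + 1) * (β (m + 1) - β m) ≤ 1 * (β (m + 1) - β m) := by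
      gcongr
    linarith
  refine (Finset.sum_le_sum h).trans ?_
  rw [Finset.sum_add_distrib, ← Finset.mul_sum, Finset.sum_range_sub, Finset.sum_range_sub']
  have hB : 0 ≤ B := hβ0.trans ((hβ (Nat.zero_le M)).trans hβM)
  have := hρ1 0
  have := hρ0 M
  nlinarith

/-! ### Local control of cut-offs of `Q` by the low-pass parts of `P`. -/

/-- Bootstrapping of a family of identities with a dominant zeroth term. -/
lemma norm_zero_le_of_hasSum {f Z A B : ℕ → ℂ} {D : ℕ → ℂ} {b S T : ℝ}
    (hZ : ∀ j, ‖Z j‖ ≤ b)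
    (hA : ∀ j, HasSum (fun i => ((-1 / 2) ^ i / (i.factorial : ℂ)) * (f i * Z (i + j))) (A j))
    (hB : ∀ j, HasSum (fun i => ((-1 / 2) ^ i / (i.factorial : ℂ)) * (f (i + 1) * Z (i + j))) (B j))
    (hD : ∀ j, D j = (1 / 4) * A (j + 1) + B j)
    (hS : HasSum (fun i => ‖f (i + 1)‖ / (i.factorial : ℝ)) S) (hS0 : 3 * S ≤ ‖f 0‖ / 2)
    (hf : 0 < ‖f 0‖)
    (hT : ∀ j, ‖A (2 * j)‖ + 4 * ‖D (2 * j)‖ ≤ 4 ^ j * T) :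
    ‖Z 0‖ ≤ 2 / ‖f 0‖ * T := by
  -- The weight `2 ^ j` is matched to the coefficients `(1 / 2) ^ i`: since `(1 / 2) ^ i * ‖Z (i +
  -- j)‖ ≤ 2 ^ j * N`, the remainders of both expansions are at most `2 ^ j * N * S`.
  set N : ℝ := ⨆ j, ‖Z j‖ / 2 ^ j with hN
  have hbdd : BddAbove (Set.range fun j => ‖Z j‖ / 2 ^ j) := by
    refine ⟨b, ?_⟩
    rintro _ ⟨j, rfl⟩
    exact (div_le_self (norm_nonneg _) (one_le_pow₀ (by norm_num))).trans (hZ j)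
  have hZN : ∀ j, ‖Z j‖ ≤ 2 ^ j * N := by
    intro j
    have := le_ciSup hbdd j
    rw [mul_comm]
    exact (div_le_iff₀ (by positivity)).1 this
  have hN0 : 0 ≤ N := (by positivity : 0 ≤ ‖Z 0‖ / 2 ^ 0).trans (le_ciSup hbdd 0)
  have hS1 : 0 ≤ S := hS.nonneg fun i => by positivity
  have hnorm : ∀ i : ℕ, ‖((-1 / 2) ^ i / (i.factorial : ℂ))‖ = (1 / 2) ^ i / (i.factorial : ℝ) := by
    intro i; simp
  have hBj : ∀ j, ‖B j‖ ≤ 2 ^ j * N * S := by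
    intro j
    refine HasSum.norm_le_of_bounded (hB j) (hS.mul_left (2 ^ j * N)) fun i => ?_
    rw [norm_mul, norm_mul, hnorm]
    have := hZN (i + j)
    calc (1 / 2) ^ i / (i.factorial : ℝ) * (‖f (i + 1)‖ * ‖Z (i + j)‖)
        ≤ (1 / 2) ^ i / (i.factorial : ℝ) * (‖f (i + 1)‖ * (2 ^ (i + j) * N)) := by gcongr
      _ = ((1 / 2) ^ i * 2 ^ i) * (2 ^ j * N * (‖f (i + 1)‖ / i.factorial)) := by rw [pow_add]; ring
      _ = _ := by rw [← mul_pow]; norm_num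
  have hAj : ∀ j, ‖f 0 * Z j‖ ≤ ‖A j‖ + 2 ^ j * N * S := by
    intro j
    have h1 := (hasSum_nat_add_iff' 1).2 (hA j)
    have h2 : ‖A j - f 0 * Z j‖ ≤ 2 ^ j * N * S := by
      have h3 : A j - f 0 * Z j = A j - ∑ i ∈ Finset.range 1,
          ((-1 / 2) ^ i / (i.factorial : ℂ)) * (f i * Z (i + j)) := by simp
      rw [h3]
      refine HasSum.norm_le_of_bounded h1 (hS.mul_left (2 ^ j * N)) fun i => ?_
      rw [norm_mul, norm_mul, hnorm]
      have := hZN (i + 1 + j)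
      calc (1 / 2) ^ (i + 1) / ((i + 1).factorial : ℝ) * (‖f (i + 1)‖ * ‖Z (i + 1 + j)‖)
          ≤ (1 / 2) ^ (i + 1) / (i.factorial : ℝ) * (‖f (i + 1)‖ * (2 ^ (i + 1 + j) * N)) := by
            gcongr; omega
        _ = ((1 / 2) ^ (i + 1) * 2 ^ (i + 1)) * (2 ^ j * N * (‖f (i + 1)‖ / i.factorial)) := by
            rw [pow_add 2 (i + 1)]; ring
        _ = _ := by rw [← mul_pow]; norm_num
    have := norm_sub_norm_le (f 0 * Z j) (A j)
    rw [norm_sub_rev] at this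
    linarith
  -- For even `j` the hypothesis `hT` bounds `A j`. For `j = 2i + 1` one uses `A j = 4 D (2i) - 4 B
  -- (2i)`; after division by `2 ^ j` the term `B` costs `2 N S`, and the expansion of `A j` around
  -- `f 0 * Z j` costs another `N S`.
  have hmain : ∀ j, ‖Z j‖ / 2 ^ j ≤ (T + 3 * N * S) / ‖f 0‖ := by
    intro j
    rw [le_div_iff₀ hf, div_mul_eq_mul_div, div_le_iff₀ (by positivity), mul_comm, ← norm_mul]
    have hNS : 0 ≤ N * S := by positivity
    rcases Nat.even_or_odd' j with ⟨i, rfl | rfl⟩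
    · have h1 := hAj (2 * i)
      have h2 := hT i
      have h3 := norm_nonneg (D (2 * i))
      have h4 : (2 : ℝ) ^ (2 * i) = 4 ^ i := by rw [pow_mul]; norm_num
      have h5 : (0 : ℝ) < 4 ^ i := by positivity
      rw [h4] at h1 ⊢
      nlinarith
    · have h1 := hAj (2 * i + 1)
      have h2 := hT i
      have h3 := norm_nonneg (A (2 * i))
      have h4 : (2 : ℝ) ^ (2 * i) = 4 ^ i := by rw [pow_mul]; norm_num
      have h5 : (0 : ℝ) < 4 ^ i := by positivity
      have h6 := hBj (2 * i)
      have h7 : ‖A (2 * i + 1)‖ ≤ 4 * ‖D (2 * i)‖ + 4 * ‖B (2 * i)‖ := by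
        have : A (2 * i + 1) = 4 * D (2 * i) - 4 * B (2 * i) := by rw [hD]; ring
        rw [this]
        refine (norm_sub_le _ _).trans ?_
        simp
      rw [pow_succ, h4] at h1 ⊢
      rw [h4] at h6
      have h8 : 0 ≤ T := by
        have : 0 ≤ 4 ^ i * T := (by positivity : 0 ≤ ‖A (2 * i)‖ + 4 * ‖D (2 * i)‖).trans h2
        exact nonneg_of_mul_nonneg_right this h5
      nlinarith [mul_nonneg h5.le h8]
  -- By `hS0`, the term `3 N S` is at most half of `N ‖f 0‖` and is absorbed on the left.
  have hNle : N ≤ (T + 3 * N * S) / ‖f 0‖ := ciSup_le hmain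
  rw [le_div_iff₀ hf] at hNle
  have h0 := hZN 0
  rw [pow_zero, one_mul] at h0
  rw [div_mul_eq_mul_div, le_div_iff₀ hf]
  nlinarith [mul_le_mul_of_nonneg_left hS0 hN0, mul_le_mul_of_nonneg_right h0 hf.le]


/-- The Gaussian low-pass filter at scale `L`, with an extra frequency factor `(n / L) ^ i`. -/
noncomputable def lowPass (s : Finset ℤ) (L : ℝ) (p : ℤ → ℂ) (i : ℕ) : ℝ → ℂ :=
  trig s fun n => (((n / L) ^ i * Real.exp (-(n / L) ^ 2) : ℝ) : ℂ) * p n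

/-- The sum with cut-off `ρ` and an extra frequency factor `(n / M) ^ j`. -/
noncomputable def cutSum (s : Finset ℤ) (M : ℝ) (ρ : ℕ → ℝ) (q : ℤ → ℂ) (j : ℕ) : ℝ → ℂ :=
  trig s fun n => ((ρ n.natAbs * (n / M) ^ j : ℝ) : ℂ) * q n

/-- The filtered product of a cut-off sum of `q` and the sum of `p`. -/
noncomputable def mixed (s : Finset ℤ) (M : ℝ) (ρ : ℕ → ℝ) (q p : ℤ → ℂ) (l j : ℕ) (x : ℝ) : ℂ :=
  ∑ a ∈ s, ∑ b ∈ s, ((Real.exp (-((a + b) / (4 * M)) ^ 2) * (b / (4 * M)) ^ l *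
    (ρ a.natAbs * (a / M) ^ j * Real.exp ((a / (4 * M)) ^ 2)) : ℝ) : ℂ) * (q a * p b) * ex (a + b) x

/-- The weight `exp((a/4M)²)` in `mixed` is there to complete the square: what remains is
`exp(-(b/4M)²)` times the cross term `exp(-(a/M)(b/4M)/2)`, whose Taylor series separates `a` from
`b`. -/
lemma hasSum_mixed (s : Finset ℤ) {M : ℝ} (hM : M ≠ 0) (ρ : ℕ → ℝ) (q p : ℤ → ℂ) (l j : ℕ) (x : ℝ) :
    HasSum (fun i => ((-1 / 2) ^ i / (i.factorial : ℂ)) *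
      (lowPass s (4 * M) p (i + l) x * cutSum s M ρ q (i + j) x)) (mixed s M ρ q p l j x) := by
  have hterm : ∀ a ∈ s, ∀ b ∈ s, HasSum (fun i : ℕ => ((-1 / 2) ^ i / (i.factorial : ℂ)) *
      (((((b / (4 * M)) ^ (i + l) * Real.exp (-(b / (4 * M)) ^ 2) : ℝ) : ℂ) * p b * ex b x) *
      ((((ρ a.natAbs * (a / M) ^ (i + j) : ℝ) : ℂ) * q a) * ex a x)))
      (((Real.exp (-((a + b) / (4 * M)) ^ 2) * (b / (4 * M)) ^ l *
    (ρ a.natAbs * (a / M) ^ j * Real.exp ((a / (4 * M)) ^ 2)) : ℝ) : ℂ) * (q a * p b) * ex (a + b) x) := by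
    intro a _ b _
    have h1 : HasSum (fun i : ℕ => (-1 / 2 * (a / M) * (b / (4 * M))) ^ i / (i.factorial : ℝ))
        (Real.exp (-1 / 2 * (a / M) * (b / (4 * M)))) := by
      rw [Real.exp_eq_exp_ℝ]; exact NormedSpace.expSeries_div_hasSum_exp _
    have h2 := (Complex.hasSum_ofReal.2 h1).mul_left
      ((((b / (4 * M)) ^ l * Real.exp (-(b / (4 * M)) ^ 2) * (ρ a.natAbs * (a / M) ^ j) : ℝ) : ℂ) *
        (p b * q a) * (ex a x * ex b x))
    have e : ((Real.exp (-((a + b) / (4 * M)) ^ 2) * (b / (4 * M)) ^ l *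
        (ρ a.natAbs * (a / M) ^ j * Real.exp ((a / (4 * M)) ^ 2)) : ℝ) : ℂ) * (q a * p b) *
          ex (a + b) x =
        (((b / (4 * M)) ^ l * Real.exp (-(b / (4 * M)) ^ 2) * (ρ a.natAbs * (a / M) ^ j) : ℝ) : ℂ) *
        (p b * q a) * (ex a x * ex b x) * (Real.exp (-1 / 2 * (a / M) * (b / (4 * M))) : ℝ) := by
      rw [ex_add]
      have : Real.exp (-((a + b) / (4 * M)) ^ 2) * Real.exp ((a / (4 * M)) ^ 2) =
          Real.exp (-(b / (4 * M)) ^ 2) * Real.exp (-1 / 2 * (a / M) * (b / (4 * M))) := by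
        rw [← Real.exp_add, ← Real.exp_add]; congr 1; field_simp; ring
      have := congrArg (fun r : ℝ => (r : ℂ)) this
      push_cast at this ⊢
      linear_combination ((b / (4 * M)) ^ l * (ρ a.natAbs * (a / M) ^ j) * q a * p b *
        (ex a x * ex b x) : ℂ) * this
    rw [e]
    refine Eq.subst (motive := fun F => HasSum F _) (funext fun i => ?_) h2
    push_cast; rw [mul_pow, mul_pow, pow_add, pow_add]; ring
  refine Eq.subst (motive := fun F => HasSum F _) (funext fun i => ?_)
    (hasSum_sum (s := s) fun a ha => hasSum_sum (s := s) fun b hb => hterm a ha b hb)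
  simp only [lowPass, cutSum, trig]
  rw [Finset.sum_mul_sum, Finset.mul_sum, Finset.sum_comm]
  simp only [Finset.mul_sum]

lemma abs_mul_exp_neg_sq_le (t : ℝ) : |t * Real.exp (-t ^ 2)| ≤ 1 := by
  rw [abs_mul, abs_of_pos (Real.exp_pos _), Real.exp_neg, ← div_eq_mul_inv, div_le_one (Real.exp_pos _)]
  have := Real.add_one_le_exp (t ^ 2)
  nlinarith [sq_abs t, sq_nonneg (|t| - 1), abs_nonneg t]

/-- The sum estimated here is the function `T` of `exists_majorant`. The constant 12 is `2 * 6`: the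
geometric weights sum to at most 2, and the inner weights are `1 + 4 + 1`. -/
lemma integral_geometric_sum_rpow_le {p' B : ℝ} (hp' : 1 < p') (hB : 0 ≤ B) {G D : ℕ → ℝ → ℝ}
    (hGc : ∀ j, Continuous (G j)) (hDc : ∀ j, Continuous (D j)) (hG0 : ∀ j x, 0 ≤ G j x)
    (hD0 : ∀ j x, 0 ≤ D j x) (hGi : ∀ j, ∫ x in (0:ℝ)..2 * π, G j x ^ p' ≤ B)
    (hDi : ∀ j, ∫ x in (0:ℝ)..2 * π, D j x ^ p' ≤ B) (J : ℕ) :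
    ∫ x in (0:ℝ)..2 * π, (∑ j ∈ Finset.range (J + 1), (1 / 4 : ℝ) ^ j * (G j x + 4 * D j x + 1)) ^ p' ≤
      12 ^ p' * (5 * B + 2 * π) := by
  have hp0 : 0 < p' := by linarith
  set a : ℕ → ℝ → ℝ := fun j x => G j x + 4 * D j x + 1 with ha
  have ha1 : ∀ j x, 1 ≤ a j x := fun j x => by simp only [ha]; linarith [hG0 j x, hD0 j x]
  have hgeo : ∑ j ∈ Finset.range (J + 1), (1 / 4 : ℝ) ^ j ≤ 2 := by
    have := Summable.sum_le_tsum (Finset.range (J + 1)) (fun i _ => by positivity)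
      (summable_geometric_of_lt_one (by norm_num : (0:ℝ) ≤ 1 / 4) (by norm_num))
    rw [tsum_geometric_of_lt_one (by norm_num) (by norm_num)] at this
    linarith
  have hpt : ∀ x, (∑ j ∈ Finset.range (J + 1), (1 / 4 : ℝ) ^ j * a j x) ^ p' ≤
      2 ^ (p' - 1) * ∑ j ∈ Finset.range (J + 1), (1 / 4 : ℝ) ^ j *
        (6 ^ (p' - 1) * (G j x ^ p' + 4 * D j x ^ p' + 1)) := by
    intro x
    refine (rpow_sum_mul_le _ hp'.le _ _ (fun _ _ => by positivity)
      (fun j _ => by linarith [ha1 j x])).trans ?_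
    refine mul_le_mul (Real.rpow_le_rpow (by positivity) hgeo (by linarith)) ?_ ?_ (by positivity)
    · refine Finset.sum_le_sum fun j _ => mul_le_mul_of_nonneg_left ?_ (by positivity)
      have h := rpow_sum_mul_le (Finset.univ : Finset (Fin 3)) hp'.le ![1, 4, 1]
        ![G j x, D j x, 1] (by intro i _; fin_cases i <;> simp)
        (by intro i _; fin_cases i <;> simp [hG0, hD0])
      simp only [Fin.sum_univ_three, Matrix.cons_val_zero, Matrix.cons_val_one, Matrix.cons_val,
        one_mul, Real.one_rpow, mul_one] at h
      norm_num at h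
      exact h
    · exact Finset.sum_nonneg fun j _ => mul_nonneg (by positivity)
        (Real.rpow_nonneg (by linarith [ha1 j x]) _)
  have hGp : ∀ j, Continuous fun x => G j x ^ p' := fun j =>
    (hGc j).rpow_const fun x => Or.inr hp0.le
  have hDp : ∀ j, Continuous fun x => D j x ^ p' := fun j =>
    (hDc j).rpow_const fun x => Or.inr hp0.le
  refine (intervalIntegral.integral_mono (by positivity)
    (Continuous.intervalIntegrable (Continuous.rpow_const (by fun_prop) fun x => Or.inr hp0.le) _ _)
    (Continuous.intervalIntegrable (by fun_prop) _ _) hpt).trans ?_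
  rw [intervalIntegral.integral_const_mul, intervalIntegral.integral_finsetSum
    fun j _ => Continuous.intervalIntegrable (by fun_prop) _ _]
  have hj : ∀ j, ∫ x in (0:ℝ)..2 * π, (1 / 4 : ℝ) ^ j *
        (6 ^ (p' - 1) * (G j x ^ p' + 4 * D j x ^ p' + 1)) ≤
        (1 / 4 : ℝ) ^ j * (6 ^ (p' - 1) * (5 * B + 2 * π)) := by
    intro j
    rw [intervalIntegral.integral_const_mul, intervalIntegral.integral_const_mul,
      intervalIntegral.integral_add (Continuous.intervalIntegrable (by fun_prop) _ _)
        (Continuous.intervalIntegrable (by fun_prop) _ _),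
      intervalIntegral.integral_add (Continuous.intervalIntegrable (by fun_prop) _ _)
        (Continuous.intervalIntegrable (by fun_prop) _ _), intervalIntegral.integral_const_mul,
      intervalIntegral.integral_const, smul_eq_mul, mul_one, sub_zero]
    gcongr
    linarith [hGi j, hDi j]
  have hX : 0 ≤ 5 * B + 2 * π := by positivity
  calc _ ≤ 2 ^ (p' - 1) * ∑ j ∈ Finset.range (J + 1), (1 / 4 : ℝ) ^ j *
          (6 ^ (p' - 1) * (5 * B + 2 * π)) := by
        gcongr with j _; exact hj j
    _ ≤ 2 ^ (p' - 1) * (2 * (6 ^ (p' - 1) * (5 * B + 2 * π))) := by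
        rw [← Finset.sum_mul]; gcongr
    _ = 2 ^ p' * 6 ^ p' / 6 * (5 * B + 2 * π) := by
        rw [Real.rpow_sub_one (by norm_num), Real.rpow_sub_one (by norm_num)]; ring
    _ ≤ 12 ^ p' * (5 * B + 2 * π) := by
        rw [← Real.mul_rpow (by norm_num) (by norm_num)]
        norm_num
        gcongr
        have : (0:ℝ) ≤ 12 ^ p' := by positivity
        linarith

section Majorant
variable {s S : Finset ℤ} {q b : ℤ → ℂ} {p p' K C : ℝ}

/-- `L^{p'}` bound for the filtered products. -/
lemma integral_norm_filter_le (hp : 1 < p) (hC : 0 ≤ C) (hK : 0 ≤ K) (hp' : 0 < p')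
    (hHY : ∀ (s : Finset ℤ) (c : ℤ → ℂ),
      ∫ x in (0:ℝ)..2 * π, ‖trig s c x‖ ^ p' ≤ K * (∑ n ∈ s, ‖c n‖ ^ p) ^ (p' / p))
    (hT : ∀ m : ℕ, ∑ n ∈ S, ‖cv s (fun j => if j.natAbs ≤ m then q j else 0) b n‖ ^ p ≤ C ^ p)
    {M : ℕ} (hM : 0 < M) {ρ : ℕ → ℝ} (hρ : Antitone ρ) (hρ1 : ∀ m, ρ m ≤ 1)
    (hρ0 : ∀ m, 0 ≤ ρ m) (hρM : ∀ m, M ≤ m → ρ m = 0) (j : ℕ) (F : ℤ → ℝ) (hF : ∀ n, |F n| ≤ 1) :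
    ∫ x in (0:ℝ)..2 * π, ‖trig S (fun n => (F n : ℂ) * cv s (fun a => ((ρ a.natAbs *
      ((a.natAbs / M : ℝ) ^ j * Real.exp ((a.natAbs / (4 * M) : ℝ) ^ 2)) : ℝ) : ℂ) * q a) b n) x‖ ^ p'
      ≤ K * (4 * C) ^ p' := by
  refine (hHY _ _).trans ?_
  have hM0 : (0:ℝ) < M := by exact_mod_cast hM
  -- The multiplier `β` is nondecreasing and `β M = exp(1/16) ≤ 2`, so the cut-off `ρ β` has
  -- variation at most `2 * 2`; hence the factor `4 * C`.
  set β : ℕ → ℝ := fun m => (m / M : ℝ) ^ j * Real.exp ((m / (4 * M) : ℝ) ^ 2) with hβ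
  have hβm : Monotone β := fun m n h => by
    have : (m : ℝ) ≤ n := by exact_mod_cast h
    simp only [hβ]; gcongr
  have hβM : β M ≤ 2 := by
    simp only [hβ, div_self hM0.ne', one_pow, one_mul]
    have h1 : ((M : ℝ) / (4 * M)) ^ 2 = 1 / 16 := by field_simp; norm_num
    rw [h1]
    have h2 : Real.exp (1 / 16) ≤ Real.exp (Real.log 2) := by
      apply Real.exp_le_exp.2; linarith [Real.log_two_gt_d9]
    rwa [Real.exp_log (by norm_num)] at h2
  have h1 := sum_norm_cv_rpow_le hp hC hT (fun m => ρ m * β m) M (fun m hm => by simp [hρM m hm]) (2 * 2)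
    (sum_abs_sub_mul_le ρ β M hρ hρ1 hρ0 hβm (by simp only [hβ]; positivity) hβM)
  have h2 : ∑ n ∈ S, ‖(F n : ℂ) * cv s (fun a => ((ρ a.natAbs * β a.natAbs : ℝ) : ℂ) * q a) b n‖ ^ p ≤
      (4 * C) ^ p := by
    refine (Finset.sum_le_sum fun n _ => ?_).trans (h1.trans_eq (by norm_num))
    refine Real.rpow_le_rpow (norm_nonneg _) ?_ (by linarith)
    rw [norm_mul, Complex.norm_real, Real.norm_eq_abs]
    exact mul_le_of_le_one_left (norm_nonneg _) (hF n)
  have h3 : (∑ n ∈ S, ‖(F n : ℂ) * cv s (fun a => ((ρ a.natAbs * β a.natAbs : ℝ) : ℂ) * q a) b n‖ ^ p)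
      ^ (p' / p) ≤ ((4 * C) ^ p) ^ (p' / p) :=
    Real.rpow_le_rpow (Finset.sum_nonneg fun n _ => by positivity) h2 (by positivity)
  rw [← Real.rpow_mul (by positivity), mul_div_cancel₀ _ (by linarith)] at h3
  gcongr

/-- For an even power the multiplier depends on `|a|` only, so the hypothesis on symmetric partial
sums applies. An odd power is reached by inserting the output frequency `(a + b)/(4M) = (1/4)(a/M) +
b/(4M)`, which is harmless next to the Gaussian. -/
lemma mixed_eq_trig (hS : ∀ a ∈ s, ∀ b ∈ s, a + b ∈ S) (hb : ∀ n, n ∉ s → b n = 0) (M : ℕ)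
    (ρ : ℕ → ℝ) (j : ℕ) (x : ℝ) :
    mixed s M ρ q b 0 (2 * j) x = trig S (fun n => ((Real.exp (-(n / (4 * M)) ^ 2) : ℝ) : ℂ) *
      cv s (fun a => ((ρ a.natAbs * ((a.natAbs / M : ℝ) ^ (2 * j) *
        Real.exp ((a.natAbs / (4 * M) : ℝ) ^ 2)) : ℝ) : ℂ) * q a) b n) x ∧
    (1 / 4) * mixed s M ρ q b 0 (2 * j + 1) x + mixed s M ρ q b 1 (2 * j) x =
      trig S (fun n => ((n / (4 * M) * Real.exp (-(n / (4 * M)) ^ 2) : ℝ) : ℂ) *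
      cv s (fun a => ((ρ a.natAbs * ((a.natAbs / M : ℝ) ^ (2 * j) *
        Real.exp ((a.natAbs / (4 * M) : ℝ) ^ 2)) : ℝ) : ℂ) * q a) b n) x := by
  have hnat : ∀ a : ℤ, ((a.natAbs : ℕ) : ℝ) = |(a : ℝ)| := fun a => by
    rw [Nat.cast_natAbs, Int.cast_abs]
  have e1 : ∀ a : ℤ, (a.natAbs / M : ℝ) ^ (2 * j) = (a / M : ℝ) ^ (2 * j) := fun a => by
    rw [hnat, pow_mul, pow_mul, div_pow, sq_abs, ← div_pow]
  have e2 : ∀ a : ℤ, (a.natAbs / (4 * M) : ℝ) ^ 2 = (a / (4 * M) : ℝ) ^ 2 := fun a => by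
    rw [hnat, div_pow, div_pow, sq_abs]
  simp only [e1, e2]
  constructor
  · rw [trig, Finset.sum_congr rfl fun n _ => mul_right_comm _ _ _,
      sum_mul_cv hS _ _ hb (fun n => ((Real.exp (-(n / (4 * M)) ^ 2) : ℝ) : ℂ) * ex n x), mixed]
    refine Finset.sum_congr rfl fun a _ => Finset.sum_congr rfl fun c _ => ?_
    push_cast; ring
  · rw [trig, Finset.sum_congr rfl fun n _ => mul_right_comm _ _ _,
      sum_mul_cv hS _ _ hb (fun n => ((n / (4 * M) * Real.exp (-(n / (4 * M)) ^ 2) : ℝ) : ℂ) * ex n x),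
      mixed, mixed, Finset.mul_sum, ← Finset.sum_add_distrib]
    refine Finset.sum_congr rfl fun a _ => ?_
    rw [Finset.mul_sum, ← Finset.sum_add_distrib]
    refine Finset.sum_congr rfl fun c _ => ?_
    push_cast; ring

lemma norm_trig_cv_le (hS : ∀ a ∈ s, ∀ b ∈ s, a + b ∈ S) (hb : ∀ n, n ∉ s → b n = 0)
    (F : ℤ → ℝ) (hF : ∀ n, |F n| ≤ 1) (μ : ℤ → ℝ) (hμ : ∀ n, |μ n| ≤ 2) (x : ℝ) :
    ‖trig S (fun n => (F n : ℂ) * cv s (fun a => (μ a : ℂ) * q a) b n) x‖ ≤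
      2 * ((∑ n ∈ s, ‖q n‖) * ∑ n ∈ s, ‖b n‖) := by
  rw [trig, Finset.sum_congr rfl fun n _ => mul_right_comm _ _ _,
      sum_mul_cv hS _ _ hb (fun n => (F n : ℂ) * ex n x), Finset.sum_mul_sum, Finset.mul_sum]
  refine (norm_sum_le _ _).trans (Finset.sum_le_sum fun a _ => ?_)
  rw [Finset.mul_sum]
  refine (norm_sum_le _ _).trans (Finset.sum_le_sum fun c _ => ?_)
  simp only [norm_mul, norm_ex, Complex.norm_real, Real.norm_eq_abs, mul_one]
  have h1 := hF (a + c)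
  have h2 := hμ a
  calc |F (a + c)| * (|μ a| * ‖q a‖ * ‖b c‖) ≤ 1 * (2 * ‖q a‖ * ‖b c‖) := by gcongr
    _ = _ := by ring

/-- On the set where the low-pass filtered `b` dominates its higher-order terms, the cut-off sum of
`q` is controlled by an `L^{p'}` function divided by the filtered `b`. -/
lemma exists_majorant (hp : 1 < p) (hC : 0 ≤ C) (hK : 0 ≤ K) (hp' : 1 < p')
    (hHY : ∀ (s : Finset ℤ) (c : ℤ → ℂ),
      ∫ x in (0:ℝ)..2 * π, ‖trig s c x‖ ^ p' ≤ K * (∑ n ∈ s, ‖c n‖ ^ p) ^ (p' / p))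
    (hS : ∀ a ∈ s, ∀ b ∈ s, a + b ∈ S) (hb : ∀ n, n ∉ s → b n = 0)
    (hT : ∀ m : ℕ, ∑ n ∈ S, ‖cv s (fun j => if j.natAbs ≤ m then q j else 0) b n‖ ^ p ≤ C ^ p)
    {M : ℕ} (hM : 0 < M) {ρ : ℕ → ℝ} (hρ : Antitone ρ) (hρ1 : ∀ m, ρ m ≤ 1)
    (hρ0 : ∀ m, 0 ≤ ρ m) (hρM : ∀ m, M ≤ m → ρ m = 0) :
    ∃ T : ℝ → ℝ, Continuous T ∧ (∀ x, 0 ≤ T x) ∧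
      ∫ x in (0:ℝ)..2 * π, T x ^ p' ≤ 12 ^ p' * (5 * (K * (4 * C) ^ p') + 2 * π) ∧
      ∀ x V, HasSum (fun i : ℕ => ‖lowPass s (4 * M) b (i + 1) x‖ / (i.factorial : ℝ)) V →
        3 * V ≤ ‖lowPass s (4 * M) b 0 x‖ / 2 → 0 < ‖lowPass s (4 * M) b 0 x‖ →
        ‖trig s (fun n => (ρ n.natAbs : ℂ) * q n) x‖ ≤ 2 / ‖lowPass s (4 * M) b 0 x‖ * T x := by
  have hM0 : (0:ℝ) < M := by exact_mod_cast hM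
  set μ : ℕ → ℤ → ℝ := fun j a => ρ a.natAbs * ((a.natAbs / M : ℝ) ^ (2 * j) *
        Real.exp ((a.natAbs / (4 * M) : ℝ) ^ 2)) with hμ
  set G : ℕ → ℝ → ℂ := fun j => trig S (fun n => ((Real.exp (-(n / (4 * M)) ^ 2) : ℝ) : ℂ) *
      cv s (fun a => (μ j a : ℂ) * q a) b n) with hG
  set D : ℕ → ℝ → ℂ := fun j => trig S (fun n => ((n / (4 * M) * Real.exp (-(n / (4 * M)) ^ 2) : ℝ) : ℂ) *
      cv s (fun a => (μ j a : ℂ) * q a) b n) with hD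
  have hF1 : ∀ n : ℤ, |Real.exp (-(n / (4 * M : ℝ)) ^ 2)| ≤ 1 := fun n => by
    rw [abs_of_pos (Real.exp_pos _), Real.exp_le_one_iff]
    exact neg_nonpos.2 (sq_nonneg _)
  have hF2 : ∀ n : ℤ, |n / (4 * M : ℝ) * Real.exp (-(n / (4 * M : ℝ)) ^ 2)| ≤ 1 := fun n =>
    abs_mul_exp_neg_sq_le _
  have hμ2 : ∀ j a, |μ j a| ≤ 2 := by
    intro j a
    rcases le_or_gt M a.natAbs with h | h
    · simp [hμ, hρM _ h]
    · have h1 : (a.natAbs : ℝ) ≤ M := by exact_mod_cast h.le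
      have h2 : (a.natAbs / M : ℝ) ^ (2 * j) ≤ 1 := pow_le_one₀ (by positivity) (by
        rw [div_le_one hM0]; exact h1)
      have h3 : Real.exp ((a.natAbs / (4 * M) : ℝ) ^ 2) ≤ 2 := by
        have h4 : (a.natAbs / (4 * M) : ℝ) ^ 2 ≤ Real.log 2 := by
          have : (a.natAbs / (4 * M) : ℝ) ≤ 1 / 4 := by
            rw [div_le_div_iff₀ (by positivity) (by norm_num)]; linarith
          have h5 : (0:ℝ) ≤ a.natAbs / (4 * M) := by positivity
          nlinarith [Real.log_two_gt_d9]
        have := Real.exp_le_exp.2 h4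
        rwa [Real.exp_log (by norm_num)] at this
      have h5 := hρ0 a.natAbs
      have h6 := hρ1 a.natAbs
      rw [abs_of_nonneg (by simp only [hμ]; positivity)]
      calc μ j a ≤ 1 * (1 * 2) := by simp only [hμ]; gcongr
        _ = 2 := by norm_num
  set Y := 2 * ((∑ n ∈ s, ‖q n‖) * ∑ n ∈ s, ‖b n‖) with hY
  have hGY : ∀ j x, ‖G j x‖ ≤ Y := fun j x => norm_trig_cv_le hS hb _ hF1 _ (hμ2 j) x
  have hDY : ∀ j x, ‖D j x‖ ≤ Y := fun j x => norm_trig_cv_le hS hb _ hF2 _ (hμ2 j) x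
  -- For `j > J` the crude bound `‖G j‖ + 4 ‖D j‖ ≤ 5 Y ≤ 4 ^ j` suffices because the summand 1 in
  -- `a 0` makes the majorant at least one. A finite sum therefore serves for all `j`, and it is
  -- continuous.
  obtain ⟨J, hJ⟩ : ∃ J : ℕ, 5 * Y ≤ 4 ^ J := by
    obtain ⟨J, hJ⟩ := pow_unbounded_of_one_lt (5 * Y) (show (1:ℝ) < 4 by norm_num)
    exact ⟨J, hJ.le⟩
  have hGi : ∀ j, ∫ x in (0:ℝ)..2 * π, ‖G j x‖ ^ p' ≤ K * (4 * C) ^ p' := fun j =>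
    integral_norm_filter_le hp hC hK (by linarith) hHY hT hM hρ hρ1 hρ0 hρM (2 * j) _ hF1
  have hDi : ∀ j, ∫ x in (0:ℝ)..2 * π, ‖D j x‖ ^ p' ≤ K * (4 * C) ^ p' := fun j =>
    integral_norm_filter_le hp hC hK (by linarith) hHY hT hM hρ hρ1 hρ0 hρM (2 * j) _ hF2
  have hGc : ∀ j, Continuous (G j) := fun j => continuous_trig _ _
  have hDc : ∀ j, Continuous (D j) := fun j => continuous_trig _ _
  set a : ℕ → ℝ → ℝ := fun j x => ‖G j x‖ + 4 * ‖D j x‖ + 1 with ha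
  have ha1 : ∀ j x, 1 ≤ a j x := fun j x => by simp only [ha]; linarith [norm_nonneg (G j x), norm_nonneg (D j x)]
  have hac : ∀ j, Continuous (a j) := fun j => by simp only [ha]; fun_prop
  have hp0 : 0 < p' := by linarith
  have hTa : ∀ x j, j < J + 1 → (1 / 4 : ℝ) ^ j * a j x ≤
      ∑ j ∈ Finset.range (J + 1), (1 / 4 : ℝ) ^ j * a j x := fun x j hj =>
    Finset.single_le_sum (f := fun j => (1 / 4 : ℝ) ^ j * a j x)
      (fun i _ => mul_nonneg (by positivity) (by linarith [ha1 i x])) (Finset.mem_range.2 hj)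
  refine ⟨fun x => ∑ j ∈ Finset.range (J + 1), (1 / 4 : ℝ) ^ j * a j x, by fun_prop,
    fun x => Finset.sum_nonneg fun j _ => mul_nonneg (by positivity) (by linarith [ha1 j x]), ?_, ?_⟩
  · exact integral_geometric_sum_rpow_le hp' (by positivity) (fun j => (hGc j).norm) (fun j => (hDc j).norm)
      (fun _ _ => norm_nonneg _) (fun _ _ => norm_nonneg _) hGi hDi J
  · intro x V hV h3 hpos
    have h := norm_zero_le_of_hasSum (f := fun i => lowPass s (4 * M) b i x)
      (Z := fun j => cutSum s M ρ q j x) (A := fun j => mixed s M ρ q b 0 j x)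
      (B := fun j => mixed s M ρ q b 1 j x)
      (D := fun j => (1 / 4) * mixed s M ρ q b 0 (j + 1) x + mixed s M ρ q b 1 j x)
      (b := ∑ n ∈ s, ‖q n‖) (T := ∑ j ∈ Finset.range (J + 1), (1 / 4 : ℝ) ^ j * a j x)
      (fun j => ?_) (fun j => hasSum_mixed s hM0.ne' ρ q b 0 j x)
      (fun j => hasSum_mixed s hM0.ne' ρ q b 1 j x) (fun j => rfl) hV h3 hpos (fun j => ?_)
    · simpa [cutSum] using h
    · refine (norm_trig_le _ _ _).trans (Finset.sum_le_sum fun n _ => ?_)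
      rw [norm_mul, Complex.norm_real, Real.norm_eq_abs]
      refine mul_le_of_le_one_left (norm_nonneg _) ?_
      rcases le_or_gt M n.natAbs with h | h
      · simp [hρM _ h]
      · rw [abs_mul, abs_pow, abs_div, abs_of_pos hM0, abs_of_nonneg (hρ0 _)]
        have h1 : |(n : ℝ)| ≤ M := by
          rw [← Int.cast_abs, ← Nat.cast_natAbs]; exact_mod_cast h.le
        exact mul_le_one₀ (hρ1 _) (by positivity) (pow_le_one₀ (by positivity) ((div_le_one hM0).2 h1))
    · obtain ⟨e1, e2⟩ := mixed_eq_trig (q := q) hS hb M ρ j x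
      rw [e2, e1]
      change ‖G j x‖ + 4 * ‖D j x‖ ≤ _
      have h4 : ∀ j, (4:ℝ) ^ j * (1 / 4) ^ j = 1 := fun j => by rw [← mul_pow]; norm_num
      rcases lt_or_ge j (J + 1) with hj | hj
      · have h1 := mul_le_mul_of_nonneg_left (hTa x j hj) (by positivity : (0:ℝ) ≤ 4 ^ j)
        rw [← mul_assoc, h4, one_mul] at h1
        simp only [ha] at h1 ⊢
        linarith
      · have h1 := mul_le_mul_of_nonneg_left (hTa x 0 (by omega)) (by positivity : (0:ℝ) ≤ 4 ^ j)
        have h2 : (4:ℝ) ^ J ≤ 4 ^ j := pow_le_pow_right₀ (by norm_num) (by omega)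
        have h5 := ha1 0 x
        have h6 : (0:ℝ) < 4 ^ j := by positivity
        rw [pow_zero, one_mul] at h1
        nlinarith [hGY j x, hDY j x]
end Majorant


/-! ### The Poisson kernel and its derivatives. -/

/-- The Poisson kernel on the circle, normalized to have integral one over a period. -/
noncomputable def circleKernel (r t : ℝ) : ℝ := (1 - r ^ 2) / (2 * π) / (1 - 2 * r * Real.cos t + r ^ 2)

section Kernel
variable {r : ℝ}

lemma circleKernel_denom_ge (h0 : 0 < r) (t : ℝ) :
    (1 - r) ^ 2 ≤ 1 - 2 * r * Real.cos t + r ^ 2 := by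
  nlinarith [Real.cos_le_one t]

lemma circleKernel_denom_pos (h0 : 0 < r) (h1 : r < 1) (t : ℝ) :
    0 < 1 - 2 * r * Real.cos t + r ^ 2 :=
  (pow_pos (sub_pos.2 h1) 2).trans_le (circleKernel_denom_ge h0 t)

lemma circleKernel_pos (h0 : 0 < r) (h1 : r < 1) (t : ℝ) : 0 < circleKernel r t := by
  have := circleKernel_denom_pos h0 h1 t
  have : 0 < 1 - r ^ 2 := by nlinarith
  unfold circleKernel; positivity

lemma continuous_circleKernel (h0 : 0 < r) (h1 : r < 1) : Continuous (circleKernel r) := by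
  unfold circleKernel
  exact Continuous.div (by fun_prop) (by fun_prop) fun t => (circleKernel_denom_pos h0 h1 t).ne'

lemma circleKernel_periodic : Function.Periodic (circleKernel r) (2 * π) := fun t => by
  simp [circleKernel]

/-- With `u = 1 - cos t` the denominator is `(1 - r)² + 2 r u`. By the inequality of the means its
square is at least `8 r u (1 - r)²`, which dominates `(2 r sin t)² (1 - r)²`. -/
lemma circleKernel_deriv_bound (h0 : 0 < r) (h1 : r < 1) (t : ℝ) :
    |2 * r * Real.sin t| / (1 - 2 * r * Real.cos t + r ^ 2) ≤ 1 / (1 - r) := by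
  have hD := circleKernel_denom_pos h0 h1 t
  have h1r : 0 < 1 - r := by linarith
  rw [div_le_div_iff₀ hD h1r, one_mul]
  refine abs_le_of_sq_le_sq' ?_ hD.le |>.2
  rw [mul_pow, sq_abs]
  have hs := Real.sin_sq_add_cos_sq t
  have hc := Real.cos_le_one t
  have hc' := Real.neg_one_le_cos t
  set u := 1 - Real.cos t with hu
  have e1 : 1 - 2 * r * Real.cos t + r ^ 2 = (1 - r) ^ 2 + 2 * r * u := by rw [hu]; ring
  have e2 : Real.sin t ^ 2 = u * (2 - u) := by rw [hu]; nlinarith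
  rw [e1, mul_pow, e2]
  have hu0 : 0 ≤ u := by rw [hu]; linarith
  have h2 : (2 * r) ^ 2 * (u * (2 - u)) * (1 - r) ^ 2 ≤ 8 * r * u * (1 - r) ^ 2 := by
    refine mul_le_mul_of_nonneg_right ?_ (sq_nonneg _)
    have : r ^ 2 * (u * (2 - u)) ≤ r * (2 * u) := by
      have a1 : r ^ 2 ≤ r := by nlinarith
      have a2 : u * (2 - u) ≤ 2 * u := by nlinarith
      have a3 : r ^ 2 * (u * (2 - u)) ≤ r ^ 2 * (2 * u) := by gcongr
      have a4 : r ^ 2 * (2 * u) ≤ r * (2 * u) := by gcongr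
      linarith
    nlinarith
  nlinarith [sq_nonneg ((1 - r) ^ 2 - 2 * r * u)]

lemma hasDerivAt_circleKernel_denom (t : ℝ) :
    HasDerivAt (fun t => 1 - 2 * r * Real.cos t + r ^ 2) (2 * r * Real.sin t) t := by
  have := (((Real.hasDerivAt_cos t).const_mul (2 * r)).const_sub 1).add_const (r ^ 2)
  exact this.congr_deriv (by ring)

/-- The first two derivatives of the Poisson kernel and their bounds by the kernel. -/
lemma exists_circleKernel_derivs (h0 : 0 < r) (h1 : r < 1) :
    ∃ k1 k2 : ℝ → ℝ, (∀ t, HasDerivAt (circleKernel r) (k1 t) t) ∧ (∀ t, HasDerivAt k1 (k2 t) t) ∧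
      Continuous k1 ∧ Continuous k2 ∧
      (∀ t, |k1 t| ≤ 1 / (1 - r) * circleKernel r t) ∧
      (∀ t, |k2 t| ≤ 4 * (1 / (1 - r)) ^ 2 * circleKernel r t) := by
  have hD := circleKernel_denom_pos h0 h1
  have hK := circleKernel_pos h0 h1
  have hKc := continuous_circleKernel h0 h1
  set D : ℝ → ℝ := fun t => 1 - 2 * r * Real.cos t + r ^ 2 with hDdef
  have hD1 : ∀ t, HasDerivAt D (2 * r * Real.sin t) t := hasDerivAt_circleKernel_denom
  have hDc : Continuous D := by simp only [hDdef]; fun_prop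
  have d1 : ∀ t, HasDerivAt (circleKernel r) (-(circleKernel r t * (2 * r * Real.sin t / D t))) t := by
    intro t
    have := (hD1 t).inv (hD t).ne' |>.const_mul ((1 - r ^ 2) / (2 * π))
    refine (this.congr_deriv ?_).congr_of_eventuallyEq (Filter.Eventually.of_forall fun x => ?_)
    · simp only [circleKernel, hDdef]; field_simp
    · simp only [circleKernel, hDdef]; rw [Pi.inv_apply, div_eq_mul_inv]
  have hs : ∀ t, HasDerivAt (fun t => 2 * r * Real.sin t) (2 * r * Real.cos t) t := fun t =>
    (Real.hasDerivAt_sin t).const_mul _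
  have hq : Continuous fun t => 2 * r * Real.sin t / D t :=
    Continuous.div (by fun_prop) hDc fun t => (hD t).ne'
  have hq2 : Continuous fun t => 2 * r * Real.cos t / D t :=
    Continuous.div (by fun_prop) hDc fun t => (hD t).ne'
  have b1 : ∀ t, |2 * r * Real.sin t / D t| ≤ 1 / (1 - r) := fun t => by
    rw [abs_div, abs_of_pos (hD t)]; exact circleKernel_deriv_bound h0 h1 t
  have h1r : 0 < 1 - r := by linarith
  have b2 : ∀ t, |2 * r * Real.cos t / D t| ≤ 2 * (1 / (1 - r)) ^ 2 := fun t => by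
    rw [abs_div, abs_of_pos (hD t), div_pow, one_pow, ← mul_div_assoc, mul_one,
      div_le_div_iff₀ (hD t) (by positivity)]
    have := circleKernel_denom_ge h0 t
    have h3 : |2 * r * Real.cos t| ≤ 2 := by
      rw [abs_mul, abs_of_pos (by positivity)]
      have := Real.abs_cos_le_one t
      nlinarith [abs_nonneg (Real.cos t)]
    calc _ ≤ 2 * (1 - r) ^ 2 := by gcongr
      _ ≤ 2 * D t := by gcongr
  refine ⟨fun t => -(circleKernel r t * (2 * r * Real.sin t / D t)),
    fun t => -((-(circleKernel r t * (2 * r * Real.sin t / D t))) * (2 * r * Real.sin t / D t) +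
      circleKernel r t * (2 * r * Real.cos t / D t - (2 * r * Real.sin t / D t) ^ 2)), d1, ?_,
    by fun_prop, by fun_prop, ?_, ?_⟩
  · intro t
    refine (((d1 t).mul ((hs t).div (hD1 t) (hD t).ne')).neg).congr_deriv ?_
    have := (hD t).ne'
    simp only [Pi.div_apply]
    field_simp
  · intro t
    rw [abs_neg, abs_mul, abs_of_pos (hK t), mul_comm]
    exact mul_le_mul_of_nonneg_right (b1 t) (hK t).le
  · intro t
    dsimp only
    have a1 := b1 t
    have a2 := b2 t
    set u := 2 * r * Real.sin t / D t
    set v := 2 * r * Real.cos t / D t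
    have e : -(-(circleKernel r t * u) * u + circleKernel r t * (v - u ^ 2)) =
        (2 * u ^ 2 - v) * circleKernel r t := by ring
    rw [e, abs_mul, abs_of_pos (hK t)]
    refine mul_le_mul_of_nonneg_right ?_ (hK t).le
    refine (abs_sub _ _).trans ?_
    rw [abs_of_nonneg (by positivity : 0 ≤ 2 * u ^ 2), ← sq_abs u]
    have : |u| ^ 2 ≤ (1 / (1 - r)) ^ 2 := by gcongr
    linarith

/-- For `n ≥ 0` this is the Poisson formula for `z ^ n` at the point `r e^{ix}`; negative
frequencies follow by conjugation. -/
lemma integral_circleKernel_mul_ex (h0 : 0 < r) (h1 : r < 1) (n : ℤ) (x : ℝ) :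
    ∫ t in (0:ℝ)..2 * π, (circleKernel r (x - t) : ℂ) * ex n t = (r ^ n.natAbs : ℝ) * ex n x := by
  have hnat : ∀ n : ℕ, ∫ t in (0:ℝ)..2 * π, (circleKernel r (x - t) : ℂ) * ex n t =
      (r ^ n : ℝ) * ex n x := by
    intro n
    have hw : (r * Complex.exp (x * I) : ℂ) ∈ Metric.ball (0:ℂ) 1 := by
      simp [Complex.norm_exp_ofReal_mul_I, abs_of_pos h0, h1]
    have hd : DiffContOnCl ℂ (fun z : ℂ => z ^ n) (Metric.ball 0 1) :=
      (differentiable_pow n).diffContOnCl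
    have h := hd.circleAverage_poissonKernel_smul hw
    rw [Real.circleAverage_def] at h
    have e1 : ∀ t : ℝ, (poissonKernel 0 (r * Complex.exp (x * I)) • fun z : ℂ => z ^ n)
        (circleMap 0 1 t) = (2 * π : ℝ) * ((circleKernel r (x - t) : ℂ) * ex n t) := by
      intro t
      simp only [Pi.smul_apply', circleMap, poissonKernel_def, Complex.ofReal_one, one_mul, zero_add,
        sub_zero, Complex.real_smul]
      rw [← mul_assoc, ← Complex.exp_nat_mul]
      have e3 : Complex.exp (n * (t * I)) = ex n t := by unfold ex; congr 1; push_cast; ring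
      rw [e3, ← Complex.ofReal_mul]
      congr 2
      rw [norm_mul, Complex.norm_exp_ofReal_mul_I, Complex.norm_exp_ofReal_mul_I, Complex.norm_real,
        Real.norm_of_nonneg h0.le]
      have e4 : ‖Complex.exp (t * I) - r * Complex.exp (x * I)‖ ^ 2 =
          1 - 2 * r * Real.cos (x - t) + r ^ 2 := by
        rw [Complex.sq_norm, Complex.normSq_apply, Complex.exp_mul_I, Complex.exp_mul_I]
        simp only [← Complex.ofReal_cos, ← Complex.ofReal_sin, Complex.sub_re, Complex.sub_im,
          Complex.add_re, Complex.add_im, Complex.mul_re, Complex.mul_im, Complex.ofReal_re,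
          Complex.ofReal_im, Complex.I_re, Complex.I_im]
        rw [Real.cos_sub]
        nlinarith [Real.sin_sq_add_cos_sq t, Real.sin_sq_add_cos_sq x,
          congrArg (fun z => r ^ 2 * z) (Real.sin_sq_add_cos_sq x)]
      rw [e4, circleKernel]
      field_simp
    simp only [e1] at h
    rw [intervalIntegral.integral_const_mul, Complex.real_smul, ← mul_assoc, ← Complex.ofReal_mul,
      inv_mul_cancel₀ (by positivity), Complex.ofReal_one, one_mul] at h
    rw [h, mul_pow, ← Complex.exp_nat_mul]
    push_cast; congr 1; unfold ex; congr 1; push_cast; ring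
  rcases Int.natAbs_eq n with h | h
  · rw [h]; exact hnat _
  · have := congrArg (starRingEnd ℂ) (hnat n.natAbs)
    rw [map_mul, Complex.conj_ofReal, conj_ex, ← h, intervalIntegral.integral_of_le (by positivity),
      ← integral_conj, ← intervalIntegral.integral_of_le (by positivity)] at this
    rw [← this]
    refine intervalIntegral.integral_congr fun t _ => ?_
    rw [map_mul, Complex.conj_ofReal, conj_ex, ← h]
end Kernel


/-! ### Convolution over a period and slowly varying majorants. -/

lemma periodic_deriv {f f' : ℝ → ℝ} {c : ℝ} (hf : Function.Periodic f c)
    (h : ∀ x, HasDerivAt f (f' x) x) : Function.Periodic f' c := fun x => by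
  have h1 : HasDerivAt (fun y => f (y + c)) (f' (x + c)) x := (h (x + c)).comp_add_const x c
  have h2 : (fun y => f (y + c)) = f := funext hf
  rw [h2] at h1
  exact h1.unique (h x)

/-- Convolution over a period. -/
noncomputable def kconv (k f : ℝ → ℝ) (x : ℝ) : ℝ := ∫ t in (0:ℝ)..2 * π, k (x - t) * f t

lemma continuous_kconv {k f : ℝ → ℝ} (hk : Continuous k) (hf : Continuous f) :
    Continuous (kconv k f) := by
  unfold kconv
  exact intervalIntegral.continuous_parametric_intervalIntegral_of_continuous' (by fun_prop) _ _

lemma hasDerivAt_kconv {k k1 f : ℝ → ℝ} (hk : ∀ t, HasDerivAt k (k1 t) t) (hk1 : Continuous k1)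
    (hf : Continuous f) (x : ℝ) : HasDerivAt (kconv k f) (kconv k1 f x) x := by
  have hkc : Continuous k := continuous_iff_continuousAt.2 fun t => (hk t).continuousAt
  obtain ⟨B, hB⟩ := (isCompact_Icc (a := x - 1 - 2 * π) (b := x + 1)).exists_bound_of_continuousOn
    hk1.continuousOn
  refine (intervalIntegral.hasDerivAt_integral_of_dominated_loc_of_deriv_le
    (F := fun x t => k (x - t) * f t) (F' := fun x t => k1 (x - t) * f t)
    (bound := fun t => B * |f t|) (Metric.ball_mem_nhds x one_pos)
    (Filter.Eventually.of_forall fun y => Continuous.aestronglyMeasurable (by fun_prop))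
    (Continuous.intervalIntegrable (by fun_prop) _ _)
    (Continuous.aestronglyMeasurable (by fun_prop)) ?_
    (Continuous.intervalIntegrable (by fun_prop) _ _) ?_).2
  · refine Filter.Eventually.of_forall fun t ht y hy => ?_
    rw [Set.uIoc_of_le (by positivity)] at ht
    rw [Metric.mem_ball, Real.dist_eq, abs_lt] at hy
    rw [norm_mul, Real.norm_eq_abs (f t)]
    exact mul_le_mul_of_nonneg_right (hB _ ⟨by linarith [ht.2], by linarith [ht.1]⟩) (abs_nonneg _)
  · refine Filter.Eventually.of_forall fun t _ y _ => ?_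
    exact ((hk (y - t)).comp_sub_const y t).mul_const _

lemma kconv_mono {k f g : ℝ → ℝ} (hk : Continuous k) (hf : Continuous f) (hg : Continuous g)
    (hk0 : ∀ t, 0 ≤ k t) (h : ∀ t, f t ≤ g t) (x : ℝ) : kconv k f x ≤ kconv k g x :=
  intervalIntegral.integral_mono (by positivity) (Continuous.intervalIntegrable (by fun_prop) _ _)
    (Continuous.intervalIntegrable (by fun_prop) _ _)
    fun t => mul_le_mul_of_nonneg_left (h t) (hk0 _)

lemma abs_kconv_le {k k1 f : ℝ → ℝ} {c : ℝ} (hk : Continuous k) (hk1 : Continuous k1)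
    (hf : Continuous f) (hf0 : ∀ t, 0 ≤ f t) (h : ∀ t, |k1 t| ≤ c * k t) (x : ℝ) :
    |kconv k1 f x| ≤ c * kconv k f x := by
  unfold kconv
  rw [← intervalIntegral.integral_const_mul]
  refine (intervalIntegral.abs_integral_le_integral_abs (by positivity)).trans ?_
  refine intervalIntegral.integral_mono (by positivity)
    (Continuous.intervalIntegrable (by fun_prop) _ _)
    (Continuous.intervalIntegrable (by fun_prop) _ _) fun t => ?_
  simp only [abs_mul, abs_of_nonneg (hf0 t), ← mul_assoc]
  exact mul_le_mul_of_nonneg_right (h _) (hf0 t)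

section
variable {r : ℝ}

lemma integral_circleKernel_sub (h0 : 0 < r) (h1 : r < 1) (x : ℝ) :
    ∫ t in (0:ℝ)..2 * π, circleKernel r (x - t) = 1 := by
  have h := integral_circleKernel_mul_ex h0 h1 0 x
  simp only [ex_zero_left, mul_one, Int.natAbs_zero, pow_zero, Complex.ofReal_one] at h
  rw [intervalIntegral.integral_ofReal] at h
  exact_mod_cast h

lemma integral_kconv_circleKernel (h0 : 0 < r) (h1 : r < 1) {f : ℝ → ℝ} (hf : Continuous f) :
    ∫ x in (0:ℝ)..2 * π, kconv (circleKernel r) f x = ∫ t in (0:ℝ)..2 * π, f t := by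
  have hk := continuous_circleKernel h0 h1
  unfold kconv
  rw [intervalIntegral_intervalIntegral_swap]
  · refine intervalIntegral.integral_congr fun t _ => ?_
    rw [intervalIntegral.integral_mul_const]
    have : ∀ x, circleKernel r (x - t) = circleKernel r (t - x) := fun x => by
      unfold circleKernel; rw [← Real.cos_neg (x - t), neg_sub]
    simp only [this, integral_circleKernel_sub h0 h1, one_mul]
  · rw [Set.uIoc_of_le (by positivity)]
    have : Continuous (Function.uncurry fun x t => circleKernel r (x - t) * f t) := by
      unfold Function.uncurry; fun_prop
    exact (this.continuousOn.integrableOn_compact (isCompact_Icc.prod isCompact_Icc)).mono_set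
      (Set.prod_mono Set.Ioc_subset_Icc_self Set.Ioc_subset_Icc_self)

/-- A multiplier divisible by `r ^ |n|` is a Poisson mean, so the sum is bounded by a smoothed
function even though `‖trig s d‖` itself may vary quickly. -/
lemma norm_trig_le_kconv (h0 : 0 < r) (h1 : r < 1) (s : Finset ℤ) (c d : ℤ → ℂ)
    (hcd : ∀ n ∈ s, c n = (r ^ n.natAbs : ℝ) * d n) (x : ℝ) :
    ‖trig s c x‖ ≤ kconv (circleKernel r) (fun t => ‖trig s d t‖) x := by
  have hk := continuous_circleKernel h0 h1
  have h : trig s c x = ∫ t in (0:ℝ)..2 * π, (circleKernel r (x - t) : ℂ) * trig s d t := by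
    simp only [trig, Finset.mul_sum]
    rw [intervalIntegral.integral_finsetSum fun n _ => Continuous.intervalIntegrable (by fun_prop) _ _]
    refine Finset.sum_congr rfl fun n hn => ?_
    simp only [mul_left_comm _ (d n), intervalIntegral.integral_const_mul,
      integral_circleKernel_mul_ex h0 h1, hcd n hn]
    ring
  rw [h]
  refine (intervalIntegral.norm_integral_le_integral_norm (by positivity)).trans_eq ?_
  unfold kconv
  refine intervalIntegral.integral_congr fun t _ => ?_
  dsimp only
  rw [norm_mul, Complex.norm_real, Real.norm_of_nonneg (circleKernel_pos h0 h1 _).le]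

/-- Jensen's inequality for convolution with the Poisson kernel. -/
lemma kconv_le_rpow (h0 : 0 < r) (h1 : r < 1) {p q : ℝ} (hpq : p.HolderConjugate q) {F : ℝ → ℝ}
    (hF : Continuous F) (hF0 : ∀ t, 0 ≤ F t) {g x : ℝ}
    (hgF : kconv (circleKernel r) (fun t => F t ^ q) x ≤ g) (hg : 0 < g) :
    kconv (circleKernel r) F x ≤ g ^ (1 / q) := by
  have hk := continuous_circleKernel h0 h1
  have hq := hpq.symm.pos
  have hp := hpq.pos
  set c := g ^ (1 / q) with hc
  have hc0 : 0 < c := by positivity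
  have hcq : c ^ q = g := by rw [hc, ← Real.rpow_mul hg.le, one_div_mul_cancel hq.ne', Real.rpow_one]
  have hFq : Continuous fun t => F t ^ q := hF.rpow_const fun t => Or.inr hq.le
  -- Jensen's inequality is obtained by averaging Young's inequality `F c^(q-1) ≤ c^q / p + F^q / q`
  -- at the constant `c = g^(1/q)`.
  have hconv : kconv (circleKernel r) (fun t => F t * c ^ (q - 1)) x ≤
      kconv (circleKernel r) (fun t => c ^ q / p + F t ^ q / q) x := by
    refine kconv_mono hk (by fun_prop) (by fun_prop) (fun t => (circleKernel_pos h0 h1 t).le)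
      (fun t => ?_) x
    have := Real.young_inequality_of_nonneg (a := c ^ (q - 1)) (b := F t) (by positivity) (hF0 t) hpq
    rw [← Real.rpow_mul hc0.le, show (q - 1) * p = q by
      have := hpq.symm.sub_one_mul_conj; linarith] at this
    linarith
  have e1 : kconv (circleKernel r) (fun t => F t * c ^ (q - 1)) x =
      c ^ (q - 1) * kconv (circleKernel r) F x := by
    unfold kconv; rw [← intervalIntegral.integral_const_mul]; congr 1; ext t; ring
  have e2 : kconv (circleKernel r) (fun t => c ^ q / p + F t ^ q / q) x =
      c ^ q / p + kconv (circleKernel r) (fun t => F t ^ q) x / q := by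
    unfold kconv
    rw [← intervalIntegral.integral_div]
    simp only [mul_add]
    rw [intervalIntegral.integral_add (Continuous.intervalIntegrable (by fun_prop) _ _)
      (Continuous.intervalIntegrable (by fun_prop) _ _), intervalIntegral.integral_mul_const,
      integral_circleKernel_sub h0 h1, one_mul]
    simp only [mul_div_assoc]
  rw [e1, e2] at hconv
  have h2 : kconv (circleKernel r) (fun t => F t ^ q) x / q ≤ g / q := by gcongr
  have h3 : c ^ q / p + g / q = c ^ (q - 1) * c := by
    rw [← Real.rpow_add_one hc0.ne', sub_add_cancel, hcq, div_eq_mul_inv, div_eq_mul_inv, ← mul_add,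
      hpq.inv_add_inv_eq_one, mul_one]
  have h4 : c ^ (q - 1) * kconv (circleKernel r) F x ≤ c ^ (q - 1) * c := by linarith
  exact le_of_mul_le_mul_left h4 (by positivity)
end

/-- A slowly varying majorant at scale `L`. -/
lemma exists_slow_majorant {p q : ℝ} (hpq : p.HolderConjugate q) (hq2 : 2 ≤ q) {L : ℝ} (hL : 1 ≤ L)
    {F : ℝ → ℝ} (hF : Continuous F) (hF0 : ∀ t, 0 ≤ F t) {ι : ℝ} (hι : 0 < ι) :
    ∃ G G1 G2 : ℝ → ℝ, (∀ x, HasDerivAt G (G1 x) x) ∧ (∀ x, HasDerivAt G1 (G2 x) x) ∧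
      Continuous G2 ∧ Function.Periodic G (2 * π) ∧ (∀ x, 0 < G x) ∧ (∀ x, ι ≤ G x ^ (q / 2)) ∧
      (∀ x, |G1 x| ≤ 2 * L * G x) ∧ (∀ x, |G2 x| ≤ 20 * L ^ 2 * G x) ∧
      (∫ x in (0:ℝ)..2 * π, G x ^ (q / 2)) = (∫ x in (0:ℝ)..2 * π, F x ^ q) + 2 * π * ι ∧
      ∀ x, kconv (circleKernel (Real.exp (-1 / L))) F x ≤ √(G x) := by
  have hL0 : 0 < L := by linarith
  have hq0 : 0 < q := by linarith
  set r := Real.exp (-1 / L) with hr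
  have h0 : 0 < r := Real.exp_pos _
  have hx : 1 / L ≤ 1 := by rw [div_le_one hL0]; exact hL
  have h1 : 1 / (2 * L) ≤ 1 - r := by
    have h2 : r ≤ 1 / (1 + 1 / L) := by
      rw [hr, neg_div, Real.exp_neg, ← one_div]
      have := Real.add_one_le_exp (1 / L)
      gcongr; linarith
    have h3 : 1 / (1 + 1 / L) = 1 - 1 / (L + 1) := by field_simp; ring
    have h4 : 1 / (2 * L) ≤ 1 / (L + 1) := by gcongr; linarith
    linarith
  have h1' : r < 1 := by
    have : 0 < 1 / (2 * L) := by positivity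
    linarith
  have h1r : 1 / (1 - r) ≤ 2 * L := by
    rw [div_le_iff₀ (by linarith)]
    have := mul_le_mul_of_nonneg_left h1 (by positivity : 0 ≤ 2 * L)
    rwa [mul_one_div_cancel (by positivity)] at this
  have hk := continuous_circleKernel h0 h1'
  have hkp := circleKernel_pos h0 h1'
  obtain ⟨k1, k2, hk1, hk2, hk1c, hk2c, b1, b2⟩ := exists_circleKernel_derivs h0 h1'
  have hFq : Continuous fun t => F t ^ q := hF.rpow_const fun t => Or.inr hq0.le
  -- The majorant is `G = g^(2/q)` with `g` the Poisson mean of `f`. The floor `ι` keeps `g`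
  -- positive, so that the power is smooth. As `1/(1-r) ≤ 2L`, one has `|g'| ≤ 2 L g` and `|g''| ≤
  -- 16 L² g`; since `2/q ≤ 1`, passing to the power only adds `(2 L)²` in the second bound.
  set f : ℝ → ℝ := fun t => F t ^ q + ι with hf
  have hfc : Continuous f := by simp only [hf]; fun_prop
  have hf0 : ∀ t, 0 ≤ f t := fun t => by
    have := Real.rpow_nonneg (hF0 t) q
    simp only [hf]; positivity
  set g := kconv (circleKernel r) f with hg
  set g1 := kconv k1 f with hg1
  set g2 := kconv k2 f with hg2
  have hgg : ∀ x, g x = kconv (circleKernel r) (fun t => F t ^ q) x + ι := by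
    intro x
    simp only [hg, kconv, hf, mul_add]
    rw [intervalIntegral.integral_add (Continuous.intervalIntegrable (by fun_prop) _ _)
      (Continuous.intervalIntegrable (by fun_prop) _ _), intervalIntegral.integral_mul_const,
      integral_circleKernel_sub h0 h1', one_mul]
  have hFn : ∀ x, 0 ≤ kconv (circleKernel r) (fun t => F t ^ q) x := fun x =>
    intervalIntegral.integral_nonneg (by positivity) fun t _ =>
      mul_nonneg (hkp _).le (Real.rpow_nonneg (hF0 t) q)
  have hgι : ∀ x, ι ≤ g x := fun x => by rw [hgg]; linarith [hFn x]
  have hgp : ∀ x, 0 < g x := fun x => hι.trans_le (hgι x)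
  have dg : ∀ x, HasDerivAt g (g1 x) x := hasDerivAt_kconv hk1 hk1c hfc
  have dg1 : ∀ x, HasDerivAt g1 (g2 x) x := hasDerivAt_kconv hk2 hk2c hfc
  have hgc : Continuous g := continuous_kconv hk hfc
  have hg1c : Continuous g1 := continuous_kconv hk1c hfc
  have hg2c : Continuous g2 := continuous_kconv hk2c hfc
  have bg1 : ∀ x, |g1 x| ≤ 2 * L * g x := abs_kconv_le hk hk1c hfc hf0 fun t =>
    (b1 t).trans (mul_le_mul_of_nonneg_right h1r (hkp t).le)
  have bg2 : ∀ x, |g2 x| ≤ 16 * L ^ 2 * g x := abs_kconv_le hk hk2c hfc hf0 fun t =>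
    (b2 t).trans (mul_le_mul_of_nonneg_right (by
      have : 0 ≤ 1 / (1 - r) := by
        have : 0 < 1 - r := by linarith
        positivity
      nlinarith) (hkp t).le)
  set a := 2 / q with ha
  have ha0 : 0 < a := by positivity
  have ha1 : a ≤ 1 := by rw [ha, div_le_one hq0]; exact hq2
  have haq : a * (q / 2) = 1 := by rw [ha]; field_simp
  have hGq : ∀ x, (g x ^ a) ^ (q / 2) = g x := fun x => by
    rw [← Real.rpow_mul (hgp x).le, haq, Real.rpow_one]
  have r1 : ∀ x, g x ^ (a - 1) * g x = g x ^ a := fun x => by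
    rw [← Real.rpow_add_one (hgp x).ne', sub_add_cancel]
  have r2 : ∀ x, g x ^ (a - 1 - 1) * g x = g x ^ (a - 1) := fun x => by
    rw [← Real.rpow_add_one (hgp x).ne', sub_add_cancel]
  refine ⟨fun x => g x ^ a, fun x => g1 x * a * g x ^ (a - 1),
    fun x => g2 x * a * g x ^ (a - 1) + g1 x * a * (g1 x * (a - 1) * g x ^ (a - 1 - 1)),
    fun x => (dg x).rpow_const (Or.inl (hgp x).ne'), fun x => ?_, ?_, fun x => ?_,
    fun x => Real.rpow_pos_of_pos (hgp x) _, fun x => ?_, fun x => ?_, fun x => ?_, ?_, fun x => ?_⟩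
  · exact ((dg1 x).mul_const a).mul ((dg x).rpow_const (Or.inl (hgp x).ne'))
  · have c1 : Continuous fun x => g x ^ (a - 1) := hgc.rpow_const fun x => Or.inl (hgp x).ne'
    have c2 : Continuous fun x => g x ^ (a - 1 - 1) := hgc.rpow_const fun x => Or.inl (hgp x).ne'
    fun_prop
  · have : g (x + 2 * π) = g x := by
      simp only [hg, kconv]
      refine intervalIntegral.integral_congr fun t _ => ?_
      rw [add_sub_right_comm, circleKernel_periodic]
    dsimp only; rw [this]
  · rw [hGq]; exact hgι x
  · have h2 := Real.rpow_pos_of_pos (hgp x) (a - 1)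
    rw [abs_mul, abs_mul, abs_of_pos ha0, abs_of_pos h2]
    dsimp only
    rw [← r1]
    have hb1 := bg1 x
    have hgx := hgp x
    calc |g1 x| * a * g x ^ (a - 1) ≤ (2 * L * g x) * 1 * g x ^ (a - 1) := by gcongr
      _ = _ := by ring
  · have h2 := Real.rpow_pos_of_pos (hgp x) (a - 1)
    have h3 := Real.rpow_pos_of_pos (hgp x) (a - 1 - 1)
    dsimp only
    rw [← r1, ← r2]
    refine (abs_add_le _ _).trans ?_
    simp only [abs_mul, abs_of_pos ha0, abs_of_pos h3, abs_of_pos (hgp x)]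
    have h4 : |a - 1| ≤ 1 := by rw [abs_le]; constructor <;> linarith
    have hb1 := bg1 x
    have hb2 := bg2 x
    have hgx := hgp x
    calc |g2 x| * a * (g x ^ (a - 1 - 1) * g x) + |g1 x| * a * (|g1 x| * |a - 1| * g x ^ (a - 1 - 1))
        ≤ (16 * L ^ 2 * g x) * 1 * (g x ^ (a - 1 - 1) * g x) +
          (2 * L * g x) * 1 * ((2 * L * g x) * 1 * g x ^ (a - 1 - 1)) := by gcongr
      _ = _ := by ring
  · simp only [hGq]
    rw [hg, integral_kconv_circleKernel h0 h1' hfc]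
    simp only [hf]
    rw [intervalIntegral.integral_add (Continuous.intervalIntegrable (by fun_prop) _ _)
      (Continuous.intervalIntegrable (by fun_prop) _ _), intervalIntegral.integral_const]
    simp
  · have h5 : √(g x ^ a) = g x ^ (1 / q) := by
      rw [Real.sqrt_eq_rpow, ← Real.rpow_mul (hgp x).le, ha]; congr 1; field_simp
    dsimp only
    rw [h5]
    refine kconv_le_rpow h0 h1' hpq hF hF0 ?_ (hgp x)
    rw [hgg]; linarith


/-! ### Multipliers measuring the oscillation of the low-pass parts. -/

/-- The frequency multipliers controlling the oscillation of a low-pass filtered sum. -/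
noncomputable def oscMult : ℕ → ℝ → ℝ
  | 0, ξ => Real.exp (-(ξ / 2) ^ 2) - Real.exp (-ξ ^ 2)
  | 1, ξ => (Real.exp (-(ξ / 2) ^ 2) - Real.exp (-ξ ^ 2)) / ξ
  | i + 2, ξ => ξ ^ (i + 1) * Real.exp (-ξ ^ 2) / i.factorial

/-- The weight `t / ((1 + t)(2 + t))`. -/
noncomputable def bandWeight (t : ℝ) : ℝ := t / ((1 + t) * (2 + t))

lemma bandWeight_nonneg {t : ℝ} (ht : 0 ≤ t) : 0 ≤ bandWeight t := by unfold bandWeight; positivity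

lemma bandWeight_le_one {t : ℝ} (ht : 0 ≤ t) : bandWeight t ≤ 1 := by
  unfold bandWeight; rw [div_le_one (by positivity)]; nlinarith

lemma bandWeight_eq {t : ℝ} (ht : 0 ≤ t) : bandWeight t = t / (1 + t) - (t / 2) / (1 + t / 2) := by
  unfold bandWeight; field_simp; ring

/-- The weight is the increment of `t / (1 + t)` from `t / 2` to `t`, so the sum over dyadic scales
telescopes. Consequently a single coefficient is counted at most once over all scales. -/
lemma sum_bandWeight_le {t : ℝ} (ht : 0 ≤ t) (N : ℕ) :
    ∑ k ∈ Finset.range N, bandWeight (t / 2 ^ k) ≤ 1 := by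
  have h : ∀ k ∈ Finset.range N, bandWeight (t / 2 ^ k) =
      (fun k : ℕ => t / 2 ^ k / (1 + t / 2 ^ k)) k - (fun k : ℕ => t / 2 ^ k / (1 + t / 2 ^ k)) (k + 1) :=
    fun k _ => by
      rw [bandWeight_eq (by positivity)]
      simp only [pow_succ, div_div]
  rw [Finset.sum_congr rfl h, Finset.sum_range_sub']
  have h2 : 0 ≤ t / 2 ^ N / (1 + t / 2 ^ N) := by positivity
  have h3 : t / 2 ^ 0 / (1 + t / 2 ^ 0) ≤ 1 := by
    rw [div_le_one (by positivity)]; linarith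
  linarith

lemma mul_exp_le_bandWeight {t c : ℝ} (ht : 0 ≤ t) {u : ℝ} (hu : u + t ≤ c) :
    t * Real.exp u ≤ 4 * Real.exp c * bandWeight t := by
  unfold bandWeight
  rw [← mul_div_assoc, le_div_iff₀ (by positivity)]
  have h1 : (1 + t) * (2 + t) ≤ 4 * Real.exp t := by
    have h := Real.add_one_le_exp (t / 2)
    have h2 : Real.exp t = Real.exp (t / 2) * Real.exp (t / 2) := by rw [← Real.exp_add]; ring_nf
    rw [h2]; nlinarith
  calc t * Real.exp u * ((1 + t) * (2 + t)) ≤ t * Real.exp u * (4 * Real.exp t) := by gcongr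
    _ = 4 * Real.exp (u + t) * t := by rw [Real.exp_add]; ring
    _ ≤ 4 * Real.exp c * t := by gcongr

lemma abs_exp_sub_exp_le {t : ℝ} (ht : 0 ≤ t) :
    |Real.exp (-(t / 2) ^ 2) - Real.exp (-t ^ 2)| ≤ min t (t ^ 2) * Real.exp (-t ^ 2 / 4) := by
  have e : Real.exp (-t ^ 2) = Real.exp (-t ^ 2 / 4) * Real.exp (-(3 / 4 * t ^ 2)) := by
    rw [← Real.exp_add]; ring_nf
  have e' : -(t / 2) ^ 2 = -t ^ 2 / 4 := by ring
  rw [e, e', ← mul_one_sub, abs_mul, abs_of_pos (Real.exp_pos _), mul_comm]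
  gcongr
  have h1 := Real.add_one_le_exp (-(3 / 4 * t ^ 2))
  have h2 := Real.exp_pos (-(3 / 4 * t ^ 2))
  have h3 : Real.exp (-(3 / 4 * t ^ 2)) ≤ 1 := Real.exp_le_one_iff.2 (by nlinarith)
  rw [abs_of_nonneg (by linarith)]
  refine le_min ?_ (by nlinarith)
  rcases le_total t 1 with h | h <;> nlinarith

/-- Each multiplier vanishes at the origin and has Gaussian decay. This leaves room for `exp |ξ|`,
needed to write the sum as a Poisson mean, and for `2 ^ i`, needed to sum over `i`; in the last case
`(2t)^i / i! ≤ exp(2t)` takes care of the powers. -/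
lemma oscMult_bound (i : ℕ) (ξ : ℝ) :
    2 ^ i * |oscMult i ξ| * Real.exp |ξ| ≤ 16 * Real.exp 4 * bandWeight |ξ| := by
  have ht := abs_nonneg ξ
  set t := |ξ| with htd
  have hsq : ξ ^ 2 = t ^ 2 := (sq_abs ξ).symm
  have hsq2 : (ξ / 2) ^ 2 = (t / 2) ^ 2 := by rw [div_pow, div_pow, hsq]
  have hb := bandWeight_nonneg ht
  have h4 := mul_exp_le_bandWeight ht (show (t - t ^ 2 / 4) + t ≤ 4 by nlinarith [sq_nonneg (t - 4)])
  have hE : Real.exp (t - t ^ 2 / 4) = Real.exp (-t ^ 2 / 4) * Real.exp t := by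
    rw [← Real.exp_add]; ring_nf
  have hpos : 0 ≤ Real.exp 4 * bandWeight t := by positivity
  match i with
  | 0 =>
    have h := abs_exp_sub_exp_le ht
    simp only [oscMult, hsq, hsq2, pow_zero, one_mul]
    calc _ ≤ (min t (t ^ 2) * Real.exp (-t ^ 2 / 4)) * Real.exp t := by gcongr
      _ ≤ (t * Real.exp (-t ^ 2 / 4)) * Real.exp t := by gcongr; exact min_le_left _ _
      _ = t * Real.exp (t - t ^ 2 / 4) := by rw [hE]; ring
      _ ≤ _ := by linarith
  | 1 =>
    have h := abs_exp_sub_exp_le ht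
    simp only [oscMult, hsq, hsq2, pow_one]
    rw [abs_div, ← htd]
    have h5 : |Real.exp (-(t / 2) ^ 2) - Real.exp (-t ^ 2)| / t ≤ t * Real.exp (-t ^ 2 / 4) := by
      refine div_le_of_le_mul₀ ht (by positivity) (h.trans ?_)
      calc _ ≤ t ^ 2 * Real.exp (-t ^ 2 / 4) := by gcongr; exact min_le_right _ _
        _ = _ := by ring
    calc _ ≤ 2 * (t * Real.exp (-t ^ 2 / 4)) * Real.exp t := by gcongr
      _ = 2 * (t * Real.exp (t - t ^ 2 / 4)) := by rw [hE]; ring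
      _ ≤ _ := by linarith
  | i + 2 =>
    simp only [oscMult]
    rw [abs_div, abs_mul, abs_pow, abs_of_pos (Real.exp_pos _), ← htd, hsq, Nat.abs_cast]
    have h6 := Real.pow_div_factorial_le_exp (2 * t) (by positivity) i
    have h7 := mul_exp_le_bandWeight ht (show (3 * t - t ^ 2) + t ≤ 4 by nlinarith [sq_nonneg (t - 2)])
    calc 2 ^ (i + 2) * (t ^ (i + 1) * Real.exp (-t ^ 2) / i.factorial) * Real.exp t
        = 4 * t * ((2 * t) ^ i / i.factorial) * (Real.exp (-t ^ 2) * Real.exp t) := by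
          rw [mul_pow]; ring
      _ ≤ 4 * t * Real.exp (2 * t) * (Real.exp (-t ^ 2) * Real.exp t) := by gcongr
      _ = 4 * (t * Real.exp (3 * t - t ^ 2)) := by
          rw [mul_assoc (4 * t), ← Real.exp_add, ← Real.exp_add, mul_assoc]
          ring_nf
      _ ≤ _ := by linarith

/-- A sum filtered by one of the multipliers `oscMult`. -/
noncomputable def oscSum (s : Finset ℤ) (L : ℝ) (b : ℤ → ℂ) (i : ℕ) : ℝ → ℂ :=
  trig s fun n => (oscMult i (n / L) : ℂ) * b n

lemma norm_oscSum_add_two (s : Finset ℤ) (L : ℝ) (b : ℤ → ℂ) (i : ℕ) (x : ℝ) :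
    ‖oscSum s L b (i + 2) x‖ = ‖lowPass s L b (i + 1) x‖ / (i.factorial : ℝ) := by
  have : oscSum s L b (i + 2) x = lowPass s L b (i + 1) x / (i.factorial : ℂ) := by
    simp only [oscSum, lowPass, trig, oscMult, Finset.sum_div]
    refine Finset.sum_congr rfl fun n _ => ?_
    push_cast; ring
  rw [this, norm_div, Complex.norm_natCast]

lemma exists_summable_oscSum (s : Finset ℤ) (L : ℝ) (b : ℤ → ℂ) :
    ∃ v : ℕ → ℝ, Summable v ∧ ∀ i x, ‖oscSum s L b (i + 2) x‖ ≤ v i := by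
  set R := ∑ n ∈ s, |(n / L : ℝ)| with hR
  have hR0 : 0 ≤ R := by positivity
  refine ⟨fun i => (R * ∑ n ∈ s, ‖b n‖) * (R ^ i / i.factorial),
    (Real.summable_pow_div_factorial R).mul_left _, fun i x => ?_⟩
  refine (norm_trig_le _ _ _).trans ?_
  dsimp only
  rw [mul_right_comm, Finset.mul_sum]
  refine Finset.sum_le_sum fun n hn => ?_
  rw [norm_mul, Complex.norm_real, Real.norm_eq_abs]
  refine mul_le_mul_of_nonneg_right ?_ (norm_nonneg _)
  simp only [oscMult]
  rw [abs_div, abs_mul, abs_pow, abs_of_pos (Real.exp_pos _), Nat.abs_cast, ← mul_div_assoc]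
  have h1 : |(n / L : ℝ)| ≤ R := Finset.single_le_sum (f := fun n : ℤ => |(n / L : ℝ)|)
    (fun _ _ => abs_nonneg _) hn
  have h2 : Real.exp (-(n / L : ℝ) ^ 2) ≤ 1 := Real.exp_le_one_iff.2 (neg_nonpos.2 (sq_nonneg _))
  refine div_le_div_of_nonneg_right ?_ (Nat.cast_nonneg _)
  calc |(n / L : ℝ)| ^ (i + 1) * Real.exp (-(n / L : ℝ) ^ 2) ≤ R ^ (i + 1) * 1 := by gcongr
    _ = _ := by ring

/-- The oscillation of a filtered sum at scale `L` is controlled by a slowly varying function, which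
is small in mean. -/
lemma exists_oscillation_majorant {p q K : ℝ} (hpq : p.HolderConjugate q) (hq2 : 2 ≤ q) (hK : 0 ≤ K)
    (hHY : ∀ (s : Finset ℤ) (c : ℤ → ℂ),
      ∫ x in (0:ℝ)..2 * π, ‖trig s c x‖ ^ q ≤ K * (∑ n ∈ s, ‖c n‖ ^ p) ^ (q / p))
    (s : Finset ℤ) (b : ℤ → ℂ) {L : ℝ} (hL : 1 ≤ L) {ι : ℝ} (hι : 0 < ι) :
    ∃ G G1 G2 : ℝ → ℝ, (∀ x, HasDerivAt G (G1 x) x) ∧ (∀ x, HasDerivAt G1 (G2 x) x) ∧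
      Continuous G2 ∧ Function.Periodic G (2 * π) ∧ (∀ x, 0 < G x) ∧ (∀ x, ι ≤ G x ^ (q / 2)) ∧
      (∀ x, |G1 x| ≤ 2 * L * G x) ∧ (∀ x, |G2 x| ≤ 20 * L ^ 2 * G x) ∧
      (∫ x in (0:ℝ)..2 * π, G x ^ (q / 2)) ≤ 2 ^ q * (K * (16 * Real.exp 4) ^ q *
        (∑ n ∈ s, bandWeight |n / L| * ‖b n‖ ^ p) ^ (q / p)) + 2 * π * ι ∧
      ∀ x, ‖oscSum s L b 0 x‖ ≤ √(G x) ∧ ‖oscSum s L b 1 x‖ ≤ √(G x) ∧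
        ∃ V, HasSum (fun i : ℕ => ‖lowPass s L b (i + 1) x‖ / (i.factorial : ℝ)) V ∧ V ≤ 2 * √(G x) := by
  have hL0 : 0 < L := by linarith
  have hq0 : 0 < q := by linarith
  have hp0 : 0 < p := hpq.pos
  have hp1 : 1 < p := hpq.lt
  set C₀ := 16 * Real.exp 4 with hC₀
  have hC₀0 : 0 < C₀ := by positivity
  obtain ⟨v, hv, hvb⟩ := exists_summable_oscSum s L b
  -- The floor `ι` gives `ι^(1/q) ≤ √G`, which absorbs the terms beyond `I`; only finitely many
  -- multipliers have to enter `F`.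
  obtain ⟨I, hI⟩ : ∃ I : ℕ, ∑' i, v (i + I) ≤ ι ^ (1 / q) := by
    have := tendsto_sum_nat_add v
    exact ((this.eventually (gt_mem_nhds (show (0:ℝ) < ι ^ (1 / q) by positivity))).exists).imp
      fun _ h => h.le
  -- Dividing by the Poisson factor `r ^ |n| = exp(-|n|/L)` and by `(1/2)^i` leaves coefficients
  -- bounded uniformly in `i`.
  set y : ℕ → ℤ → ℂ := fun i n =>
    ((2 ^ i * oscMult i (n / L) * Real.exp |n / L| : ℝ) : ℂ) * b n with hy
  have hyb : ∀ i n, ‖y i n‖ ≤ C₀ * (bandWeight |n / L| * ‖b n‖) := by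
    intro i n
    simp only [hy]
    rw [norm_mul, Complex.norm_real, Real.norm_eq_abs, abs_mul, abs_mul, abs_of_pos (Real.exp_pos _),
      abs_of_pos (by positivity : (0:ℝ) < 2 ^ i), ← mul_assoc]
    exact mul_le_mul_of_nonneg_right (oscMult_bound i _) (norm_nonneg _)
  set F : ℝ → ℝ := fun x => ∑ i ∈ Finset.range (I + 2), (1 / 2 : ℝ) ^ i * ‖trig s (y i) x‖ with hF
  have hFc : Continuous F := by simp only [hF]; fun_prop
  have hF0 : ∀ x, 0 ≤ F x := fun x => by simp only [hF]; positivity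
  obtain ⟨G, G1, G2, d1, d2, hG2, hGp, hG0, hGι, b1, b2, hint, hconv⟩ :=
    exists_slow_majorant hpq hq2 hL hFc hF0 hι
  refine ⟨G, G1, G2, d1, d2, hG2, hGp, hG0, hGι, b1, b2, ?_, fun x => ?_⟩
  · rw [hint]
    gcongr
    have hgeo : ∑ j ∈ Finset.range (I + 2), (1 / 2 : ℝ) ^ j ≤ 2 := by
      have := Summable.sum_le_tsum (Finset.range (I + 2)) (fun i _ => by positivity)
        (summable_geometric_of_lt_one (by norm_num : (0:ℝ) ≤ 1 / 2) (by norm_num))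
      rw [tsum_geometric_of_lt_one (by norm_num) (by norm_num)] at this
      linarith
    have hc : ∀ i, Continuous fun x => ‖trig s (y i) x‖ ^ q := fun i =>
      (continuous_trig _ _).norm.rpow_const fun x => Or.inr hq0.le
    have hpt : ∀ x, F x ^ q ≤ 2 ^ (q - 1) *
        ∑ i ∈ Finset.range (I + 2), (1 / 2 : ℝ) ^ i * ‖trig s (y i) x‖ ^ q := by
      intro x
      refine (rpow_sum_mul_le _ (by linarith) _ _ (fun _ _ => by positivity)
        (fun _ _ => norm_nonneg _)).trans ?_
      refine mul_le_mul_of_nonneg_right ?_ (by positivity)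
      exact Real.rpow_le_rpow (by positivity) hgeo (by linarith)
    refine (intervalIntegral.integral_mono (by positivity)
      (Continuous.intervalIntegrable (hFc.rpow_const fun x => Or.inr hq0.le) _ _)
      (Continuous.intervalIntegrable (by fun_prop) _ _) hpt).trans ?_
    rw [intervalIntegral.integral_const_mul, intervalIntegral.integral_finsetSum
      fun j _ => Continuous.intervalIntegrable (by fun_prop) _ _]
    set Y := (∑ n ∈ s, bandWeight |n / L| * ‖b n‖ ^ p) with hY
    have hY0 : 0 ≤ Y := Finset.sum_nonneg fun n _ =>
      mul_nonneg (bandWeight_nonneg (abs_nonneg _)) (by positivity)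
    have hi : ∀ i, ∫ x in (0:ℝ)..2 * π, (1 / 2 : ℝ) ^ i * ‖trig s (y i) x‖ ^ q ≤
        (1 / 2 : ℝ) ^ i * (K * C₀ ^ q * Y ^ (q / p)) := by
      intro i
      rw [intervalIntegral.integral_const_mul]
      gcongr
      refine (hHY _ _).trans ?_
      rw [mul_assoc]
      gcongr
      have h1 : ∑ n ∈ s, ‖y i n‖ ^ p ≤ C₀ ^ p * Y := by
        rw [hY, Finset.mul_sum]
        refine Finset.sum_le_sum fun n _ => ?_
        have hb0 := bandWeight_nonneg (abs_nonneg (n / L : ℝ))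
        refine (Real.rpow_le_rpow (norm_nonneg _) (hyb i n) hp0.le).trans ?_
        rw [Real.mul_rpow hC₀0.le (by positivity), Real.mul_rpow hb0 (norm_nonneg _)]
        gcongr
        -- Keeping the band weight to the first power is what later allows the sum over scales to
        -- telescope.
        exact Real.rpow_le_self_of_le_one hb0 (bandWeight_le_one (abs_nonneg _)) hp1.le
      calc (∑ n ∈ s, ‖y i n‖ ^ p) ^ (q / p) ≤ (C₀ ^ p * Y) ^ (q / p) := by gcongr
        _ = C₀ ^ q * Y ^ (q / p) := by
          rw [Real.mul_rpow (by positivity) hY0, ← Real.rpow_mul hC₀0.le, mul_div_cancel₀ _ hp0.ne']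
    have hX : 0 ≤ K * C₀ ^ q * Y ^ (q / p) := by positivity
    calc _ ≤ 2 ^ (q - 1) * ∑ i ∈ Finset.range (I + 2), (1 / 2 : ℝ) ^ i * (K * C₀ ^ q * Y ^ (q / p)) := by
          gcongr with i _; exact hi i
      _ ≤ 2 ^ (q - 1) * (2 * (K * C₀ ^ q * Y ^ (q / p))) := by rw [← Finset.sum_mul]; gcongr
      _ = _ := by rw [Real.rpow_sub_one (by norm_num)]; ring
  · have hsum : ∑ i ∈ Finset.range (I + 2), ‖oscSum s L b i x‖ ≤ √(G x) := by
      refine le_trans ?_ (hconv x)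
      set r := Real.exp (-1 / L) with hr
      have h0 : 0 < r := Real.exp_pos _
      have h1 : r < 1 := Real.exp_lt_one_iff.2 (by rw [neg_div]; exact neg_neg_of_pos (by positivity))
      have hle : ∀ i, ‖oscSum s L b i x‖ ≤
          kconv (circleKernel r) (fun t => (1 / 2 : ℝ) ^ i * ‖trig s (y i) t‖) x := by
        intro i
        have h2 := norm_trig_le_kconv h0 h1 s (fun n => (oscMult i (n / L) : ℂ) * b n)
          (fun n => (((1 / 2 : ℝ) ^ i : ℝ) : ℂ) * y i n) (fun n _ => by
            simp only [hy]
            have : (1 / 2 : ℝ) ^ i * 2 ^ i = 1 := by rw [← mul_pow]; norm_num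
            have h3 : r ^ n.natAbs * Real.exp |n / L| = 1 := by
              rw [hr, ← Real.exp_nat_mul, ← Real.exp_add, Real.exp_eq_one_iff, Nat.cast_natAbs, abs_div,
                abs_of_pos hL0, Int.cast_abs]
              ring
            have h4 : (oscMult i (n / L) : ℝ) = r ^ n.natAbs * ((1 / 2 : ℝ) ^ i *
                (2 ^ i * oscMult i (n / L) * Real.exp |n / L|)) := by
              linear_combination (-oscMult i (n / L)) * this * (r ^ n.natAbs * Real.exp |n / L|) -
                oscMult i (n / L) * h3
            conv_lhs => rw [h4]
            push_cast; ring) x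
        refine h2.trans_eq ?_
        unfold kconv
        refine intervalIntegral.integral_congr fun t _ => ?_
        have : trig s (fun n => (((1 / 2 : ℝ) ^ i : ℝ) : ℂ) * y i n) t =
            (((1 / 2 : ℝ) ^ i : ℝ) : ℂ) * trig s (y i) t := by
          simp only [trig, Finset.mul_sum, mul_assoc]
        dsimp only
        rw [this, norm_mul, Complex.norm_real, Real.norm_of_nonneg (by positivity)]
      refine (Finset.sum_le_sum fun i _ => hle i).trans_eq ?_
      have hk := continuous_circleKernel h0 h1
      simp only [kconv, hF, Finset.mul_sum]
      rw [intervalIntegral.integral_finsetSum fun j _ => Continuous.intervalIntegrable (by fun_prop) _ _]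
    have hnn : ∀ i ∈ Finset.range (I + 2), 0 ≤ ‖oscSum s L b i x‖ := fun i _ => norm_nonneg _
    refine ⟨(Finset.single_le_sum hnn (by simp)).trans hsum,
      (Finset.single_le_sum hnn (by simp)).trans hsum, ?_⟩
    have hs1 : Summable fun i => ‖oscSum s L b (i + 2) x‖ :=
      Summable.of_nonneg_of_le (fun i => norm_nonneg _) (fun i => hvb i x) hv
    refine ⟨∑' i, ‖oscSum s L b (i + 2) x‖, ?_, ?_⟩
    · simp only [← norm_oscSum_add_two]; exact hs1.hasSum
    · rw [← hs1.sum_add_tsum_nat_add I]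
      have h1 : ∑ i ∈ Finset.range I, ‖oscSum s L b (i + 2) x‖ ≤ √(G x) := by
        refine le_trans ?_ hsum
        rw [Finset.sum_range_succ', Finset.sum_range_succ']
        have := norm_nonneg (oscSum s L b 0 x)
        have := norm_nonneg (oscSum s L b (0 + 1) x)
        linarith
      have h2 : ∑' i, ‖oscSum s L b (i + I + 2) x‖ ≤ ι ^ (1 / q) := by
        refine le_trans ?_ hI
        refine Summable.tsum_le_tsum (fun i => hvb (i + I) x) ?_ ((summable_nat_add_iff I).2 hv)
        exact (summable_nat_add_iff I).2 hs1
      have h3 : ι ^ (1 / q) ≤ √(G x) := by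
        have := Real.rpow_le_rpow hι.le (hGι x) (by positivity : 0 ≤ 1 / q)
        rwa [← Real.rpow_mul (hG0 x).le, show q / 2 * (1 / q) = 1 / 2 by field_simp,
          ← Real.sqrt_eq_rpow] at this
      linarith


/-! ### A twice differentiable cut-off. -/

/-- The bounded reciprocal `1 / max w 1`. -/
noncomputable def recip (w : ℝ) : ℝ := 1 / max w 1

lemma continuous_recip : Continuous recip := by
  unfold recip
  exact continuous_const.div (by fun_prop) fun w => (lt_of_lt_of_le one_pos (le_max_right w 1)).ne'

lemma recip_pos (w : ℝ) : 0 < recip w := by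
  have := le_max_right w 1
  unfold recip; positivity

lemma recip_le_one (w : ℝ) : recip w ≤ 1 := by
  have := le_max_right w 1
  unfold recip; rw [div_le_one (by linarith)]; exact this

lemma recip_of_le {w : ℝ} (h : w ≤ 1) : recip w = 1 := by unfold recip; rw [max_eq_right h, div_one]

lemma recip_of_ge {w : ℝ} (h : 1 ≤ w) : recip w = 1 / w := by unfold recip; rw [max_eq_left h]

lemma recip_mul_of_ge {w : ℝ} (h : 1 ≤ w) : recip w * w = 1 := by
  rw [recip_of_ge h]; field_simp

lemma one_sub_recip_le (w : ℝ) : 1 - recip w ≤ |w - 1| := by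
  rcases le_total w 1 with h | h
  · rw [recip_of_le h]; simp
  · rw [recip_of_ge h, abs_of_nonneg (by linarith)]
    rw [one_sub_div (by linarith), div_le_iff₀ (by linarith)]; nlinarith

lemma hasDerivAt_zero_of_le_sq {f : ℝ → ℝ} {a C : ℝ}
    (h : ∀ x, |x - a| ≤ 1 → |f x| ≤ C * |x - a| ^ 2) : HasDerivAt f 0 a := by
  have hO : f =O[nhds a] fun x => ‖x - a‖ ^ 2 := by
    refine Asymptotics.IsBigO.of_bound C ?_
    filter_upwards [Metric.closedBall_mem_nhds a one_pos] with x hx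
    have := h x (by simpa [Real.dist_eq] using hx)
    simpa using this
  have := (hO.hasFDerivAt (by norm_num : 1 < 2)).hasDerivAt
  simpa using this

lemma hasDerivAt_recip {w : ℝ} (h : 1 < w) : HasDerivAt recip (-recip w ^ 2) w := by
  have h1 : HasDerivAt (fun w : ℝ => w⁻¹) (-(w ^ 2)⁻¹) w := hasDerivAt_inv (by linarith)
  refine (h1.congr_of_eventuallyEq ?_).congr_deriv ?_
  · filter_upwards [lt_mem_nhds h] with y hy
    rw [recip_of_ge hy.le, one_div]
  · rw [recip_of_ge h.le]; field_simp

lemma recip_eventually_one {w : ℝ} (h : w < 1) : ∀ᶠ y in nhds w, recip y = 1 := by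
  filter_upwards [gt_mem_nhds h] with y hy using recip_of_le hy.le

/-- The exponent 3 makes the cut-off smooth enough across `w = 1`: there `1 - recip w` has a corner
of order `|w - 1|`, so both its cube and the derivative of the cube are `O(|w - 1|²)`. -/
lemma hasDerivAt_cutoff (w : ℝ) :
    HasDerivAt (fun w => (1 - recip w) ^ 3) (3 * (1 - recip w) ^ 2 * recip w ^ 2) w := by
  rcases lt_trichotomy w 1 with h | rfl | h
  · rw [recip_of_le h.le]
    refine ((hasDerivAt_const w (0:ℝ)).congr_of_eventuallyEq ?_).congr_deriv (by norm_num)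
    filter_upwards [recip_eventually_one h] with y hy
    rw [hy]; norm_num
  · refine (hasDerivAt_zero_of_le_sq (C := 1)
      fun x hx => ?_).congr_deriv (by rw [recip_of_le le_rfl]; norm_num)
    have h1 := one_sub_recip_le x
    have h2 := recip_le_one x
    rw [abs_of_nonneg (pow_nonneg (by linarith) 3), one_mul]
    calc (1 - recip x) ^ 3 ≤ |x - 1| ^ 3 := by gcongr
      _ ≤ |x - 1| ^ 2 := pow_le_pow_of_le_one (abs_nonneg _) hx (by norm_num)
  · exact (((hasDerivAt_recip h).const_sub 1).pow 3).congr_deriv (by push_cast; ring)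

lemma hasDerivAt_cutoff_deriv (w : ℝ) :
    HasDerivAt (fun w => 3 * (1 - recip w) ^ 2 * recip w ^ 2)
      (6 * (1 - recip w) * recip w ^ 4 - 6 * (1 - recip w) ^ 2 * recip w ^ 3) w := by
  rcases lt_trichotomy w 1 with h | rfl | h
  · rw [recip_of_le h.le]
    refine ((hasDerivAt_const w (0:ℝ)).congr_of_eventuallyEq ?_).congr_deriv (by norm_num)
    filter_upwards [recip_eventually_one h] with y hy
    rw [hy]; norm_num
  · refine (hasDerivAt_zero_of_le_sq (C := 3)
      fun x hx => ?_).congr_deriv (by rw [recip_of_le le_rfl]; norm_num)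
    have h1 := one_sub_recip_le x
    have h2 := recip_le_one x
    have h3 := recip_pos x
    rw [abs_of_nonneg (by positivity)]
    calc 3 * (1 - recip x) ^ 2 * recip x ^ 2 ≤ 3 * |x - 1| ^ 2 * 1 ^ 2 := by gcongr
      _ = _ := by ring
  · have := ((((hasDerivAt_recip h).const_sub 1).pow 2).const_mul 3).mul ((hasDerivAt_recip h).pow 2)
    refine this.congr_deriv ?_
    simp only [Pi.pow_apply]
    push_cast; ring

/-! ### Ladders of approximations and their killing weights. -/

/-- A sequence of low-pass approximations `P k` at the scales `L k`, whose variation is controlled by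
slowly varying functions `G k`. -/
structure Ladder where
  L : ℕ → ℝ
  P : ℕ → ℝ → ℂ
  P1 : ℕ → ℝ → ℂ
  P2 : ℕ → ℝ → ℂ
  H : ℕ → ℝ → ℂ
  G : ℕ → ℝ → ℝ
  G1 : ℕ → ℝ → ℝ
  G2 : ℕ → ℝ → ℝ
  κ : ℝ
  one_le_L : ∀ k, 1 ≤ L k
  L_succ : ∀ k, L (k + 1) = 2 * L k
  hasDerivAt_P : ∀ k x, HasDerivAt (P k) (P1 k x) x
  hasDerivAt_P1 : ∀ k x, HasDerivAt (P1 k) (P2 k x) x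
  continuous_P2 : ∀ k, Continuous (P2 k)
  hasDerivAt_H : ∀ k x, HasDerivAt (H k) (I * L k * (P (k + 1) x - P k x)) x
  P_periodic : ∀ k, Function.Periodic (P k) (2 * π)
  H_periodic : ∀ k, Function.Periodic (H k) (2 * π)
  hasDerivAt_G : ∀ k x, HasDerivAt (G k) (G1 k x) x
  hasDerivAt_G1 : ∀ k x, HasDerivAt (G1 k) (G2 k x) x
  continuous_G2 : ∀ k, Continuous (G2 k)
  G_periodic : ∀ k, Function.Periodic (G k) (2 * π)
  κ_pos : 0 < κ
  κ_sq_le : ∀ k x, κ ^ 2 ≤ G k x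
  κ_le : ∀ x, κ ≤ ‖P 0 x‖
  G1_le : ∀ k x, |G1 k x| ≤ 2 * L k * G k x
  G2_le : ∀ k x, |G2 k x| ≤ 20 * L k ^ 2 * G k x
  H_le : ∀ k x, ‖H k x‖ ≤ √(G k x)
  sub_le : ∀ k x, ‖P (k + 1) x - P k x‖ ≤ √(G k x)
  P1_le : ∀ k x, ‖P1 k x‖ ≤ 2 * L k * √(G k x)
  P2_le : ∀ k x, ‖P2 k x‖ ≤ 2 * L k ^ 2 * √(G k x)

namespace Ladder
variable (S : Ladder) (a : ℝ)

lemma L_pos (k : ℕ) : 0 < S.L k := by linarith [S.one_le_L k]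

lemma G_pos (k : ℕ) (x : ℝ) : 0 < S.G k x := (pow_pos S.κ_pos 2).trans_le (S.κ_sq_le k x)

lemma continuous_P (k : ℕ) : Continuous (S.P k) :=
  continuous_iff_continuousAt.2 fun x => (S.hasDerivAt_P k x).continuousAt

lemma continuous_P1 (k : ℕ) : Continuous (S.P1 k) :=
  continuous_iff_continuousAt.2 fun x => (S.hasDerivAt_P1 k x).continuousAt

lemma continuous_H (k : ℕ) : Continuous (S.H k) :=
  continuous_iff_continuousAt.2 fun x => (S.hasDerivAt_H k x).continuousAt

lemma continuous_G (k : ℕ) : Continuous (S.G k) :=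
  continuous_iff_continuousAt.2 fun x => (S.hasDerivAt_G k x).continuousAt

lemma continuous_G1 (k : ℕ) : Continuous (S.G1 k) :=
  continuous_iff_continuousAt.2 fun x => (S.hasDerivAt_G1 k x).continuousAt

/-- The ratio of the size of `P k` to its oscillation. -/
noncomputable def w (k : ℕ) (x : ℝ) : ℝ := ‖S.P k x‖ ^ 2 / (a ^ 2 * S.G k x)

/-- The relative size of the oscillation of `P k`, capped at one. -/
noncomputable def b (k : ℕ) (x : ℝ) : ℝ := recip (S.w a k x)

/-- The killing weights. -/
noncomputable def X : ℕ → ℝ → ℝ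
  | 0, _ => 1
  | k + 1, x => X k x * (1 - S.b a k x) ^ 3

/-- Weights controlling the derivatives of the killing weights. -/
noncomputable def E : ℕ → ℝ → ℝ
  | 0, _ => 0
  -- Halving compensates the doubling of `L`, so that `L k * E k` is carried over unchanged to the
  -- next level. The factor `1 - b` makes `E` vanish where the new weight has been killed.
  | k + 1, x => (E k x / 2 + S.X a k x * S.b a k x) * (1 - S.b a k x)

variable {a}

lemma b_pos (k : ℕ) (x : ℝ) : 0 < S.b a k x := recip_pos _
lemma b_le_one (k : ℕ) (x : ℝ) : S.b a k x ≤ 1 := recip_le_one _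

lemma X_nonneg (k : ℕ) (x : ℝ) : 0 ≤ S.X a k x := by
  induction k with
  | zero => simp [X]
  | succ k ih => exact mul_nonneg ih (pow_nonneg (sub_nonneg.2 (S.b_le_one k x)) 3)

lemma X_succ_le (k : ℕ) (x : ℝ) : S.X a (k + 1) x ≤ S.X a k x * (1 - S.b a k x) := by
  have h1 := S.b_le_one (a := a) k x
  have h2 := S.b_pos (a := a) k x
  refine mul_le_mul_of_nonneg_left ?_ (S.X_nonneg k x)
  exact pow_le_of_le_one (by linarith) (by linarith) (by norm_num)

lemma X_le_one (k : ℕ) (x : ℝ) : S.X a k x ≤ 1 := by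
  induction k with
  | zero => simp [X]
  | succ k ih =>
    have h1 := S.b_le_one (a := a) k x
    have h2 := S.b_pos (a := a) k x
    refine (S.X_succ_le k x).trans ?_
    exact mul_le_one₀ ih (by linarith) (by linarith)

lemma E_nonneg (k : ℕ) (x : ℝ) : 0 ≤ S.E a k x := by
  induction k with
  | zero => simp [E]
  | succ k ih =>
    have h1 := S.b_le_one (a := a) k x
    have h2 := S.b_pos (a := a) k x
    have h3 := S.X_nonneg (a := a) k x
    exact mul_nonneg (by positivity) (by linarith)

lemma E_succ_le (k : ℕ) (x : ℝ) :
    S.E a (k + 1) x ≤ S.E a k x / 2 + S.X a k x * S.b a k x := by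
  have h1 := S.b_le_one (a := a) k x
  have h2 := S.b_pos (a := a) k x
  have h3 := S.X_nonneg (a := a) k x
  have h4 := S.E_nonneg (a := a) k x
  exact mul_le_of_le_one_right (by positivity) (by linarith)

/-- A squared oscillation relative to `P k` is `b k / a²`; this inequality lets `E (k + 1)` pay for
it on the support of `X (k + 1)`. -/
lemma X_succ_mul_b_le (k : ℕ) (x : ℝ) : S.X a (k + 1) x * S.b a k x ≤ S.E a (k + 1) x := by
  have h1 := S.b_le_one (a := a) k x
  have h2 := S.b_pos (a := a) k x
  have h3 := S.X_nonneg (a := a) k x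
  have h4 := S.E_nonneg (a := a) k x
  have h5 := S.X_succ_le (a := a) k x
  calc S.X a (k + 1) x * S.b a k x ≤ S.X a k x * (1 - S.b a k x) * S.b a k x := by gcongr
    _ = (S.X a k x * S.b a k x) * (1 - S.b a k x) := by ring
    _ ≤ _ := mul_le_mul_of_nonneg_right (by linarith) (by linarith)

lemma continuous_w (ha : 0 < a) (k : ℕ) : Continuous (S.w a k) := by
  have h1 := S.continuous_P k
  have h2 := S.continuous_G k
  unfold w
  exact Continuous.div (by fun_prop) (by fun_prop) fun x => by have := S.G_pos k x; positivity

lemma continuous_b (ha : 0 < a) (k : ℕ) : Continuous (S.b a k) :=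
  continuous_recip.comp (S.continuous_w ha k)

lemma continuous_X (ha : 0 < a) (k : ℕ) : Continuous (S.X a k) := by
  induction k with
  | zero => exact continuous_const
  | succ k ih =>
    have h1 := S.continuous_b ha k
    change Continuous fun x => S.X a k x * (1 - S.b a k x) ^ 3
    fun_prop

lemma continuous_E (ha : 0 < a) (k : ℕ) : Continuous (S.E a k) := by
  induction k with
  | zero => exact continuous_const
  | succ k ih =>
    have h1 := S.continuous_b ha k
    have h2 := S.continuous_X ha k
    change Continuous fun x => (S.E a k x / 2 + S.X a k x * S.b a k x) * (1 - S.b a k x)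
    fun_prop

lemma b_periodic (k : ℕ) : Function.Periodic (S.b a k) (2 * π) := fun x => by
  simp only [b, w, S.P_periodic k x, S.G_periodic k x]

lemma X_periodic (k : ℕ) : Function.Periodic (S.X a k) (2 * π) := by
  induction k with
  | zero => intro x; rfl
  | succ k ih => intro x; simp only [X, ih x, S.b_periodic k x]

/-- Where the ratio exceeds one, the oscillation is dominated by `P k`. -/
lemma sqrt_G_le (ha : 0 < a) {k : ℕ} {x : ℝ} (h : 1 ≤ S.w a k x) :
    √(S.G k x) ≤ ‖S.P k x‖ / a := by
  have hG := S.G_pos k x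
  rw [w, le_div_iff₀ (by positivity), one_mul] at h
  rw [le_div_iff₀ ha]
  have h2 : (√(S.G k x) * a) ^ 2 ≤ ‖S.P k x‖ ^ 2 := by rw [mul_pow, Real.sq_sqrt hG.le]; linarith
  exact abs_le_of_sq_le_sq' h2 (norm_nonneg _) |>.2

lemma one_lt_w_of_b_lt {k : ℕ} {x : ℝ} (h : S.b a k x < 1) : 1 < S.w a k x := by
  by_contra h2
  exact h.ne (recip_of_le (not_lt.1 h2))

lemma b_lt_of_X_pos {k : ℕ} {x : ℝ} (h : 0 < S.X a (k + 1) x) : S.b a k x < 1 := by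
  refine lt_of_le_of_ne (S.b_le_one k x) fun h2 => ?_
  simp [X, h2] at h

lemma b_lt_of_E_pos {k : ℕ} {x : ℝ} (h : 0 < S.E a (k + 1) x) : S.b a k x < 1 := by
  refine lt_of_le_of_ne (S.b_le_one k x) fun h2 => ?_
  simp [E, h2] at h

lemma G_eq_of_b_lt (ha : 0 < a) {k : ℕ} {x : ℝ} (h : S.b a k x < 1) :
    S.G k x = S.b a k x / a ^ 2 * ‖S.P k x‖ ^ 2 := by
  have h1 := S.one_lt_w_of_b_lt h
  have hG := S.G_pos k x
  have h2 : S.b a k x * S.w a k x = 1 := recip_mul_of_ge h1.le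
  rw [w, mul_div_assoc', div_eq_one_iff_eq (by positivity)] at h2
  field_simp
  linarith

end Ladder


/-! ### Derivatives of the killing weights. -/

namespace Ladder
variable (S : Ladder) {a : ℝ}

lemma hasDerivAt_normSq {P P1 : ℝ → ℂ} {x : ℝ} (h : HasDerivAt P (P1 x) x) :
    HasDerivAt (fun x => ‖P x‖ ^ 2) (2 * (P x * (starRingEnd ℂ) (P1 x)).re) x := by
  have h2 := h.norm_sq
  refine h2.congr_deriv ?_
  rw [Complex.inner]
  simp [Complex.mul_re]; ring

lemma hasDerivAt_re_mul_conj {P P1 P2 : ℝ → ℂ} {x : ℝ} (h : HasDerivAt P (P1 x) x)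
    (h1 : HasDerivAt P1 (P2 x) x) :
    HasDerivAt (fun x => 2 * (P x * (starRingEnd ℂ) (P1 x)).re)
      (2 * (‖P1 x‖ ^ 2 + (P x * (starRingEnd ℂ) (P2 x)).re)) x := by
  have h2 : HasDerivAt (fun x => (starRingEnd ℂ) (P1 x)) ((starRingEnd ℂ) (P2 x)) x := h1.star
  have h3 := Complex.reCLM.hasFDerivAt.comp_hasDerivAt x (h.mul h2)
  refine (h3.const_mul 2).congr_deriv ?_
  simp only [Complex.reCLM_apply, Complex.add_re, Complex.mul_conj, Complex.ofReal_re,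
    ← Complex.normSq_eq_norm_sq]

/-- First two derivatives of the ratio `w`. -/
lemma exists_w_derivs (ha : 1 ≤ a) (k : ℕ) :
    ∃ w1 w2 : ℝ → ℝ, (∀ x, HasDerivAt (S.w a k) (w1 x) x) ∧ (∀ x, HasDerivAt w1 (w2 x) x) ∧
      Continuous w2 ∧ (∀ x, 1 ≤ S.w a k x → |w1 x| ≤ 6 * S.L k * S.w a k x) ∧
      (∀ x, 1 ≤ S.w a k x → |w2 x| ≤ 56 * S.L k ^ 2 * S.w a k x) := by
  have ha0 : 0 < a := by linarith
  have hG := S.G_pos k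
  have hL := S.L_pos k
  set N : ℝ → ℝ := fun x => ‖S.P k x‖ ^ 2 with hN
  set N1 : ℝ → ℝ := fun x => 2 * (S.P k x * (starRingEnd ℂ) (S.P1 k x)).re with hN1
  set N2 : ℝ → ℝ := fun x => 2 * (‖S.P1 k x‖ ^ 2 + (S.P k x * (starRingEnd ℂ) (S.P2 k x)).re) with hN2
  have dN : ∀ x, HasDerivAt N (N1 x) x := fun x => hasDerivAt_normSq (S.hasDerivAt_P k x)
  have dN1 : ∀ x, HasDerivAt N1 (N2 x) x := fun x =>
    hasDerivAt_re_mul_conj (S.hasDerivAt_P k x) (S.hasDerivAt_P1 k x)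
  set J : ℝ → ℝ := fun x => (a ^ 2 * S.G k x)⁻¹ with hJ
  set R : ℝ → ℝ := fun x => S.G1 k x / S.G k x with hR
  set T : ℝ → ℝ := fun x => S.G2 k x / S.G k x with hT
  have dJ : ∀ x, HasDerivAt J (-(J x * R x)) x := fun x => by
    have hGx := (hG x).ne'
    refine (((S.hasDerivAt_G k x).const_mul (a ^ 2)).inv (by positivity)).congr_deriv ?_
    simp only [hJ, hR]; field_simp
  have dR : ∀ x, HasDerivAt R (T x - R x ^ 2) x := fun x => by
    have hGx := (hG x).ne'
    refine ((S.hasDerivAt_G1 k x).div (S.hasDerivAt_G k x) hGx).congr_deriv ?_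
    simp only [hT, hR]; field_simp
  have hw : ∀ x, S.w a k x = N x * J x := fun x => by simp only [w, hN, hJ, div_eq_mul_inv]
  have hw' : S.w a k = fun x => N x * J x := funext hw
  have hJ0 : ∀ x, 0 < J x := fun x => by have := hG x; simp only [hJ]; positivity
  have hRb : ∀ x, |R x| ≤ 2 * S.L k := fun x => by
    simp only [hR]; rw [abs_div, abs_of_pos (hG x), div_le_iff₀ (hG x)]; exact S.G1_le k x
  have hTb : ∀ x, |T x| ≤ 20 * S.L k ^ 2 := fun x => by
    simp only [hT]; rw [abs_div, abs_of_pos (hG x), div_le_iff₀ (hG x)]; exact S.G2_le k x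
  have cP := S.continuous_P k
  have cP1 := S.continuous_P1 k
  have cP2 := S.continuous_P2 k
  have cG := S.continuous_G k
  have cG1 := S.continuous_G1 k
  have cG2 := S.continuous_G2 k
  have hc : Continuous (starRingEnd ℂ) := Complex.continuous_conj
  have cN : Continuous N := by simp only [hN]; fun_prop
  have cN1 : Continuous N1 := by simp only [hN1]; fun_prop
  have cN2 : Continuous N2 := by simp only [hN2]; fun_prop
  have cJ : Continuous J := Continuous.inv₀ (by fun_prop) fun x => by have := hG x; positivity
  have cR : Continuous R := cG1.div cG fun x => (hG x).ne'
  have cT : Continuous T := cG2.div cG fun x => (hG x).ne'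
  have hsq : ∀ x, 1 ≤ S.w a k x → √(S.G k x) ≤ ‖S.P k x‖ := fun x hx =>
    (S.sqrt_G_le ha0 hx).trans (div_le_self (norm_nonneg _) ha)
  have hre : ∀ z z' : ℂ, |(z * (starRingEnd ℂ) z').re| ≤ ‖z‖ * ‖z'‖ := fun z z' => by
    refine (Complex.abs_re_le_norm _).trans_eq ?_
    rw [norm_mul, RCLike.norm_conj]
  -- Where `w ≥ 1` the oscillation is dominated by `P k`, giving `|N1| ≤ 4 L N` and `|N2| ≤ 12 L²
  -- N`. With `|R| ≤ 2 L` and `|T| ≤ 20 L²` the constants are `6 = 4 + 2` and `56 = 12 + 16 + 28`.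
  have hN1b : ∀ x, 1 ≤ S.w a k x → |N1 x| ≤ 4 * S.L k * N x := fun x hx => by
    have h1 := (S.P1_le k x).trans (mul_le_mul_of_nonneg_left (hsq x hx) (by positivity))
    simp only [hN1, hN]
    rw [abs_mul, abs_two]
    have h2 := hre (S.P k x) (S.P1 k x)
    have h3 := mul_le_mul_of_nonneg_left h1 (norm_nonneg (S.P k x))
    nlinarith
  have hN2b : ∀ x, 1 ≤ S.w a k x → |N2 x| ≤ 12 * S.L k ^ 2 * N x := fun x hx => by
    have h1 := (S.P1_le k x).trans (mul_le_mul_of_nonneg_left (hsq x hx) (by positivity))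
    have h1' := (S.P2_le k x).trans (mul_le_mul_of_nonneg_left (hsq x hx) (by positivity))
    simp only [hN2, hN]
    rw [abs_mul, abs_two]
    have h2 := hre (S.P k x) (S.P2 k x)
    have h3 := mul_le_mul_of_nonneg_left h1' (norm_nonneg (S.P k x))
    have h4 : ‖S.P1 k x‖ ^ 2 ≤ (2 * S.L k * ‖S.P k x‖) ^ 2 := by gcongr
    have h5 := abs_add_le (‖S.P1 k x‖ ^ 2) (S.P k x * (starRingEnd ℂ) (S.P2 k x)).re
    rw [abs_of_nonneg (by positivity : 0 ≤ ‖S.P1 k x‖ ^ 2)] at h5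
    nlinarith
  refine ⟨fun x => N1 x * J x + N x * (-(J x * R x)),
    fun x => (N2 x * J x + N1 x * (-(J x * R x))) + (N1 x * (-(J x * R x)) +
      N x * (-(-(J x * R x) * R x + J x * (T x - R x ^ 2)))), fun x => ?_, fun x => ?_, by fun_prop,
    fun x hx => ?_, fun x hx => ?_⟩
  · rw [hw']; exact (dN x).mul (dJ x)
  · exact ((dN1 x).mul (dJ x)).add ((dN x).mul ((dJ x).mul (dR x)).neg)
  · have h1 := hN1b x hx
    have h2 := hRb x
    have hN0 : 0 ≤ N x := by simp only [hN]; positivity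
    change |N1 x * J x + N x * (-(J x * R x))| ≤ _
    rw [hw, show N1 x * J x + N x * (-(J x * R x)) = (N1 x - N x * R x) * J x by ring, abs_mul,
      abs_of_pos (hJ0 x), ← mul_assoc (6 * S.L k)]
    refine mul_le_mul_of_nonneg_right ?_ (hJ0 x).le
    refine (abs_sub _ _).trans ?_
    rw [abs_mul (N x), abs_of_nonneg hN0]
    have h3 := mul_le_mul_of_nonneg_left h2 hN0
    linarith
  · have h1 := hN1b x hx
    have h1' := hN2b x hx
    have h2 := hRb x
    have h2' := hTb x
    have hN0 : 0 ≤ N x := by simp only [hN]; positivity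
    have e : N2 x * J x + N1 x * (-(J x * R x)) + (N1 x * (-(J x * R x)) +
        N x * (-(-(J x * R x) * R x + J x * (T x - R x ^ 2)))) =
        (N2 x - 2 * N1 x * R x + N x * (2 * R x ^ 2 - T x)) * J x := by ring
    change |N2 x * J x + N1 x * (-(J x * R x)) + (N1 x * (-(J x * R x)) +
        N x * (-(-(J x * R x) * R x + J x * (T x - R x ^ 2))))| ≤ _
    rw [hw, e, abs_mul, abs_of_pos (hJ0 x), ← mul_assoc (56 * S.L k ^ 2)]
    refine mul_le_mul_of_nonneg_right ?_ (hJ0 x).le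
    have h5 : |2 * N1 x * R x| ≤ 2 * (4 * S.L k * N x) * (2 * S.L k) := by
      rw [abs_mul, abs_mul, abs_two]; gcongr
    have h6 : |N x * (2 * R x ^ 2 - T x)| ≤ N x * (28 * S.L k ^ 2) := by
      rw [abs_mul, abs_of_nonneg hN0]
      refine mul_le_mul_of_nonneg_left ((abs_sub _ _).trans ?_) hN0
      rw [abs_of_nonneg (by positivity : 0 ≤ 2 * R x ^ 2), ← sq_abs]
      have : |R x| ^ 2 ≤ (2 * S.L k) ^ 2 := by gcongr
      nlinarith
    have h7 := abs_add_le (N2 x - 2 * N1 x * R x) (N x * (2 * R x ^ 2 - T x))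
    have h8 := abs_sub (N2 x) (2 * N1 x * R x)
    nlinarith

/-- First two derivatives of the factor `(1 - b) ^ 3`. -/
lemma exists_factor_derivs (ha : 1 ≤ a) (k : ℕ) :
    ∃ t1 t2 : ℝ → ℝ, (∀ x, HasDerivAt (fun x => (1 - S.b a k x) ^ 3) (t1 x) x) ∧
      (∀ x, HasDerivAt t1 (t2 x) x) ∧ Continuous t2 ∧
      (∀ x, |t1 x| ≤ 18 * S.L k * S.b a k x * (1 - S.b a k x) ^ 2) ∧
      (∀ x, |t2 x| ≤ 600 * S.L k ^ 2 * S.b a k x * (1 - S.b a k x)) := by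
  have ha0 : 0 < a := by linarith
  obtain ⟨w1, w2, d1, d2, c2, b1, b2⟩ := S.exists_w_derivs ha k
  have hL := S.L_pos k
  have cb := S.continuous_b ha0 k
  have c1 : Continuous w1 := continuous_iff_continuousAt.2 fun x => (d2 x).continuousAt
  refine ⟨fun x => 3 * (1 - S.b a k x) ^ 2 * S.b a k x ^ 2 * w1 x,
    fun x => (6 * (1 - S.b a k x) * S.b a k x ^ 4 - 6 * (1 - S.b a k x) ^ 2 * S.b a k x ^ 3) * w1 x * w1 x +
      3 * (1 - S.b a k x) ^ 2 * S.b a k x ^ 2 * w2 x, fun x => ?_, fun x => ?_, by fun_prop,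
    fun x => ?_, fun x => ?_⟩
  · exact (hasDerivAt_cutoff (S.w a k x)).comp x (d1 x)
  · exact ((hasDerivAt_cutoff_deriv (S.w a k x)).comp x (d1 x)).mul (d2 x)
  · have hb := S.b_pos (a := a) k x
    rcases (S.b_le_one (a := a) k x).eq_or_lt with h | h
    · simp [h]
    · have hw := S.one_lt_w_of_b_lt h
      have hbw : S.b a k x * S.w a k x = 1 := recip_mul_of_ge hw.le
      have h1 := b1 x hw.le
      rw [abs_mul, abs_of_nonneg (by positivity)]
      calc 3 * (1 - S.b a k x) ^ 2 * S.b a k x ^ 2 * |w1 x|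
          ≤ 3 * (1 - S.b a k x) ^ 2 * S.b a k x ^ 2 * (6 * S.L k * S.w a k x) := by gcongr
        _ = 18 * S.L k * S.b a k x * (1 - S.b a k x) ^ 2 * (S.b a k x * S.w a k x) := by ring
        _ = _ := by rw [hbw, mul_one]
  · have hb := S.b_pos (a := a) k x
    rcases (S.b_le_one (a := a) k x).eq_or_lt with h | h
    · simp [h]
    · have hw := S.one_lt_w_of_b_lt h
      have hbw : S.b a k x * S.w a k x = 1 := recip_mul_of_ge hw.le
      have h1 := b1 x hw.le
      have h2 := b2 x hw.le
      set β := S.b a k x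
      set ω := S.w a k x
      have hf : 0 < 1 - β := by linarith
      have hω : 0 < ω := by linarith
      have k1 : |6 * (1 - β) * β ^ 4 - 6 * (1 - β) ^ 2 * β ^ 3| ≤ 12 * (1 - β) * β ^ 3 := by
        refine (abs_sub _ _).trans ?_
        rw [abs_of_nonneg (by positivity), abs_of_nonneg (by positivity)]
        have : 0 < (1 - β) * β ^ 3 := by positivity
        nlinarith
      have k2 : |w1 x| * |w1 x| ≤ (6 * S.L k * ω) * (6 * S.L k * ω) := by gcongr
      refine (abs_add_le _ _).trans ?_
      rw [mul_assoc _ (w1 x), abs_mul, abs_mul (w1 x), abs_mul _ (w2 x),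
        abs_of_nonneg (by positivity : 0 ≤ 3 * (1 - β) ^ 2 * β ^ 2)]
      -- Every surplus factor `ω` is cancelled through `β ω = 1`. The constants are `12 * 36 = 432`
      -- and `3 * 56 = 168`, of sum 600.
      calc _ ≤ 12 * (1 - β) * β ^ 3 * ((6 * S.L k * ω) * (6 * S.L k * ω)) +
            3 * (1 - β) ^ 2 * β ^ 2 * (56 * S.L k ^ 2 * ω) := by gcongr
        _ = 432 * S.L k ^ 2 * β * (1 - β) * (β * ω) ^ 2 +
            168 * S.L k ^ 2 * β * (1 - β) * (1 - β) * (β * ω) := by ring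
        _ ≤ 432 * S.L k ^ 2 * β * (1 - β) + 168 * S.L k ^ 2 * β * (1 - β) * 1 := by
            rw [hbw, one_pow, mul_one, mul_one]; gcongr; linarith
        _ = _ := by ring

/-- First two derivatives of the killing weights. -/
lemma exists_X_derivs (ha : 1 ≤ a) (k : ℕ) :
    ∃ X1 X2 : ℝ → ℝ, (∀ x, HasDerivAt (S.X a k) (X1 x) x) ∧ (∀ x, HasDerivAt X1 (X2 x) x) ∧
      Continuous X2 ∧ (∀ x, |X1 x| ≤ 18 * S.L k * S.E a k x) ∧
      (∀ x, |X2 x| ≤ 650 * S.L k ^ 2 * S.E a k x) := by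
  induction k with
  | zero =>
    refine ⟨fun _ => 0, fun _ => 0, fun x => hasDerivAt_const x 1, fun x => hasDerivAt_const x 0,
      continuous_const, fun x => by simp [E], fun x => by simp [E]⟩
  | succ k ih =>
    obtain ⟨X1, X2, d1, d2, c2, b1, b2⟩ := ih
    obtain ⟨t1, t2, dt1, dt2, ct2, bt1, bt2⟩ := S.exists_factor_derivs ha k
    have ha0 : 0 < a := by linarith
    have cX := S.continuous_X ha0 k
    have cb := S.continuous_b ha0 k
    have c1 : Continuous X1 := continuous_iff_continuousAt.2 fun x => (d2 x).continuousAt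
    have ct1 : Continuous t1 := continuous_iff_continuousAt.2 fun x => (dt2 x).continuousAt
    have hL := S.L_pos k
    refine ⟨fun x => X1 x * (1 - S.b a k x) ^ 3 + S.X a k x * t1 x,
      fun x => (X2 x * (1 - S.b a k x) ^ 3 + X1 x * t1 x) + (X1 x * t1 x + S.X a k x * t2 x),
      fun x => (d1 x).mul (dt1 x), fun x => ((d2 x).mul (dt1 x)).add ((d1 x).mul (dt2 x)),
      by fun_prop, fun x => ?_, fun x => ?_⟩
    all_goals
      have h1 := b1 x
      have h2 := b2 x
      have h3 := bt1 x
      have h4 := bt2 x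
      have hb := S.b_pos (a := a) k x
      have hb1 := S.b_le_one (a := a) k x
      have hX := S.X_nonneg (a := a) k x
      have hE := S.E_nonneg (a := a) k x
      have hf : 0 ≤ 1 - S.b a k x := by linarith
      have hf1 : 1 - S.b a k x ≤ 1 := by linarith
      have p3 : (1 - S.b a k x) ^ 3 ≤ 1 - S.b a k x := pow_le_of_le_one hf hf1 (by norm_num)
      have p2 : (1 - S.b a k x) ^ 2 ≤ 1 - S.b a k x := pow_le_of_le_one hf hf1 (by norm_num)
      simp only [E, S.L_succ]
      set β := S.b a k x
      set e := S.E a k x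
      set χ := S.X a k x
      set l := S.L k
    · refine (abs_add_le _ _).trans ?_
      rw [abs_mul, abs_mul, abs_of_nonneg (pow_nonneg hf 3), abs_of_nonneg hX]
      calc _ ≤ (18 * l * e) * (1 - β) + χ * (18 * l * β * (1 - β)) := by
            gcongr
            exact h3.trans (by gcongr)
        _ ≤ _ := by
            have : 0 ≤ χ * (l * β * (1 - β)) := by positivity
            nlinarith
    -- The constant 650 closes the induction: the multiple of `l² e (1 - β)` available is `4 * 650 /
    -- 2 = 1300`, and `650 + 2 * 18² = 1298` is needed.
    · have k1 : |X1 x * t1 x| ≤ (18 * l * e) * (18 * l * (1 - β)) := by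
        rw [abs_mul]
        gcongr
        refine h3.trans ?_
        calc 18 * l * β * (1 - β) ^ 2 ≤ 18 * l * 1 * (1 - β) := by gcongr
          _ = _ := by ring
      have k2 : |X2 x * (1 - β) ^ 3| ≤ (650 * l ^ 2 * e) * (1 - β) := by
        rw [abs_mul, abs_of_nonneg (pow_nonneg hf 3)]; gcongr
      have k3 : |χ * t2 x| ≤ χ * (600 * l ^ 2 * β * (1 - β)) := by
        rw [abs_mul, abs_of_nonneg hX]; gcongr
      have k4 := abs_add_le (X2 x * (1 - β) ^ 3 + X1 x * t1 x) (X1 x * t1 x + χ * t2 x)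
      have k5 := abs_add_le (X2 x * (1 - β) ^ 3) (X1 x * t1 x)
      have k6 := abs_add_le (X1 x * t1 x) (χ * t2 x)
      have k7 : 0 ≤ l ^ 2 * e * (1 - β) := by positivity
      have k8 : 0 ≤ χ * (l ^ 2 * β * (1 - β)) := by positivity
      nlinarith
end Ladder


/-! ### Negative moments of the approximations. -/

/-- Second-order expansion of `‖1 + w‖ ^ (-2n)`. -/
lemma exists_inv_norm_pow_le (n : ℕ) : ∃ C : ℝ, 0 ≤ C ∧ ∀ w : ℂ, ‖w‖ ≤ 1 / 2 →
    1 / ‖1 + w‖ ^ (2 * n) ≤ 1 - 2 * n * w.re + C * ‖w‖ ^ 2 := by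
  -- Induction on `n` from `1/(1+u) = 1 - u + u²/(1+u)`. It is used with `1 + u = ‖1 + w‖² ≥ 1/4`,
  -- so `u ≥ -3/4` and `1/(1+u) ≤ 4`.
  have key : ∀ n : ℕ, ∃ C : ℝ, 0 ≤ C ∧ ∀ u : ℝ, -3 / 4 ≤ u →
      (1 / (1 + u)) ^ n ≤ 1 - n * u + C * u ^ 2 := by
    intro n
    induction n with
    | zero => exact ⟨0, le_rfl, fun u _ => by simp⟩
    | succ n ih =>
      obtain ⟨C, hC, h⟩ := ih
      refine ⟨4 + 4 * n + 4 * C, by positivity, fun u hu => ?_⟩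
      have h0 : 0 < 1 + u := by linarith
      set v := 1 / (1 + u) with hv
      have hv0 : 0 < v := by positivity
      have hv4 : v ≤ 4 := by rw [hv, div_le_iff₀ h0]; linarith
      have e : v = 1 - u + u ^ 2 * v := by rw [hv]; field_simp; ring
      have h1 := mul_le_mul_of_nonneg_right (h u hu) hv0.le
      rw [pow_succ]
      have hn : (0:ℝ) ≤ n := Nat.cast_nonneg n
      have h2 : u ^ 2 * v ≤ u ^ 2 * 4 := by gcongr
      have h3 : C * u ^ 2 * v ≤ C * u ^ 2 * 4 := by gcongr
      have h4 : n * (u ^ 2 * v) ≤ n * (u ^ 2 * 4) := by gcongr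
      have e2 : u * v = u - u ^ 2 * v := by rw [hv]; field_simp; ring
      have e3 : (1 - n * u + C * u ^ 2) * v = v - n * (u * v) + C * u ^ 2 * v := by ring
      rw [e3, e2] at h1
      push_cast
      nlinarith
  obtain ⟨C, hC, h⟩ := key n
  refine ⟨9 * C, by positivity, fun w hw => ?_⟩
  have e : ‖1 + w‖ ^ 2 = 1 + (2 * w.re + ‖w‖ ^ 2) := by
    rw [Complex.sq_norm, Complex.sq_norm, Complex.normSq_apply, Complex.normSq_apply]
    simp; ring
  have hre := Complex.abs_re_le_norm w
  have hre2 := abs_le.1 hre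
  have h0 := norm_nonneg w
  have h1 := h (2 * w.re + ‖w‖ ^ 2) (by nlinarith)
  rw [pow_mul, ← one_div_pow, e]
  refine h1.trans ?_
  have hn : (0:ℝ) ≤ n := Nat.cast_nonneg n
  have h2 : (2 * w.re + ‖w‖ ^ 2) ^ 2 ≤ 9 * ‖w‖ ^ 2 := by
    have : |2 * w.re + ‖w‖ ^ 2| ≤ 3 * ‖w‖ := by
      rw [abs_le]; constructor <;> nlinarith
    calc (2 * w.re + ‖w‖ ^ 2) ^ 2 = |2 * w.re + ‖w‖ ^ 2| ^ 2 := (sq_abs _).symm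
      _ ≤ (3 * ‖w‖) ^ 2 := by gcongr
      _ = _ := by ring
  have h3 := mul_le_mul_of_nonneg_left h2 hC
  have h4 : 0 ≤ n * ‖w‖ ^ 2 := by positivity
  nlinarith

namespace Ladder
variable (S : Ladder) {a : ℝ}

/-- The size of `P k`, bounded below by the constant `κ`. -/
noncomputable def sz (k : ℕ) (x : ℝ) : ℝ := max ‖S.P k x‖ S.κ

lemma sz_pos (k : ℕ) (x : ℝ) : 0 < S.sz k x := S.κ_pos.trans_le (le_max_right _ _)

lemma continuous_sz (k : ℕ) : Continuous (S.sz k) := (S.continuous_P k).norm.max continuous_const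

lemma κ_le_of_b_lt (ha : 0 < a) {k : ℕ} {x : ℝ} (h : S.b a k x < 1) : a * S.κ ≤ ‖S.P k x‖ := by
  have h1 := S.sqrt_G_le ha (S.one_lt_w_of_b_lt h).le
  have h2 : S.κ ≤ √(S.G k x) := Real.le_sqrt_of_sq_le (S.κ_sq_le k x)
  rw [le_div_iff₀ ha] at h1
  nlinarith

lemma norm_sub_le_of_b_lt (ha : 0 < a) {k : ℕ} {x : ℝ} (h : S.b a k x < 1) :
    ‖S.P (k + 1) x - S.P k x‖ ≤ ‖S.P k x‖ / a :=
  (S.sub_le k x).trans (S.sqrt_G_le ha (S.one_lt_w_of_b_lt h).le)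

lemma norm_P_succ_ge (ha : 0 < a) {k : ℕ} {x : ℝ} (h : S.b a k x < 1) :
    (1 - 1 / a) * ‖S.P k x‖ ≤ ‖S.P (k + 1) x‖ := by
  have h1 := S.norm_sub_le_of_b_lt ha h
  have h2 := norm_sub_norm_le (S.P k x) (S.P (k + 1) x)
  rw [norm_sub_rev] at h2
  have e : (1 - 1 / a) * ‖S.P k x‖ = ‖S.P k x‖ - ‖S.P k x‖ / a := by ring
  linarith

lemma norm_P_succ_le (ha : 1 ≤ a) {k : ℕ} {x : ℝ} (h : S.b a k x < 1) :
    ‖S.P (k + 1) x‖ ≤ 2 * ‖S.P k x‖ := by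
  have h1 := (S.norm_sub_le_of_b_lt (by linarith) h).trans (div_le_self (norm_nonneg _) ha)
  have h2 := norm_sub_norm_le (S.P (k + 1) x) (S.P k x)
  linarith

lemma sz_of_b_lt (ha : 1 ≤ a) {k : ℕ} {x : ℝ} (h : S.b a k x < 1) : S.sz k x = ‖S.P k x‖ := by
  have := S.κ_le_of_b_lt (by linarith) h
  have hκ := S.κ_pos
  exact max_eq_left (by nlinarith)

lemma sz_succ_of_b_lt (ha : 2 ≤ a) {k : ℕ} {x : ℝ} (h : S.b a k x < 1) :
    S.sz (k + 1) x = ‖S.P (k + 1) x‖ := by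
  have h0 : 0 < a := by linarith
  have h1 := S.κ_le_of_b_lt h0 h
  have h2 := S.norm_P_succ_ge h0 h
  have hκ := S.κ_pos
  have h3 : 1 / a ≤ 1 / 2 := by gcongr
  refine max_eq_left ?_
  have h4 : 1 / 2 * ‖S.P k x‖ ≤ (1 - 1 / a) * ‖S.P k x‖ := by gcongr; linarith
  nlinarith

lemma sz_of_X_pos (ha : 2 ≤ a) {k : ℕ} {x : ℝ} (h : 0 < S.X a k x) : S.sz k x = ‖S.P k x‖ := by
  cases k with
  | zero => exact max_eq_left (S.κ_le x)
  | succ k => exact S.sz_succ_of_b_lt ha (S.b_lt_of_X_pos h)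

lemma sz_succ_ge (ha : 2 ≤ a) {k : ℕ} {x : ℝ} (h : S.b a k x < 1) :
    (1 - 1 / a) * S.sz k x ≤ S.sz (k + 1) x := by
  rw [S.sz_of_b_lt (by linarith) h, S.sz_succ_of_b_lt ha h]
  exact S.norm_P_succ_ge (by linarith) h

/-- One step of the weights `E`, relative to a power of the size. -/
lemma E_succ_div_le (ha : 2 ≤ a) {m : ℕ} (hm : 3 / 4 ≤ (1 - 1 / a) ^ m) (k : ℕ) (x : ℝ) :
    S.E a (k + 1) x / S.sz k x ^ m ≤
      2 / 3 * (S.E a k x / S.sz (k - 1) x ^ m) + S.X a k x * S.b a k x / S.sz k x ^ m := by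
  have hs := S.sz_pos
  refine (div_le_div_of_nonneg_right (S.E_succ_le k x) (pow_pos (hs k x) m).le).trans ?_
  rw [add_div]
  refine add_le_add_left ?_ _
  rcases (S.E_nonneg (a := a) k x).eq_or_lt with h | h
  · rw [← h]; simp
  · cases k with
    | zero => simp [E] at h
    | succ k =>
      have h1 := S.sz_succ_ge ha (S.b_lt_of_E_pos h)
      have h0 : 0 ≤ 1 - 1 / a := by
        have : 1 / a ≤ 1 / 2 := by gcongr
        linarith
      have h2 : 3 / 4 * S.sz k x ^ m ≤ S.sz (k + 1) x ^ m := by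
        calc 3 / 4 * S.sz k x ^ m ≤ (1 - 1 / a) ^ m * S.sz k x ^ m := by
              have := (hs k x).le
              gcongr
          _ = ((1 - 1 / a) * S.sz k x) ^ m := (mul_pow _ _ _).symm
          _ ≤ _ := by
            have := (hs k x).le
            gcongr
      have hp := pow_pos (hs k x) m
      rw [Nat.add_sub_cancel, div_div, mul_div_assoc', div_le_div_iff₀ (by
        have := pow_pos (hs (k+1) x) m
        positivity) hp]
      nlinarith [mul_le_mul_of_nonneg_left h2 h.le]

lemma continuous_E_div (ha : 0 < a) (k j m : ℕ) : Continuous fun x => S.E a k x / S.sz j x ^ m :=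
  (S.continuous_E ha k).div ((S.continuous_sz j).pow m) fun x => (pow_pos (S.sz_pos j x) m).ne'

lemma continuous_X_div (ha : 0 < a) (k j m : ℕ) : Continuous fun x => S.X a k x / S.sz j x ^ m :=
  (S.continuous_X ha k).div ((S.continuous_sz j).pow m) fun x => (pow_pos (S.sz_pos j x) m).ne'

lemma continuous_Xb_div (ha : 0 < a) (k j m : ℕ) :
    Continuous fun x => S.X a k x * S.b a k x / S.sz j x ^ m :=
  ((S.continuous_X ha k).mul (S.continuous_b ha k)).div ((S.continuous_sz j).pow m)
    fun x => (pow_pos (S.sz_pos j x) m).ne'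

/-- The holomorphic-type power `conj z ^ n * z ^ (n + 1)`. -/
noncomputable def mixedPow (n : ℕ) (z : ℂ) : ℂ := (starRingEnd ℂ) z ^ n * z ^ (n + 1)

lemma norm_mixedPow (n : ℕ) (z : ℂ) : ‖mixedPow n z‖ = ‖z‖ ^ (2 * n) * ‖z‖ := by
  simp only [mixedPow, norm_mul, norm_pow, RCLike.norm_conj]; ring

lemma inv_mixedPow_mul {n : ℕ} {z : ℂ} (hz : z ≠ 0) (d : ℂ) :
    (mixedPow n z)⁻¹ * d = ((1 / ‖z‖ ^ (2 * n) : ℝ) : ℂ) * (d / z) := by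
  have h : mixedPow n z = ((‖z‖ ^ (2 * n) : ℝ) : ℂ) * z := by
    have e : (starRingEnd ℂ) z * z = (‖z‖ : ℂ) ^ 2 := by rw [mul_comm, Complex.mul_conj']
    rw [mixedPow, pow_succ, ← mul_assoc, ← mul_pow, e, pow_mul]
    push_cast; ring
  rw [h]
  have : ((‖z‖ ^ (2 * n) : ℝ) : ℂ) ≠ 0 := by
    have : ‖z‖ ≠ 0 := norm_ne_zero_iff.2 hz
    exact_mod_cast pow_ne_zero _ this
  push_cast at this ⊢
  field_simp

lemma hasDerivAt_mixedPow (n : ℕ) {P : ℝ → ℂ} {P1 : ℂ} {x : ℝ} (h : HasDerivAt P P1 x) :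
    HasDerivAt (fun x => mixedPow n (P x))
      (n * (starRingEnd ℂ) (P x) ^ (n - 1) * (starRingEnd ℂ) P1 * P x ^ (n + 1) +
        (starRingEnd ℂ) (P x) ^ n * ((n + 1 : ℕ) * P x ^ n * P1)) x := by
  have h2 : HasDerivAt (fun x => (starRingEnd ℂ) (P x)) ((starRingEnd ℂ) P1) x := h.star
  exact (h2.fun_pow n).mul (h.fun_pow (n + 1))

/-- The first-order term in the expansion of the weighted negative moments, integrated by parts. -/
lemma norm_integral_mul_sub_le (ha : 2 ≤ a) {n : ℕ} (hn : 1 ≤ n) (k : ℕ) :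
    Continuous (fun x => (S.X a (k + 1) x : ℂ) * (mixedPow n (S.P k x))⁻¹) ∧
    ‖∫ x in (0:ℝ)..2 * π, (S.X a (k + 1) x : ℂ) * (mixedPow n (S.P k x))⁻¹ *
      (S.P (k + 1) x - S.P k x)‖ ≤
      (36 / a + (4 * n + 2) / a ^ 2) * ∫ x in (0:ℝ)..2 * π, S.E a (k + 1) x / S.sz k x ^ (2 * n) := by
  have ha0 : 0 < a := by linarith
  obtain ⟨X1, X2, d1, d2, -, b1, -⟩ := S.exists_X_derivs (by linarith : 1 ≤ a) (k + 1)
  have cX := S.continuous_X ha0 (k + 1)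
  have c1 : Continuous X1 := continuous_iff_continuousAt.2 fun x => (d2 x).continuousAt
  have cP := S.continuous_P k
  have cP1 := S.continuous_P1 k
  have cH := S.continuous_H k
  have hc : Continuous (starRingEnd ℂ) := Complex.continuous_conj
  have hL := S.L_pos k
  set P := S.P k with hP
  set P1 := S.P1 k with hP1
  set V1 : ℝ → ℂ := fun x => n * (starRingEnd ℂ) (P x) ^ (n - 1) * (starRingEnd ℂ) (P1 x) * P x ^ (n + 1) +
        (starRingEnd ℂ) (P x) ^ n * ((n + 1 : ℕ) * P x ^ n * P1 x) with hV1
  have cV : Continuous fun x => mixedPow n (P x) := by unfold mixedPow; fun_prop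
  have cV1 : Continuous V1 := by simp only [hV1]; fun_prop
  have dV : ∀ x, HasDerivAt (fun x => mixedPow n (P x)) (V1 x) x := fun x =>
    hasDerivAt_mixedPow n (S.hasDerivAt_P k x)
  -- Since `mixedPow n z = |z|^(2n) z`, the product of `F` with the increment of `P` is the weighted
  -- relative increment. The increment is the derivative of `H k` divided by `I * L k`, so
  -- integration by parts gains `1 / L k`, which compensates the factor `L k` lost in `F1`.
  set F : ℝ → ℂ := fun x => (S.X a (k + 1) x : ℂ) * (mixedPow n (P x))⁻¹ with hF
  set F1 : ℝ → ℂ := fun x => (X1 x : ℂ) * (mixedPow n (P x))⁻¹ +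
    (S.X a (k + 1) x : ℂ) * (-V1 x / mixedPow n (P x) ^ 2) with hF1
  have hX1z : ∀ x, S.b a k x = 1 → X1 x = 0 := fun x h => by
    have h2 := b1 x
    rw [show S.E a (k + 1) x = 0 by simp [E, h], mul_zero] at h2
    exact abs_nonpos_iff.1 h2
  have hXz : ∀ x, S.b a k x = 1 → S.X a (k + 1) x = 0 := fun x h => by simp [X, h]
  have hnear : ∀ x, S.w a k x < 1 → ∀ᶠ y in nhds x, S.b a k y = 1 := fun x hx =>
    ((S.continuous_w ha0 k).continuousAt.eventually (gt_mem_nhds hx)).mono fun y hy => recip_of_le hy.le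
  have hPne : ∀ x, 1 ≤ S.w a k x → P x ≠ 0 := fun x hx h0 => by
    have : S.w a k x = 0 := by simp [w, ← hP, h0]
    linarith
  have hVne : ∀ x, P x ≠ 0 → mixedPow n (P x) ≠ 0 := fun x hx => by
    simp [mixedPow, hx]
  -- Zeros of `P` do no harm: where `w < 1` the weight vanishes on a neighbourhood, and where `w ≥
  -- 1` one has `P ≠ 0`.
  have dF : ∀ x, HasDerivAt F (F1 x) x := by
    intro x
    rcases lt_or_ge (S.w a k x) 1 with hw | hw
    · have hn := hnear x hw
      have h1 := hn.self_of_nhds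
      have : F1 x = 0 := by simp [hF1, hX1z x h1, hXz x h1]
      rw [this]
      refine (hasDerivAt_const x (0:ℂ)).congr_of_eventuallyEq (hn.mono fun y hy => ?_)
      simp [hF, hXz y hy]
    · exact (d1 x).ofReal_comp.mul ((dV x).inv (hVne x (hPne x hw)))
  have cF : Continuous F := continuous_iff_continuousAt.2 fun x => (dF x).continuousAt
  have cF1 : Continuous F1 := by
    refine continuous_iff_continuousAt.2 fun x => ?_
    rcases lt_or_ge (S.w a k x) 1 with hw | hw
    · refine (continuousAt_const (y := (0:ℂ))).congr ((hnear x hw).mono fun y hy => ?_)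
      simp [hF1, hX1z y hy, hXz y hy]
    · have h0 := hVne x (hPne x hw)
      have h1 : ContinuousAt (fun x => (mixedPow n (P x))⁻¹) x := cV.continuousAt.inv₀ h0
      have h2 : ContinuousAt (fun x => -V1 x / mixedPow n (P x) ^ 2) x :=
        cV1.continuousAt.neg.div (cV.continuousAt.pow 2) (pow_ne_zero 2 h0)
      have h3 : ContinuousAt (fun x => (X1 x : ℂ)) x := by fun_prop
      have h4 : ContinuousAt (fun x => (S.X a (k + 1) x : ℂ)) x := by fun_prop
      exact (h3.mul h1).add (h4.mul h2)
  refine ⟨cF, ?_⟩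
  have hparts := intervalIntegral.integral_mul_deriv_eq_deriv_mul (a := 0) (b := 2 * π) (u := F)
    (v := S.H k) (u' := F1) (v' := fun x => I * S.L k * (S.P (k + 1) x - P x))
    (fun x _ => dF x) (fun x _ => S.hasDerivAt_H k x) (cF1.intervalIntegrable _ _)
    (Continuous.intervalIntegrable (by have := S.continuous_P (k + 1); fun_prop) _ _)
  have hb : F (2 * π) * S.H k (2 * π) - F 0 * S.H k 0 = 0 := by
    have e1 := S.P_periodic k 0
    have e2 := S.H_periodic k 0
    have e3 := S.X_periodic (a := a) (k + 1) 0
    rw [zero_add] at e1 e2 e3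
    simp only [hF, hP, e1, e2, e3, sub_self]
  rw [hb, zero_sub] at hparts
  have e1 : ∫ x in (0:ℝ)..2 * π, F x * (I * S.L k * (S.P (k + 1) x - P x)) =
      I * S.L k * ∫ x in (0:ℝ)..2 * π, F x * (S.P (k + 1) x - P x) := by
    rw [← intervalIntegral.integral_const_mul]
    refine intervalIntegral.integral_congr fun x _ => ?_
    ring
  rw [e1] at hparts
  have hnorm := congrArg norm hparts
  rw [norm_mul, norm_mul, Complex.norm_I, one_mul, Complex.norm_real, Real.norm_of_nonneg hL.le,
    norm_neg] at hnorm
  have hpt : ∀ x, ‖F1 x * S.H k x‖ ≤ S.L k * ((36 / a + (4 * n + 2) / a ^ 2) *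
      (S.E a (k + 1) x / S.sz k x ^ (2 * n))) := by
    intro x
    have hEn := S.E_nonneg (a := a) (k + 1) x
    have hsp := S.sz_pos k x
    rcases (S.b_le_one (a := a) k x).eq_or_lt with hb | hb
    · have : F1 x = 0 := by simp [hF1, hX1z x hb, hXz x hb]
      rw [this, zero_mul, norm_zero]
      positivity
    · have hw := S.one_lt_w_of_b_lt hb
      have hP0 := hPne x hw.le
      have hP0' : 0 < ‖P x‖ := norm_pos_iff.2 hP0
      have hs : S.sz k x = ‖P x‖ := S.sz_of_b_lt (by linarith) hb
      have hg := S.sqrt_G_le ha0 hw.le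
      have hgs : √(S.G k x) ^ 2 = S.b a k x / a ^ 2 * ‖P x‖ ^ 2 := by
        rw [Real.sq_sqrt (S.G_pos k x).le, S.G_eq_of_b_lt ha0 hb]
      have hH := S.H_le k x
      have hP1b := S.P1_le k x
      have hX1b := b1 x
      rw [S.L_succ] at hX1b
      have hXb := S.X_succ_mul_b_le (a := a) k x
      have hX0 := S.X_nonneg (a := a) (k + 1) x
      have hV1b : ‖V1 x‖ ≤ (2 * n + 1) * ‖P x‖ ^ (2 * n) * ‖P1 x‖ := by
        simp only [hV1]
        refine (norm_add_le _ _).trans_eq ?_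
        simp only [norm_mul, norm_pow, RCLike.norm_conj, Complex.norm_natCast]
        obtain ⟨j, rfl⟩ : ∃ j, n = j + 1 := ⟨n - 1, by omega⟩
        rw [Nat.add_sub_cancel]
        push_cast; ring
      set g := √(S.G k x) with hgdef
      have hg0 : 0 ≤ g := Real.sqrt_nonneg _
      set ρ := ‖P x‖ with hρ
      set Q := ρ ^ (2 * n) with hQ
      have hQ0 : 0 < Q := by positivity
      rw [hs, norm_mul]
      have t1 : ‖F1 x‖ ≤ 18 * (2 * S.L k) * S.E a (k + 1) x / (Q * ρ) +
          S.X a (k + 1) x * ((2 * n + 1) * (2 * S.L k * g) / (Q * ρ ^ 2)) := by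
        simp only [hF1]
        refine (norm_add_le _ _).trans (add_le_add ?_ ?_)
        · rw [norm_mul, norm_inv, norm_mixedPow, Complex.norm_real, Real.norm_eq_abs, ← div_eq_mul_inv]
          gcongr
        · rw [norm_mul, norm_div, norm_neg, norm_pow, norm_mixedPow, Complex.norm_real,
            Real.norm_of_nonneg hX0]
          refine mul_le_mul_of_nonneg_left ?_ hX0
          rw [div_le_div_iff₀ (by positivity) (by positivity)]
          calc ‖V1 x‖ * (Q * ρ ^ 2) ≤ ((2 * n + 1) * Q * (2 * S.L k * g)) * (Q * ρ ^ 2) := by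
                gcongr; exact hV1b.trans (by gcongr)
            _ = _ := by ring
      -- The derivative of the weight meets one factor `g ≤ ρ / a`, hence `36 / a`, where `36 = 18 *
      -- 2` because `L` doubles. The derivative of the power of `P` meets `g² = b ρ² / a²`, and the
      -- factor `b` is paid by `E`.
      calc ‖F1 x‖ * ‖S.H k x‖ ≤ (18 * (2 * S.L k) * S.E a (k + 1) x / (Q * ρ) +
          S.X a (k + 1) x * ((2 * n + 1) * (2 * S.L k * g) / (Q * ρ ^ 2))) * g := by gcongr
        _ = 36 * S.L k * S.E a (k + 1) x / (Q * ρ) * g +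
          S.X a (k + 1) x * ((4 * n + 2) * S.L k * g ^ 2 / (Q * ρ ^ 2)) := by ring
        _ ≤ 36 * S.L k * S.E a (k + 1) x / (Q * ρ) * (ρ / a) +
          S.X a (k + 1) x * ((4 * n + 2) * S.L k * (S.b a k x / a ^ 2 * ρ ^ 2) / (Q * ρ ^ 2)) := by
            rw [hgs]; gcongr
        _ = 36 * S.L k * S.E a (k + 1) x / (Q * a) +
          (S.X a (k + 1) x * S.b a k x) * ((4 * n + 2) * S.L k / (Q * a ^ 2)) := by field_simp
        _ ≤ 36 * S.L k * S.E a (k + 1) x / (Q * a) +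
          S.E a (k + 1) x * ((4 * n + 2) * S.L k / (Q * a ^ 2)) := by gcongr
        _ = _ := by field_simp; rw [hQ]
  have hfin : S.L k * ‖∫ x in (0:ℝ)..2 * π, F x * (S.P (k + 1) x - P x)‖ ≤
      S.L k * ((36 / a + (4 * n + 2) / a ^ 2) *
        ∫ x in (0:ℝ)..2 * π, S.E a (k + 1) x / S.sz k x ^ (2 * n)) := by
    rw [hnorm, ← intervalIntegral.integral_const_mul, ← intervalIntegral.integral_const_mul]
    refine (intervalIntegral.norm_integral_le_integral_norm (by positivity)).trans ?_
    have cE := S.continuous_E_div ha0 (k + 1) k (2 * n)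
    exact intervalIntegral.integral_mono (by positivity)
      (Continuous.intervalIntegrable (by fun_prop) _ _)
      (Continuous.intervalIntegrable (by fun_prop) _ _) hpt
  exact le_of_mul_le_mul_left hfin hL
end Ladder


namespace Ladder
variable (S : Ladder) {a : ℝ}

/-- One step of the weighted negative moments, pointwise. -/
lemma X_succ_div_le (ha : 2 ≤ a) {n : ℕ} {C : ℝ} (hC : 0 ≤ C)
    (hexp : ∀ w : ℂ, ‖w‖ ≤ 1 / 2 → 1 / ‖1 + w‖ ^ (2 * n) ≤ 1 - 2 * n * w.re + C * ‖w‖ ^ 2)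
    (k : ℕ) (x : ℝ) :
    S.X a (k + 1) x / S.sz (k + 1) x ^ (2 * n) ≤
      S.X a k x / S.sz k x ^ (2 * n) - S.X a k x * S.b a k x / S.sz k x ^ (2 * n) -
      2 * n * ((S.X a (k + 1) x : ℂ) * (mixedPow n (S.P k x))⁻¹ * (S.P (k + 1) x - S.P k x)).re +
      C / a ^ 2 * (S.E a (k + 1) x / S.sz k x ^ (2 * n)) := by
  have ha0 : 0 < a := by linarith
  have hs := S.sz_pos k x
  have hX0 := S.X_nonneg (a := a) (k + 1) x
  have hXs := S.X_succ_le (a := a) k x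
  have hE := S.E_nonneg (a := a) (k + 1) x
  have hfirst : S.X a (k + 1) x / S.sz k x ^ (2 * n) ≤
      S.X a k x / S.sz k x ^ (2 * n) - S.X a k x * S.b a k x / S.sz k x ^ (2 * n) := by
    rw [← sub_div]; gcongr; linarith
  rcases hX0.eq_or_lt with h | h
  · rw [← h] at hfirst ⊢
    rw [zero_div] at hfirst ⊢
    have : 0 ≤ C / a ^ 2 * (S.E a (k + 1) x / S.sz k x ^ (2 * n)) := by positivity
    simp only [Complex.ofReal_zero, zero_mul, Complex.zero_re, mul_zero, sub_zero]
    linarith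
  · have hb := S.b_lt_of_X_pos h
    have hw := S.one_lt_w_of_b_lt hb
    have hsz := S.sz_of_b_lt (by linarith : 1 ≤ a) hb
    have hP0 : 0 < ‖S.P k x‖ := by rw [← hsz]; exact hs
    have hP : S.P k x ≠ 0 := norm_pos_iff.1 hP0
    have hsz1 := S.sz_succ_of_b_lt ha hb
    set P := S.P k x with hPdef
    set D := S.P (k + 1) x - P with hD
    set ω := D / P with hω
    -- The relative increment has square at most `b / a²`, so the quadratic remainder is at most `C
    -- / a²` times `X (k + 1) * b k`, hence times `E (k + 1)`.
    have hω2 : ‖ω‖ ^ 2 ≤ S.b a k x / a ^ 2 := by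
      have h1 : ‖D‖ ^ 2 ≤ S.b a k x / a ^ 2 * ‖P‖ ^ 2 := by
        rw [← S.G_eq_of_b_lt ha0 hb, ← Real.sq_sqrt (S.G_pos k x).le]
        have := S.sub_le k x
        gcongr
      rw [hω, norm_div, div_pow, div_le_iff₀ (by positivity)]
      exact h1
    have hω1 : ‖ω‖ ≤ 1 / 2 := by
      have h1 := S.norm_sub_le_of_b_lt ha0 hb
      rw [hω, norm_div, div_le_iff₀ hP0]
      refine h1.trans ?_
      rw [div_eq_mul_inv, mul_comm]
      gcongr
      rw [← one_div]; gcongr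
    have h2 := hexp ω hω1
    have e1 : S.sz (k + 1) x = ‖P‖ * ‖1 + ω‖ := by
      rw [hsz1, ← norm_mul, mul_add, mul_one, hω, mul_div_cancel₀ _ hP, hD]; congr 1; ring
    have e2 : ((S.X a (k + 1) x : ℂ) * (mixedPow n P)⁻¹ * D).re =
        S.X a (k + 1) x / ‖P‖ ^ (2 * n) * ω.re := by
      rw [mul_assoc, inv_mixedPow_mul hP, Complex.re_ofReal_mul, Complex.re_ofReal_mul]; ring
    rw [e1, e2, hsz, mul_pow]
    rw [hsz] at hfirst
    have hXP : 0 ≤ S.X a (k + 1) x / ‖P‖ ^ (2 * n) := by positivity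
    have h3 := mul_le_mul_of_nonneg_left h2 hXP
    have h4 : S.X a (k + 1) x / ‖P‖ ^ (2 * n) * (C * ‖ω‖ ^ 2) ≤
        C / a ^ 2 * (S.E a (k + 1) x / ‖P‖ ^ (2 * n)) := by
      have hXb := S.X_succ_mul_b_le (a := a) k x
      calc S.X a (k + 1) x / ‖P‖ ^ (2 * n) * (C * ‖ω‖ ^ 2)
          ≤ S.X a (k + 1) x / ‖P‖ ^ (2 * n) * (C * (S.b a k x / a ^ 2)) := by gcongr
        _ = C / a ^ 2 * ((S.X a (k + 1) x * S.b a k x) / ‖P‖ ^ (2 * n)) := by field_simp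
        _ ≤ _ := by gcongr
    have e3 : S.X a (k + 1) x / (‖P‖ ^ (2 * n) * ‖1 + ω‖ ^ (2 * n)) =
        S.X a (k + 1) x / ‖P‖ ^ (2 * n) * (1 / ‖1 + ω‖ ^ (2 * n)) := by
      rw [div_mul_div_comm, mul_one]
    rw [e3]
    nlinarith

/-- The weighted negative moments of the approximations do not exceed the initial one. -/
lemma exists_moment_bound {n : ℕ} (hn : 1 ≤ n) :
    ∃ a₀ : ℝ, 8 ≤ a₀ ∧ ∀ a, a₀ ≤ a → ∀ (S : Ladder) (k : ℕ),
      ∫ x in (0:ℝ)..2 * π, S.X a k x / S.sz k x ^ (2 * n) ≤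
      ∫ x in (0:ℝ)..2 * π, 1 / S.sz 0 x ^ (2 * n) := by
  obtain ⟨C, hC, hexp⟩ := exists_inv_norm_pow_le n
  have hn' : (1:ℝ) ≤ n := by exact_mod_cast hn
  -- The term `8 n` gives `(1 - 1/a)^(2n) ≥ 3/4` by Bernoulli; three times the bracket gives `3 δ ≤
  -- 1`.
  refine ⟨8 * n + 3 * (72 * n + 2 * n * (4 * n + 2) + C), by nlinarith, fun a ha S k => ?_⟩
  have ha8 : 8 * (n:ℝ) ≤ a := by nlinarith
  have ha2 : 2 ≤ a := by linarith
  have ha0 : 0 < a := by linarith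
  have ham : 3 / 4 ≤ (1 - 1 / a) ^ (2 * n) := by
    have h1 : 1 / a ≤ 1 := by rw [div_le_one ha0]; linarith
    have h := one_add_mul_le_pow (show -2 ≤ -(1 / a) by linarith) (2 * n)
    have h2 : (2 * n : ℝ) * (1 / a) ≤ 1 / 4 := by
      rw [mul_one_div, div_le_iff₀ ha0]; linarith
    push_cast at h
    rw [← sub_eq_add_neg] at h
    linarith
  set δ := 2 * n * (36 / a + (4 * n + 2) / a ^ 2) + C / a ^ 2 with hδ
  have hδ0 : 0 ≤ δ := by positivity
  have hδ3 : 3 * δ ≤ 1 := by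
    have h1 : δ ≤ (72 * n + 2 * n * (4 * n + 2) + C) / a := by
      have h2 : ∀ c : ℝ, 0 ≤ c → c / a ^ 2 ≤ c / a := fun c hc => by
        gcongr; nlinarith
      calc δ = 72 * n / a + (2 * n * (4 * n + 2)) / a ^ 2 + C / a ^ 2 := by rw [hδ]; ring
        _ ≤ 72 * n / a + (2 * n * (4 * n + 2)) / a + C / a := by
          have := h2 (2 * n * (4 * n + 2)) (by positivity)
          have := h2 C hC
          linarith
        _ = _ := by ring
    have h3 : (72 * n + 2 * n * (4 * n + 2) + C) / a ≤ 1 / 3 := by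
      rw [div_le_iff₀ ha0]; nlinarith
    linarith
  set W : ℕ → ℝ := fun k => ∫ x in (0:ℝ)..2 * π, S.X a k x / S.sz k x ^ (2 * n) with hW
  set Γ : ℕ → ℝ := fun k => ∫ x in (0:ℝ)..2 * π, S.X a k x * S.b a k x / S.sz k x ^ (2 * n) with hΓ
  set Eb : ℕ → ℝ := fun k => ∫ x in (0:ℝ)..2 * π, S.E a k x / S.sz (k - 1) x ^ (2 * n) with hEb
  have hEb0 : ∀ k, 0 ≤ Eb k := fun k => intervalIntegral.integral_nonneg (by positivity) fun x _ =>
    div_nonneg (S.E_nonneg k x) (pow_pos (S.sz_pos _ x) _).le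
  have hEs : ∀ k, Eb (k + 1) ≤ 2 / 3 * Eb k + Γ k := by
    intro k
    simp only [hEb, hΓ, Nat.add_sub_cancel]
    have c1 := S.continuous_E_div ha0 (k + 1) k (2 * n)
    have c2 := S.continuous_E_div ha0 k (k - 1) (2 * n)
    have c3 := S.continuous_Xb_div ha0 k k (2 * n)
    rw [← intervalIntegral.integral_const_mul, ← intervalIntegral.integral_add
      (Continuous.intervalIntegrable (by fun_prop) _ _) (c3.intervalIntegrable _ _)]
    exact intervalIntegral.integral_mono (by positivity) (c1.intervalIntegrable _ _)
      (Continuous.intervalIntegrable (by fun_prop) _ _) (S.E_succ_div_le ha2 ham k)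
  have hWs : ∀ k, W (k + 1) ≤ W k - Γ k + δ * Eb (k + 1) := by
    intro k
    obtain ⟨cF, hF⟩ := S.norm_integral_mul_sub_le ha2 hn k
    have c1 := S.continuous_X_div ha0 (k + 1) (k + 1) (2 * n)
    have c2 := S.continuous_X_div ha0 k k (2 * n)
    have c3 := S.continuous_Xb_div ha0 k k (2 * n)
    have c4 := S.continuous_E_div ha0 (k + 1) k (2 * n)
    have cP := S.continuous_P k
    have cP' := S.continuous_P (k + 1)
    set Φ : ℝ → ℂ := fun x => (S.X a (k + 1) x : ℂ) * (mixedPow n (S.P k x))⁻¹ *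
      (S.P (k + 1) x - S.P k x) with hΦ
    have c5 : Continuous Φ := cF.mul (by fun_prop)
    have c6 : Continuous fun x => (Φ x).re := Complex.continuous_re.comp c5
    have hmono := intervalIntegral.integral_mono (μ := volume) (by positivity : (0:ℝ) ≤ 2 * π)
      (c1.intervalIntegrable _ _) ((((c2.sub c3).sub (continuous_const.mul c6)).add
        (continuous_const.mul c4)).intervalIntegrable _ _)
      (fun x => S.X_succ_div_le ha2 hC hexp k x)
    have hi : ∀ f : ℝ → ℝ, Continuous f → IntervalIntegrable f volume 0 (2 * π) := fun f hf =>
      hf.intervalIntegrable _ _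
    have e : ∫ x in (0:ℝ)..2 * π, (S.X a k x / S.sz k x ^ (2 * n) -
        S.X a k x * S.b a k x / S.sz k x ^ (2 * n) - 2 * n * (Φ x).re +
        C / a ^ 2 * (S.E a (k + 1) x / S.sz k x ^ (2 * n))) =
        W k - Γ k - 2 * n * (∫ x in (0:ℝ)..2 * π, Φ x).re + C / a ^ 2 * Eb (k + 1) := by
      rw [intervalIntegral.integral_add (hi _ (by fun_prop)) (hi _ (by fun_prop)),
        intervalIntegral.integral_sub (hi _ (by fun_prop)) (hi _ (by fun_prop)),
        intervalIntegral.integral_sub (hi _ (by fun_prop)) (hi _ (by fun_prop)),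
        intervalIntegral.integral_const_mul, intervalIntegral.integral_const_mul]
      have e2 : ∫ x in (0:ℝ)..2 * π, (Φ x).re = (∫ x in (0:ℝ)..2 * π, Φ x).re :=
        Complex.reCLM.intervalIntegral_comp_comm (c5.intervalIntegrable _ _)
      rw [e2]
      simp only [hEb, Nat.add_sub_cancel, hW, hΓ]
    replace hmono := hmono.trans_eq e
    have hre := (abs_le.1 (Complex.abs_re_le_norm (∫ x in (0:ℝ)..2 * π, Φ x))).1
    have hEe : ∫ x in (0:ℝ)..2 * π, S.E a (k + 1) x / S.sz k x ^ (2 * n) = Eb (k + 1) := by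
      simp only [hEb, Nat.add_sub_cancel]
    rw [hEe] at hF
    have h7 : -(2 * n * (∫ x in (0:ℝ)..2 * π, Φ x).re) ≤
        2 * n * ((36 / a + (4 * n + 2) / a ^ 2) * Eb (k + 1)) := by
      rw [← mul_neg]
      refine mul_le_mul_of_nonneg_left ?_ (by positivity)
      linarith
    have h8 : δ * Eb (k + 1) = 2 * n * ((36 / a + (4 * n + 2) / a ^ 2) * Eb (k + 1)) +
        C / a ^ 2 * Eb (k + 1) := by rw [hδ]; ring
    rw [h8]
    change W (k + 1) ≤ _ at hmono
    linarith
  -- The quantity `W + 2 δ Eb` does not increase: combining `hWs` and `hEs`, one step changes it by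
  -- at most `-(1 - 3 δ) Γ k`.
  have hV : ∀ k, W k + 2 * δ * Eb k ≤ W 0 := by
    intro k
    induction k with
    | zero => simp [hEb, E]
    | succ k ih =>
      have h1 := hEs k
      have h2 := hWs k
      have h3 := hEb0 k
      have h4 := hEb0 (k + 1)
      have h5 : 3 * δ * Eb (k + 1) ≤ 3 * δ * (2 / 3 * Eb k + Γ k) := by gcongr
      have h6 : 0 ≤ Γ k := intervalIntegral.integral_nonneg (by positivity) fun x _ =>
        div_nonneg (mul_nonneg (S.X_nonneg k x) (S.b_pos k x).le) (pow_pos (S.sz_pos _ x) _).le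
      nlinarith
  have h1 := hV k
  have h2 : 0 ≤ 2 * δ * Eb k := by have := hEb0 k; positivity
  calc W k ≤ W 0 := by linarith
    _ = _ := by simp only [hW, X]
end Ladder


/-! ### Losses paired with `L^q` functions. -/

/-- Hölder's inequality with three factors, with upper bounds for the integrals. -/
lemma integral_rpow_mul_rpow_mul_rpow_le {f g h : ℝ → ℝ} (hf : Continuous f) (hg : Continuous g)
    (hh : Continuous h) (f0 : ∀ x, 0 ≤ f x) (g0 : ∀ x, 0 ≤ g x) (h0 : ∀ x, 0 ≤ h x) {α β γ A B C : ℝ}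
    (hα : 0 ≤ α) (hβ : 0 ≤ β) (hγ : 0 ≤ γ) (hsum : α + β + γ = 1) (hA : 0 < A) (hB : 0 < B) (hC : 0 < C)
    (hfA : ∫ x in (0:ℝ)..2 * π, f x ≤ A) (hgB : ∫ x in (0:ℝ)..2 * π, g x ≤ B)
    (hhC : ∫ x in (0:ℝ)..2 * π, h x ≤ C) :
    ∫ x in (0:ℝ)..2 * π, f x ^ α * g x ^ β * h x ^ γ ≤ A ^ α * B ^ β * C ^ γ := by
  have hpt : ∀ x, f x ^ α * g x ^ β * h x ^ γ ≤
      A ^ α * B ^ β * C ^ γ * (α / A * f x + β / B * g x + γ / C * h x) := by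
    intro x
    have h1 := Real.geom_mean_le_arith_mean3_weighted hα hβ hγ (div_nonneg (f0 x) hA.le)
      (div_nonneg (g0 x) hB.le) (div_nonneg (h0 x) hC.le) hsum
    rw [Real.div_rpow (f0 x) hA.le, Real.div_rpow (g0 x) hB.le, Real.div_rpow (h0 x) hC.le] at h1
    have h2 := mul_le_mul_of_nonneg_left h1 (by positivity : 0 ≤ A ^ α * B ^ β * C ^ γ)
    have e1 : A ^ α * B ^ β * C ^ γ * (f x ^ α / A ^ α * (g x ^ β / B ^ β) * (h x ^ γ / C ^ γ)) =
        f x ^ α * g x ^ β * h x ^ γ := by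
      have := (Real.rpow_pos_of_pos hA α).ne'
      have := (Real.rpow_pos_of_pos hB β).ne'
      have := (Real.rpow_pos_of_pos hC γ).ne'
      field_simp
    rw [e1] at h2
    refine h2.trans_eq ?_
    ring
  have hi : ∀ u : ℝ → ℝ, Continuous u → IntervalIntegrable u volume 0 (2 * π) := fun u hu =>
    hu.intervalIntegrable _ _
  have c1 : Continuous fun x => f x ^ α := hf.rpow_const fun x => Or.inr hα
  have c2 : Continuous fun x => g x ^ β := hg.rpow_const fun x => Or.inr hβ
  have c3 : Continuous fun x => h x ^ γ := hh.rpow_const fun x => Or.inr hγ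
  refine (intervalIntegral.integral_mono (by positivity) (hi _ (by fun_prop)) (hi _ (by fun_prop))
    hpt).trans ?_
  rw [intervalIntegral.integral_const_mul, intervalIntegral.integral_add (hi _ (by fun_prop))
    (hi _ (by fun_prop)), intervalIntegral.integral_add (hi _ (by fun_prop)) (hi _ (by fun_prop)),
    intervalIntegral.integral_const_mul, intervalIntegral.integral_const_mul,
    intervalIntegral.integral_const_mul]
  refine mul_le_of_le_one_right (by positivity) ?_
  calc _ ≤ α / A * A + β / B * B + γ / C * C := by gcongr
    _ = 1 := by rw [div_mul_cancel₀ _ hA.ne', div_mul_cancel₀ _ hB.ne', div_mul_cancel₀ _ hC.ne', hsum]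

namespace Ladder
variable (S : Ladder) {a : ℝ}

/-- Both 1 and `y = a² G / sz²` bound `b`, so `b ≤ y^(p/2)` because `0 ≤ p/2 ≤ 1`. The exponent
`p/2` is chosen so that Hölder produces `(∫ G^(q/2))^(p/q)`, which is linear in the `ℓ^p` mass near
the frequency `L k` and hence summable over levels. -/
lemma b_le_rpow (ha : 1 ≤ a) {p : ℝ} (hp0 : 0 ≤ p) (hp : p ≤ 2) (k : ℕ) (x : ℝ) :
    S.b a k x ≤ a ^ p * S.G k x ^ (p / 2) * (1 / S.sz k x) ^ p := by
  have hG := S.G_pos k x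
  have hs := S.sz_pos k x
  have ha0 : 0 < a := by linarith
  set y := a ^ 2 * S.G k x / S.sz k x ^ 2 with hy
  have hy0 : 0 < y := by positivity
  have hb1 := S.b_le_one (a := a) k x
  have hby : S.b a k x ≤ y := by
    rcases hb1.eq_or_lt with h | h
    · rw [h, hy, le_div_iff₀ (by positivity), one_mul]
      have hw : S.w a k x ≤ 1 := by
        by_contra h2
        have h3 := recip_mul_of_ge (not_le.1 h2).le
        change S.b a k x * S.w a k x = 1 at h3
        rw [h, one_mul] at h3
        exact h2 h3.le
      rw [w, div_le_one (by positivity)] at hw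
      rcases max_choice ‖S.P k x‖ S.κ with h4 | h4
      · rw [sz, h4]; exact hw
      · rw [sz, h4]
        exact (S.κ_sq_le k x).trans (le_mul_of_one_le_left hG.le (one_le_pow₀ ha))
    · have h2 := S.G_eq_of_b_lt ha0 h
      rw [← S.sz_of_b_lt ha h] at h2
      rw [hy, h2]; apply le_of_eq; field_simp
  have key : S.b a k x ≤ y ^ (p / 2) := by
    rcases le_total y 1 with h | h
    · refine hby.trans ?_
      calc y = y ^ (1:ℝ) := (Real.rpow_one y).symm
        _ ≤ y ^ (p / 2) := Real.rpow_le_rpow_of_exponent_ge hy0 h (by linarith)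
    · exact hb1.trans (Real.one_le_rpow h (by linarith))
  refine key.trans_eq ?_
  have e1 : y = (a * (1 / S.sz k x)) ^ 2 * S.G k x := by rw [hy]; field_simp
  rw [e1, Real.mul_rpow (by positivity) hG.le, ← Real.rpow_natCast, ← Real.rpow_mul (by positivity),
    show ((2:ℕ):ℝ) * (p / 2) = p by push_cast; ring, Real.mul_rpow ha0.le (by positivity)]
  ring

/-- The main estimate: the total loss at one level, paired with an `L^q` function. -/
lemma integral_loss_mul_le (ha : 1 ≤ a) {p q : ℝ} (hpq : p.HolderConjugate q) (hp2 : p ≤ 2)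
    {θ : ℝ} (hθ : 0 < θ) (hθe : p / q + θ + 1 / q = 1) {n : ℕ} (hn : (p + 1) / θ ≤ 2 * n) (k : ℕ)
    {A B C : ℝ} (hA : 0 < A) (hB : 0 < B) (hC : 0 < C)
    (hGA : ∫ x in (0:ℝ)..2 * π, S.G k x ^ (q / 2) ≤ A)
    (hWB : 2 * π + ∫ x in (0:ℝ)..2 * π, S.X a k x / S.sz k x ^ (2 * n) ≤ B)
    {T : ℝ → ℝ} (hT : Continuous T) (hT0 : ∀ x, 0 ≤ T x) (hTC : ∫ x in (0:ℝ)..2 * π, T x ^ q ≤ C) :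
    ∫ x in (0:ℝ)..2 * π, S.X a k x * S.b a k x / S.sz k x * T x ≤
      a ^ p * (A ^ (p / q) * B ^ θ * C ^ (1 / q)) := by
  have ha0 : 0 < a := by linarith
  have hq0 : 0 < q := hpq.symm.pos
  have hp0 : 0 < p := hpq.pos
  have cG := S.continuous_G k
  have cX := S.continuous_X ha0 k
  have cs := S.continuous_sz k
  have cb := S.continuous_b ha0 k
  have cXd := S.continuous_X_div ha0 k k (2 * n)
  have hG := S.G_pos k
  have hs := S.sz_pos k
  have cf : Continuous fun x => S.G k x ^ (q / 2) := cG.rpow_const fun x => Or.inl (hG x).ne'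
  have cg : Continuous fun x => S.X a k x + S.X a k x / S.sz k x ^ (2 * n) := cX.add cXd
  have ch : Continuous fun x => T x ^ q := hT.rpow_const fun x => Or.inr hq0.le
  have g0 : ∀ x, 0 ≤ S.X a k x + S.X a k x / S.sz k x ^ (2 * n) := fun x => by
    have := S.X_nonneg (a := a) k x
    have := hs x
    positivity
  have hg : ∫ x in (0:ℝ)..2 * π, (S.X a k x + S.X a k x / S.sz k x ^ (2 * n)) ≤ B := by
    rw [intervalIntegral.integral_add (cX.intervalIntegrable _ _) (cXd.intervalIntegrable _ _)]
    refine le_trans (add_le_add_left ?_ _) hWB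
    calc ∫ x in (0:ℝ)..2 * π, S.X a k x ≤ ∫ x in (0:ℝ)..2 * π, (1:ℝ) :=
          intervalIntegral.integral_mono (by positivity) (cX.intervalIntegrable _ _)
            (continuous_const.intervalIntegrable _ _) (S.X_le_one k)
      _ = 2 * π := by simp
  -- The three factors carry `G^(p/2)`, the negative power `sz^(-(p+1))` together with `X`, and `T`.
  -- The middle one is dominated by the negative moment to the power `θ`, because `(p + 1) / θ ≤ 2
  -- n`.
  have hmain := integral_rpow_mul_rpow_mul_rpow_le cf cg ch (fun x => (Real.rpow_pos_of_pos (hG x) _).le)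
    g0 (fun x => Real.rpow_nonneg (hT0 x) _) (by positivity : 0 ≤ p / q) hθ.le
    (by positivity : 0 ≤ 1 / q) hθe hA hB hC hGA hg hTC
  refine le_trans ?_ (mul_le_mul_of_nonneg_left hmain (by positivity : 0 ≤ a ^ p))
  rw [← intervalIntegral.integral_const_mul]
  have c1 : Continuous fun x => (S.G k x ^ (q / 2)) ^ (p / q) := cf.rpow_const fun x =>
    Or.inr (by positivity)
  have c2 : Continuous fun x => (S.X a k x + S.X a k x / S.sz k x ^ (2 * n)) ^ θ := cg.rpow_const fun x =>
    Or.inr hθ.le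
  have c3 : Continuous fun x => (T x ^ q) ^ (1 / q) := ch.rpow_const fun x =>
    Or.inr (by positivity)
  have c4 : Continuous fun x => S.X a k x * S.b a k x / S.sz k x * T x :=
    ((cX.mul cb).div cs fun x => (hs x).ne').mul hT
  refine intervalIntegral.integral_mono (by positivity) (c4.intervalIntegrable _ _)
    (Continuous.intervalIntegrable (by fun_prop) _ _) fun x => ?_
  have hX0 := S.X_nonneg (a := a) k x
  have hX1 := S.X_le_one (a := a) k x
  have hsx := hs x
  have hb := S.b_le_rpow ha hp0.le hp2 k x
  have e1 : (S.G k x ^ (q / 2)) ^ (p / q) = S.G k x ^ (p / 2) := by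
    rw [← Real.rpow_mul (hG x).le]; congr 1; field_simp
  have e3 : (T x ^ q) ^ (1 / q) = T x := by
    rw [← Real.rpow_mul (hT0 x), mul_one_div_cancel hq0.ne', Real.rpow_one]
  have e2 : S.X a k x * ((1 / S.sz k x) ^ p * (1 / S.sz k x)) ≤
      (S.X a k x + S.X a k x / S.sz k x ^ (2 * n)) ^ θ := by
    set y := 1 / S.sz k x with hy
    have hy0 : 0 < y := by positivity
    have e4 : S.X a k x + S.X a k x / S.sz k x ^ (2 * n) = S.X a k x * (1 + y ^ (2 * n)) := by
      rw [hy, one_div_pow]; ring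
    rw [e4, Real.mul_rpow hX0 (by positivity)]
    have h1 : S.X a k x ≤ S.X a k x ^ θ := by
      have hθ1 : θ ≤ 1 := by
        have : 0 ≤ p / q := by positivity
        have : 0 ≤ 1 / q := by positivity
        linarith
      rcases hX0.eq_or_lt with h | h
      · rw [← h, Real.zero_rpow hθ.ne']
      · calc S.X a k x = S.X a k x ^ (1:ℝ) := (Real.rpow_one _).symm
          _ ≤ _ := Real.rpow_le_rpow_of_exponent_ge h hX1 hθ1
    have h2 : y ^ p * y ≤ (1 + y ^ (2 * n)) ^ θ := by
      have h3 : y ^ ((p + 1) / θ) ≤ 1 + y ^ (2 * n) := by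
        rcases le_total y 1 with h | h
        · have : y ^ ((p + 1) / θ) ≤ 1 := Real.rpow_le_one hy0.le h (by positivity)
          have : 0 < y ^ (2 * n) := by positivity
          linarith
        · have : y ^ ((p + 1) / θ) ≤ y ^ ((2 * n : ℕ) : ℝ) :=
            Real.rpow_le_rpow_of_exponent_le h (by push_cast; exact hn)
          rw [Real.rpow_natCast] at this
          linarith
      calc y ^ p * y = (y ^ ((p + 1) / θ)) ^ θ := by
            rw [← Real.rpow_mul hy0.le, div_mul_cancel₀ _ hθ.ne', Real.rpow_add_one hy0.ne']
        _ ≤ _ := by gcongr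
    exact mul_le_mul h1 h2 (by positivity) (by positivity)
  dsimp only
  rw [e1, e3]
  have hGp : 0 ≤ S.G k x ^ (p / 2) := (Real.rpow_pos_of_pos (hG x) _).le
  have hTx := hT0 x
  calc S.X a k x * S.b a k x / S.sz k x * T x
      ≤ S.X a k x * (a ^ p * S.G k x ^ (p / 2) * (1 / S.sz k x) ^ p) / S.sz k x * T x := by gcongr
    _ = a ^ p * (S.G k x ^ (p / 2) * (S.X a k x * ((1 / S.sz k x) ^ p * (1 / S.sz k x))) * T x) := by ring
    _ ≤ _ := by gcongr

/-- The quantities `u k` bounding the pairings of `E` with `L^q` functions. -/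
noncomputable def pairBound (D : ℕ → ℝ) : ℕ → ℝ
  | 0 => 0
  | k + 1 => 2 / 3 * pairBound D k + D k

/-- Each `D k` enters with the geometric series `1 + 2/3 + (2/3)² + … = 3`; the second term on the
left accounts for its unused tail. -/
lemma sum_pairBound (D : ℕ → ℝ) (K : ℕ) :
    ∑ k ∈ Finset.range K, pairBound D (k + 1) + 2 * pairBound D K = 3 * ∑ k ∈ Finset.range K, D k := by
  induction K with
  | zero => simp [pairBound]
  | succ K ih =>
    rw [Finset.sum_range_succ, Finset.sum_range_succ, mul_add, ← ih]
    simp only [pairBound]; ring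

lemma pairBound_nonneg {D : ℕ → ℝ} (hD : ∀ k, 0 ≤ D k) (k : ℕ) : 0 ≤ pairBound D k := by
  induction k with
  | zero => exact le_rfl
  | succ k ih => have := hD k; simp only [pairBound]; positivity

lemma integral_E_mul_le (ha : 4 ≤ a) {D : ℕ → ℝ} {T : ℝ → ℝ} (hT : Continuous T) (hT0 : ∀ x, 0 ≤ T x)
    (hD : ∀ k, ∫ x in (0:ℝ)..2 * π, S.X a k x * S.b a k x / S.sz k x * T x ≤ D k) (k : ℕ) :
    ∫ x in (0:ℝ)..2 * π, S.E a k x / S.sz (k - 1) x * T x ≤ pairBound D k := by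
  have ha0 : 0 < a := by linarith
  induction k with
  | zero => simp [E, pairBound]
  | succ k ih =>
    have c1 : Continuous fun x => S.E a (k + 1) x / S.sz k x ^ 1 := S.continuous_E_div ha0 (k + 1) k 1
    have c2 : Continuous fun x => S.E a k x / S.sz (k - 1) x ^ 1 := S.continuous_E_div ha0 k (k - 1) 1
    have c3 : Continuous fun x => S.X a k x * S.b a k x / S.sz k x ^ 1 := S.continuous_Xb_div ha0 k k 1
    simp only [pow_one] at c1 c2 c3
    simp only [Nat.add_sub_cancel, pairBound]
    have h1 : 1 / a ≤ 1 / 4 := by gcongr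
    refine (intervalIntegral.integral_mono (g := fun x => 2 / 3 * (S.E a k x / S.sz (k - 1) x * T x) +
      S.X a k x * S.b a k x / S.sz k x * T x) (by positivity)
      (Continuous.intervalIntegrable (by fun_prop) _ _)
      (Continuous.intervalIntegrable (by fun_prop) _ _) fun x => ?_).trans ?_
    · have := S.E_succ_div_le (by linarith : 2 ≤ a) (m := 1) (by rw [pow_one]; linarith) k x
      simp only [pow_one] at this
      have := mul_le_mul_of_nonneg_right this (hT0 x)
      dsimp only
      linarith
    · rw [intervalIntegral.integral_add (Continuous.intervalIntegrable (by fun_prop) _ _)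
        (Continuous.intervalIntegrable (by fun_prop) _ _), intervalIntegral.integral_const_mul]
      linarith [hD k]

/-- The total mass lost. -/
lemma integral_one_sub_X_le (ha : 1 ≤ a) {D : ℕ → ℝ}
    (hD : ∀ k, ∫ x in (0:ℝ)..2 * π, S.X a k x * S.b a k x / S.sz k x * S.sz k x ≤ D k) (K : ℕ) :
    ∫ x in (0:ℝ)..2 * π, (1 - S.X a K x) ≤ 3 * ∑ k ∈ Finset.range K, D k := by
  have ha0 : 0 < a := by linarith
  induction K with
  | zero => simp [X]
  | succ K ih =>
    have cX := S.continuous_X ha0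
    have cb := S.continuous_b ha0 K
    have hs := S.sz_pos K
    rw [Finset.sum_range_succ, mul_add]
    have h1 : ∫ x in (0:ℝ)..2 * π, S.X a K x * S.b a K x ≤ D K := by
      refine le_trans (le_of_eq ?_) (hD K)
      refine intervalIntegral.integral_congr fun x _ => ?_
      rw [div_mul_cancel₀ _ (hs x).ne']
    refine (intervalIntegral.integral_mono (g := fun x => (1 - S.X a K x) +
      3 * (S.X a K x * S.b a K x)) (by positivity)
      (Continuous.intervalIntegrable (by have := cX (K + 1); fun_prop) _ _)
      (Continuous.intervalIntegrable (by have := cX K; fun_prop) _ _) fun x => ?_).trans ?_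
    · have hb := S.b_pos (a := a) K x
      have hb1 := S.b_le_one (a := a) K x
      have hX := S.X_nonneg (a := a) K x
      -- Bernoulli's inequality: one step of killing removes at most `3 X b`.
      have h2 : 1 - 3 * S.b a K x ≤ (1 - S.b a K x) ^ 3 := by nlinarith [sq_nonneg (S.b a K x)]
      simp only [X]
      nlinarith
    · have c0 := cX K
      rw [intervalIntegral.integral_add (Continuous.intervalIntegrable (by fun_prop) _ _)
        (Continuous.intervalIntegrable (by fun_prop) _ _), intervalIntegral.integral_const_mul]
      linarith
end Ladder


/-! ### Integrating tapers of `Q` against the weights. -/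

lemma integral_mul_deriv_deriv {f f1 f2 : ℝ → ℝ} {g g1 g2 : ℝ → ℂ}
    (hf : ∀ x, HasDerivAt f (f1 x) x) (hf1 : ∀ x, HasDerivAt f1 (f2 x) x) (cf : Continuous f2)
    (hg : ∀ x, HasDerivAt g (g1 x) x) (hg1 : ∀ x, HasDerivAt g1 (g2 x) x) (cg : Continuous g2)
    (pf : Function.Periodic f (2 * π)) (pf1 : Function.Periodic f1 (2 * π))
    (pg : Function.Periodic g (2 * π)) (pg1 : Function.Periodic g1 (2 * π)) :
    ∫ x in (0:ℝ)..2 * π, (f x : ℂ) * g2 x = ∫ x in (0:ℝ)..2 * π, (f2 x : ℂ) * g x := by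
  have cf1 : Continuous f1 := continuous_iff_continuousAt.2 fun x => (hf1 x).continuousAt
  have cg1 : Continuous g1 := continuous_iff_continuousAt.2 fun x => (hg1 x).continuousAt
  have ef := pf 0
  have ef1 := pf1 0
  have eg := pg 0
  have eg1 := pg1 0
  rw [zero_add] at ef ef1 eg eg1
  rw [intervalIntegral.integral_mul_deriv_eq_deriv_mul (u := fun x => (f x : ℂ)) (v := g1)
    (u' := fun x => (f1 x : ℂ)) (fun x _ => (hf x).ofReal_comp) (fun x _ => hg1 x)
    (Continuous.intervalIntegrable (by fun_prop) _ _) (cg.intervalIntegrable _ _),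
    intervalIntegral.integral_mul_deriv_eq_deriv_mul (u := fun x => (f1 x : ℂ)) (v := g)
    (u' := fun x => (f2 x : ℂ)) (fun x _ => (hf1 x).ofReal_comp) (fun x _ => hg x)
    (Continuous.intervalIntegrable (by fun_prop) _ _) (cg1.intervalIntegrable _ _), ef, ef1, eg, eg1]
  ring

namespace Ladder
variable (S : Ladder) {a : ℝ}

/-- `T` is a nonnegative continuous function whose pairings with the losses are bounded by `D`. -/
def Paired (a : ℝ) (D : ℕ → ℝ) (T : ℝ → ℝ) : Prop :=
  Continuous T ∧ (∀ x, 0 ≤ T x) ∧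
    ∀ k, ∫ x in (0:ℝ)..2 * π, S.X a k x * S.b a k x / S.sz k x * T x ≤ D k

lemma L_eq (k : ℕ) : S.L k = S.L 0 * 2 ^ k := by
  induction k with
  | zero => simp
  | succ k ih => rw [S.L_succ, ih]; ring

/-- The weight changes by at most `3 X b` at level `k + 1`. On the support of `X (k + 1)` one has
`‖P (k + 1)‖ ≤ 2 ‖P k‖`, so the bound `2 T / ‖P k‖` becomes `4 T / sz (k + 1)` and is paired at the
level of the loss; `12 = 3 * 4`. -/
lemma norm_integral_X_sub_mul_le (ha : 4 ≤ a) {D : ℕ → ℝ} {T : ℝ → ℝ} (hT : S.Paired a D T)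
    {f : ℝ → ℂ} (k : ℕ)
    (hfT : ∀ x, S.b a k x < 1 → ‖f x‖ ≤ 2 / ‖S.P k x‖ * T x) :
    ‖∫ x in (0:ℝ)..2 * π, ((S.X a (k + 2) x - S.X a (k + 1) x : ℝ) : ℂ) * f x‖ ≤ 12 * D (k + 1) := by
  have ha0 : 0 < a := by linarith
  obtain ⟨cT, T0, hD⟩ := hT
  have c3 : Continuous fun x => S.X a (k + 1) x * S.b a (k + 1) x / S.sz (k + 1) x ^ 1 :=
    S.continuous_Xb_div ha0 (k + 1) (k + 1) 1
  simp only [pow_one] at c3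
  refine (intervalIntegral.norm_integral_le_of_norm_le
    (g := fun x => 12 * (S.X a (k + 1) x * S.b a (k + 1) x / S.sz (k + 1) x * T x)) (by positivity)
    (Filter.Eventually.of_forall fun x _ => ?_) (Continuous.intervalIntegrable (by fun_prop) _ _)).trans ?_
  · have hb := S.b_pos (a := a) (k + 1) x
    have hb1 := S.b_le_one (a := a) (k + 1) x
    have hX := S.X_nonneg (a := a) (k + 1) x
    have hs := S.sz_pos (k + 1) x
    have hTx := T0 x
    rcases hX.eq_or_lt with h | h
    · have : S.X a (k + 2) x = 0 := by rw [X, ← h, zero_mul]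
      rw [this, ← h]; simp
    have hlt := S.b_lt_of_X_pos h
    have e : S.X a (k + 2) x - S.X a (k + 1) x =
        -(S.X a (k + 1) x * (1 - (1 - S.b a (k + 1) x) ^ 3)) := by rw [X]; ring
    have h2 : 1 - (1 - S.b a (k + 1) x) ^ 3 ≤ 3 * S.b a (k + 1) x := by
      nlinarith [sq_nonneg (S.b a (k + 1) x)]
    have h3 : 0 ≤ 1 - (1 - S.b a (k + 1) x) ^ 3 :=
      sub_nonneg.2 (pow_le_one₀ (by linarith) (by linarith))
    have hP : 0 < ‖S.P k x‖ := by
      rw [← S.sz_of_b_lt (by linarith) hlt]; exact S.sz_pos k x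
    have h4 : S.sz (k + 1) x ≤ 2 * ‖S.P k x‖ := by
      rw [S.sz_succ_of_b_lt (by linarith) hlt]; exact S.norm_P_succ_le (by linarith) hlt
    have h5 : 2 / ‖S.P k x‖ ≤ 4 / S.sz (k + 1) x := by
      rw [div_le_div_iff₀ hP hs]; linarith
    rw [norm_mul, Complex.norm_real, Real.norm_eq_abs, e, abs_neg, abs_of_nonneg (mul_nonneg hX h3)]
    calc _ ≤ S.X a (k + 1) x * (3 * S.b a (k + 1) x) * (4 / S.sz (k + 1) x * T x) := by
          refine mul_le_mul (mul_le_mul_of_nonneg_left h2 hX)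
            ((hfT x hlt).trans (mul_le_mul_of_nonneg_right h5 hTx)) (norm_nonneg _) (by positivity)
      _ = _ := by ring
  · rw [intervalIntegral.integral_const_mul]
    exact mul_le_mul_of_nonneg_left (hD _) (by norm_num)

/-- Two integrations by parts put both derivatives on the weight, where they cost `650 L² E`. With
`L (k + 1)² = 256 * 4^k`, the constant is `332800 = 650 * 256 * 2`. -/
lemma norm_integral_X_mul_deriv_le (ha : 4 ≤ a) (hL : S.L 0 = 8) {D : ℕ → ℝ} {T : ℝ → ℝ}
    (hT : S.Paired a D T) {f f1 f2 : ℝ → ℂ}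
    (hf : ∀ x, HasDerivAt f (f1 x) x) (hf1 : ∀ x, HasDerivAt f1 (f2 x) x) (cf : Continuous f2)
    (pf : Function.Periodic f (2 * π)) (pf1 : Function.Periodic f1 (2 * π)) (k : ℕ)
    (hfT : ∀ x, S.b a k x < 1 → ‖f x‖ ≤ 2 / ‖S.P k x‖ * T x) :
    ‖∫ x in (0:ℝ)..2 * π, (S.X a (k + 1) x : ℂ) * f2 x‖ ≤ 332800 * 4 ^ k * pairBound D (k + 1) := by
  have ha0 : 0 < a := by linarith
  obtain ⟨cT, T0, hD⟩ := hT
  obtain ⟨X1, X2, d1, d2, c2, -, b2⟩ := S.exists_X_derivs (by linarith : 1 ≤ a) (k + 1)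
  have pX := S.X_periodic (a := a) (k + 1)
  rw [integral_mul_deriv_deriv d1 d2 c2 hf hf1 cf pX (periodic_deriv pX d1) pf pf1]
  have hmain := S.integral_E_mul_le ha cT T0 hD (k + 1)
  simp only [Nat.add_sub_cancel] at hmain
  have c1 : Continuous fun x => S.E a (k + 1) x / S.sz k x ^ 1 := S.continuous_E_div ha0 (k + 1) k 1
  simp only [pow_one] at c1
  refine (intervalIntegral.norm_integral_le_of_norm_le
    (g := fun x => 332800 * 4 ^ k * (S.E a (k + 1) x / S.sz k x * T x)) (by positivity)
    (Filter.Eventually.of_forall fun x _ => ?_) (Continuous.intervalIntegrable (by fun_prop) _ _)).trans ?_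
  · have hE := S.E_nonneg (a := a) (k + 1) x
    have h := b2 x
    have e : S.L (k + 1) ^ 2 = 256 * 4 ^ k := by
      rw [S.L_eq, hL, mul_pow, ← pow_mul, mul_comm (k + 1) 2, pow_mul, pow_succ]; norm_num; ring
    rw [e] at h
    rw [norm_mul, Complex.norm_real, Real.norm_eq_abs]
    rcases hE.eq_or_lt with h0 | h0
    · rw [← h0, mul_zero] at h
      rw [le_antisymm h (abs_nonneg _), ← h0]; simp
    have hlt := S.b_lt_of_E_pos h0
    have h3 := hfT x hlt
    rw [← S.sz_of_b_lt (by linarith) hlt] at h3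
    calc _ ≤ 650 * (256 * 4 ^ k) * S.E a (k + 1) x * (2 / S.sz k x * T x) :=
          mul_le_mul h h3 (norm_nonneg _) (by positivity)
      _ = _ := by ring
  · rw [intervalIntegral.integral_const_mul]
    exact mul_le_mul_of_nonneg_left hmain (by positivity)

/-- The telescoping estimate for the integral of `Q k` against the weight `X k`. -/
lemma norm_integral_X_mul_le (ha : 4 ≤ a) (hL : S.L 0 = 8) {D : ℕ → ℝ} (hD : ∀ k, 0 ≤ D k)
    {Q R R1 R2 : ℕ → ℝ → ℂ} (cQ : ∀ k, Continuous (Q k)) (hQ0 : ∀ x, Q 0 x = 0)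
    (hQ : ∀ k x, Q (k + 1) x - Q k x = -(1 / 4 ^ k) * R2 k x)
    (hR : ∀ k x, HasDerivAt (R k) (R1 k x) x) (hR1 : ∀ k x, HasDerivAt (R1 k) (R2 k x) x)
    (cR : ∀ k, Continuous (R2 k)) (pR : ∀ k, Function.Periodic (R k) (2 * π))
    (pR1 : ∀ k, Function.Periodic (R1 k) (2 * π))
    (hQT : ∀ k, ∃ T, S.Paired a D T ∧ ∀ x, S.b a k x < 1 → ‖Q (k + 1) x‖ ≤ 2 / ‖S.P k x‖ * T x)
    (hRT : ∀ k, ∃ T, S.Paired a D T ∧ ∀ x, S.b a k x < 1 → ‖R k x‖ ≤ 2 / ‖S.P k x‖ * T x) (K : ℕ) :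
    ‖∫ x in (0:ℝ)..2 * π, (S.X a K x : ℂ) * Q K x‖ ≤ 10 ^ 6 * ∑ k ∈ Finset.range K, D k := by
  have ha0 : 0 < a := by linarith
  -- The increment of `X Q` is split into `(X (K+1) - X K) Q K` and `X (K+1) (Q (K+1) - Q K)`; in
  -- the second part the factor `4^(-K)` cancels the `4^K` from `L²`. Finally `12 + 3 * 332800 ≤
  -- 10^6`.
  have key : ‖∫ x in (0:ℝ)..2 * π, (S.X a K x : ℂ) * Q K x‖ ≤
      12 * ∑ k ∈ Finset.range K, D k + 332800 * ∑ k ∈ Finset.range K, pairBound D (k + 1) := by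
    induction K with
    | zero => simp [hQ0]
    | succ K ih =>
      have cX := S.continuous_X ha0
      have cX0 := cX K
      have cX1 := cX (K + 1)
      have cQ0 := cQ K
      have cR2 := cR K
      have h1 : ‖∫ x in (0:ℝ)..2 * π, ((S.X a (K + 1) x - S.X a K x : ℝ) : ℂ) * Q K x‖ ≤ 12 * D K := by
        cases K with
        | zero => have := hD 0; simp only [hQ0]; simpa using this
        | succ k =>
          obtain ⟨T, hT, h⟩ := hQT k
          exact S.norm_integral_X_sub_mul_le ha hT k h
      have h2 : ‖∫ x in (0:ℝ)..2 * π, (S.X a (K + 1) x : ℂ) * R2 K x‖ ≤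
          332800 * 4 ^ K * pairBound D (K + 1) := by
        obtain ⟨T, hT, h⟩ := hRT K
        exact S.norm_integral_X_mul_deriv_le ha hL hT (hR K) (hR1 K) (cR K) (pR K) (pR1 K) K h
      have e : ∫ x in (0:ℝ)..2 * π, (S.X a (K + 1) x : ℂ) * Q (K + 1) x =
          (∫ x in (0:ℝ)..2 * π, (S.X a K x : ℂ) * Q K x) +
          ((∫ x in (0:ℝ)..2 * π, ((S.X a (K + 1) x - S.X a K x : ℝ) : ℂ) * Q K x) +
            -(1 / 4 ^ K) * ∫ x in (0:ℝ)..2 * π, (S.X a (K + 1) x : ℂ) * R2 K x) := by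
        rw [← intervalIntegral.integral_const_mul,
          ← intervalIntegral.integral_add (Continuous.intervalIntegrable (by fun_prop) _ _)
            (Continuous.intervalIntegrable (by fun_prop) _ _),
          ← intervalIntegral.integral_add (Continuous.intervalIntegrable (by fun_prop) _ _)
            (Continuous.intervalIntegrable (by fun_prop) _ _)]
        refine intervalIntegral.integral_congr fun x _ => ?_
        have := hQ K x
        push_cast
        linear_combination (S.X a (K + 1) x : ℂ) * this
      rw [e, Finset.sum_range_succ, Finset.sum_range_succ]
      refine (norm_add_le _ _).trans ?_
      have h3 := norm_add_le (∫ x in (0:ℝ)..2 * π, ((S.X a (K + 1) x - S.X a K x : ℝ) : ℂ) * Q K x)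
        (-(1 / 4 ^ K) * ∫ x in (0:ℝ)..2 * π, (S.X a (K + 1) x : ℂ) * R2 K x)
      have h4 : ‖-(1 / 4 ^ K) * ∫ x in (0:ℝ)..2 * π, (S.X a (K + 1) x : ℂ) * R2 K x‖ ≤
          332800 * pairBound D (K + 1) := by
        rw [norm_mul, norm_neg, norm_div, norm_one, norm_pow, RCLike.norm_ofNat, one_div,
          inv_mul_le_iff₀ (by positivity)]
        linarith
      linarith
  have h5 := sum_pairBound D K
  have h6 := pairBound_nonneg hD K
  have h7 : 0 ≤ ∑ k ∈ Finset.range K, D k := Finset.sum_nonneg fun k _ => hD k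
  linarith

end Ladder


/-! ### The Gaussian ladder of a trigonometric sum. -/

lemma hasDerivAt_lowPass (s : Finset ℤ) {L : ℝ} (hL : L ≠ 0) (b : ℤ → ℂ) (i : ℕ) (x : ℝ) :
    HasDerivAt (lowPass s L b i) (I * L * lowPass s L b (i + 1) x) x := by
  refine (hasDerivAt_trig s _ x).congr_deriv ?_
  simp only [lowPass, trig, Finset.mul_sum]
  refine Finset.sum_congr rfl fun n _ => ?_
  have hL' : (L : ℂ) ≠ 0 := by exact_mod_cast hL
  push_cast
  rw [pow_succ _ i]
  generalize (n / L : ℂ) ^ i = y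
  field_simp

lemma lowPass_two_mul_sub (s : Finset ℤ) (L : ℝ) (b : ℤ → ℂ) (x : ℝ) :
    lowPass s (2 * L) b 0 x - lowPass s L b 0 x = oscSum s L b 0 x := by
  simp only [lowPass, oscSum, trig, ← Finset.sum_sub_distrib]
  refine Finset.sum_congr rfl fun n _ => ?_
  rw [oscMult, show (n / (2 * L) : ℝ) = n / L / 2 by ring]
  push_cast; ring

/-- At frequency zero `oscMult 1` is `0 / 0 = 0`; the relation `ξ * oscMult 1 ξ = oscMult 0 ξ`
survives there because `oscMult 0` vanishes too. The zero mode is thus no obstruction to a periodic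
primitive. -/
lemma hasDerivAt_oscSum_one (s : Finset ℤ) {L : ℝ} (hL : L ≠ 0) (b : ℤ → ℂ) (x : ℝ) :
    HasDerivAt (oscSum s L b 1) (I * L * oscSum s L b 0 x) x := by
  refine (hasDerivAt_trig s _ x).congr_deriv ?_
  simp only [oscSum, trig, Finset.mul_sum]
  refine Finset.sum_congr rfl fun n _ => ?_
  have h : oscMult 0 (n / L) = n / L * oscMult 1 (n / L) := by
    simp only [oscMult]
    rcases eq_or_ne (n / L : ℝ) 0 with h | h
    · rw [h]; simp
    · rw [mul_div_cancel₀ _ h]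
  have hL' : (L : ℂ) ≠ 0 := by exact_mod_cast hL
  rw [h]
  push_cast
  field_simp

/-- The ladder of Gaussian low-pass approximations of a trigonometric sum. -/
lemma exists_ladder {p q K : ℝ} (hpq : p.HolderConjugate q) (hq2 : 2 ≤ q) (hK : 0 ≤ K)
    (hHY : ∀ (s : Finset ℤ) (c : ℤ → ℂ),
      ∫ x in (0:ℝ)..2 * π, ‖trig s c x‖ ^ q ≤ K * (∑ n ∈ s, ‖c n‖ ^ p) ^ (q / p))
    (s : Finset ℤ) (b : ℤ → ℂ) {ι : ℝ} (hι : 0 < ι) (h0 : ∀ x, 1 / 2 ≤ ‖lowPass s 8 b 0 x‖) :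
    ∃ S : Ladder, S.L 0 = 8 ∧ (∀ k, S.P k = lowPass s (8 * 2 ^ k) b 0) ∧ S.κ ≤ 1 / 2 ∧
      (∀ k, ∫ x in (0:ℝ)..2 * π, S.G k x ^ (q / 2) ≤ 2 ^ q * (K * (16 * Real.exp 4) ^ q *
        (∑ n ∈ s, bandWeight |n / (8 * 2 ^ k)| * ‖b n‖ ^ p) ^ (q / p)) + 2 * π * ι) ∧
      ∀ k x, ∃ V, HasSum (fun i : ℕ => ‖lowPass s (8 * 2 ^ k) b (i + 1) x‖ / (i.factorial : ℝ)) V ∧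
        V ≤ 2 * √(S.G k x) := by
  have hL1 : ∀ k : ℕ, (1:ℝ) ≤ 8 * 2 ^ k := fun k => by
    have : (1:ℝ) ≤ 2 ^ k := one_le_pow₀ (by norm_num)
    linarith
  have hL0 : ∀ k : ℕ, (8 * 2 ^ k : ℝ) ≠ 0 := fun k => by positivity
  choose G G1 G2 hG hG1 cG2 pG G0 hιG bG1 bG2 iG hsum using fun k : ℕ =>
    exists_oscillation_majorant hpq hq2 hK hHY s b (hL1 k) hι
  have hq0 : 0 < q := by linarith
  have hV : ∀ k x i, ‖lowPass s (8 * 2 ^ k) b (i + 1) x‖ / (i.factorial : ℝ) ≤ 2 * √(G k x) := by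
    intro k x i
    obtain ⟨-, -, V, hV, hV2⟩ := hsum k x
    exact (le_hasSum hV i fun j _ => by positivity).trans hV2
  let S : Ladder :=
    { L := fun k => 8 * 2 ^ k
      P := fun k => lowPass s (8 * 2 ^ k) b 0
      P1 := fun k x => I * (8 * 2 ^ k : ℝ) * lowPass s (8 * 2 ^ k) b 1 x
      P2 := fun k x => I * (8 * 2 ^ k : ℝ) * (I * (8 * 2 ^ k : ℝ) * lowPass s (8 * 2 ^ k) b 2 x)
      H := fun k => oscSum s (8 * 2 ^ k) b 1
      G := G
      G1 := G1
      G2 := G2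
      -- The value `1 / 2` is the lower bound for the initial approximation, and `ι^(1/q)` is the
      -- lower bound for `√G` at every level.
      κ := min (1 / 2) (ι ^ (1 / q))
      one_le_L := hL1
      L_succ := fun k => by ring
      hasDerivAt_P := fun k x => hasDerivAt_lowPass s (hL0 k) b 0 x
      hasDerivAt_P1 := fun k x => (hasDerivAt_lowPass s (hL0 k) b 1 x).const_mul _
      continuous_P2 := fun k => by unfold lowPass; fun_prop
      hasDerivAt_H := fun k x => by
        have := hasDerivAt_oscSum_one s (hL0 k) b x
        rwa [← lowPass_two_mul_sub, show (2 * (8 * 2 ^ k) : ℝ) = 8 * 2 ^ (k + 1) by ring] at this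
      P_periodic := fun k => trig_periodic _ _
      H_periodic := fun k => trig_periodic _ _
      hasDerivAt_G := hG
      hasDerivAt_G1 := hG1
      continuous_G2 := cG2
      G_periodic := pG
      κ_pos := by positivity
      κ_sq_le := fun k x => by
        have h1 : ι ^ (2 / q) ≤ G k x := by
          have := Real.rpow_le_rpow hι.le (hιG k x) (by positivity : 0 ≤ 2 / q)
          rwa [← Real.rpow_mul (G0 k x).le, show q / 2 * (2 / q) = 1 by field_simp,
            Real.rpow_one] at this
        refine le_trans ?_ h1
        calc (min (1 / 2) (ι ^ (1 / q))) ^ 2 ≤ (ι ^ (1 / q)) ^ 2 := by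
              have : 0 < min (1 / 2) (ι ^ (1 / q)) := by positivity
              exact pow_le_pow_left₀ this.le (min_le_right _ _) 2
          _ = ι ^ (2 / q) := by
              rw [← Real.rpow_natCast, ← Real.rpow_mul hι.le]; congr 1; push_cast; ring
      κ_le := fun x => by
        rw [pow_zero, mul_one]
        exact (min_le_left _ _).trans (h0 x)
      G1_le := bG1
      G2_le := bG2
      H_le := fun k x => (hsum k x).2.1
      sub_le := fun k x => by
        have := (hsum k x).1
        rwa [← lowPass_two_mul_sub, show (2 * (8 * 2 ^ k) : ℝ) = 8 * 2 ^ (k + 1) by ring] at this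
      P1_le := fun k x => by
        have := hV k x 0
        simp only [Nat.factorial_zero, Nat.cast_one, div_one, zero_add] at this
        have hL := hL1 k
        have := mul_le_mul_of_nonneg_left this (by linarith : (0:ℝ) ≤ 8 * 2 ^ k)
        rw [norm_mul, norm_mul, Complex.norm_I, Complex.norm_real, one_mul, Real.norm_eq_abs,
          abs_of_pos (by linarith)]
        linarith
      P2_le := fun k x => by
        have := hV k x 1
        simp only [Nat.factorial_one, Nat.cast_one, div_one] at this
        have hL := hL1 k
        have := mul_le_mul_of_nonneg_left this (by positivity : (0:ℝ) ≤ (8 * 2 ^ k) ^ 2)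
        rw [norm_mul, norm_mul, norm_mul, norm_mul, Complex.norm_I, Complex.norm_real, one_mul,
          Real.norm_eq_abs, abs_of_pos (by linarith)]
        linarith }
  exact ⟨S, by simp [S], fun k => rfl, min_le_left _ _, iG, fun k x => (hsum k x).2.2⟩

/-- The coefficient sequence of the constant function one. -/
noncomputable def unitCoeff (n : ℤ) : ℂ := if n = 0 then 1 else 0

lemma trig_unitCoeff {s : Finset ℤ} (hs : (0:ℤ) ∈ s) (x : ℝ) : trig s unitCoeff x = 1 := by
  simp [trig, unitCoeff, hs]

lemma trig_sub (s : Finset ℤ) (b c : ℤ → ℂ) (x : ℝ) :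
    trig s (fun n => b n - c n) x = trig s b x - trig s c x := by
  simp only [trig, sub_mul, Finset.sum_sub_distrib]

lemma norm_le_of_sum_rpow_le {p ε : ℝ} (hp : 0 < p) (hε : 0 ≤ ε) {s : Finset ℤ} {c : ℤ → ℂ}
    (h : ∑ n ∈ s, ‖c n‖ ^ p ≤ ε ^ p) {n : ℤ} (hn : n ∈ s) : ‖c n‖ ≤ ε := by
  have h1 := (Finset.single_le_sum (f := fun n => ‖c n‖ ^ p) (fun i _ => by positivity) hn).trans h
  exact (Real.rpow_le_rpow_iff (norm_nonneg _) hε hp).1 h1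

lemma sum_norm_sq_le {p ε : ℝ} (hp : 0 < p) (hp2 : p ≤ 2) (hε : 0 ≤ ε) {s : Finset ℤ} {c : ℤ → ℂ}
    (h : ∑ n ∈ s, ‖c n‖ ^ p ≤ ε ^ p) : ∑ n ∈ s, ‖c n‖ ^ 2 ≤ ε ^ 2 := by
  have e : ∀ t : ℝ, 0 ≤ t → t ^ 2 = t ^ (2 - p) * t ^ p := fun t ht => by
    rw [← Real.rpow_add_of_nonneg ht (by linarith) hp.le, sub_add_cancel, Real.rpow_two]
  calc ∑ n ∈ s, ‖c n‖ ^ 2 ≤ ∑ n ∈ s, ε ^ (2 - p) * ‖c n‖ ^ p := by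
        refine Finset.sum_le_sum fun n hn => ?_
        rw [e _ (norm_nonneg _)]
        have := norm_le_of_sum_rpow_le hp hε h hn
        gcongr
    _ = ε ^ (2 - p) * ∑ n ∈ s, ‖c n‖ ^ p := by rw [Finset.mul_sum]
    _ ≤ ε ^ (2 - p) * ε ^ p := by gcongr
    _ = ε ^ 2 := (e _ hε).symm

lemma exists_sum_gaussian_le : ∃ W : ℝ, 0 < W ∧ ∀ s : Finset ℤ, ∑ n ∈ s, Real.exp (-(n / 8) ^ 2) ≤ W := by
  have hs : Summable fun n : ℤ => Real.exp (-(n / 8) ^ 2) := by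
    have h2 : Summable fun n : ℤ => 64 * (1 / (n : ℝ) ^ 2) :=
      (Real.summable_one_div_int_pow.2 (by norm_num)).mul_left 64
    refine Summable.of_norm_bounded_eventually h2 ?_
    filter_upwards [(Set.finite_singleton (0:ℤ)).compl_mem_cofinite] with n hn
    have hn0 : (n : ℝ) ≠ 0 := by exact_mod_cast hn
    have h3 := Real.add_one_le_exp ((n / 8 : ℝ) ^ 2)
    have h4 : 0 < (n : ℝ) ^ 2 := by positivity
    rw [Real.norm_eq_abs, abs_of_pos (Real.exp_pos _), Real.exp_neg, mul_one_div,
      inv_le_comm₀ (Real.exp_pos _) (by positivity), inv_div]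
    refine le_trans ?_ h3
    rw [div_pow]; linarith
  refine ⟨∑' n : ℤ, Real.exp (-(n / 8) ^ 2), ?_, fun s => hs.sum_le_tsum s fun n _ => (Real.exp_pos _).le⟩
  exact hs.tsum_pos (fun n => (Real.exp_pos _).le) 0 (Real.exp_pos _)

/-- At the fixed scale 8 the Gaussian weights have a bounded sum `W`, while every coefficient of `P
- 1` is at most `ε`; hence the low-pass part is within `W ε ≤ 1/2` of one. -/
lemma exists_half_le_norm_lowPass {p : ℝ} (hp : 0 < p) : ∃ ε₀ : ℝ, 0 < ε₀ ∧ ε₀ ≤ 1 ∧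
    ∀ (s : Finset ℤ) (b : ℤ → ℂ) (ε : ℝ), 0 ≤ ε → ε ≤ ε₀ → (0:ℤ) ∈ s →
      ∑ n ∈ s, ‖b n - unitCoeff n‖ ^ p ≤ ε ^ p → ∀ x, 1 / 2 ≤ ‖lowPass s 8 b 0 x‖ := by
  obtain ⟨W, hW, h⟩ := exists_sum_gaussian_le
  refine ⟨min 1 (1 / (2 * W)), by positivity, min_le_left _ _, fun s b ε hε0 hε hs hb x => ?_⟩
  have h1 : lowPass s 8 b 0 x =
      1 + trig s (fun n => ((Real.exp (-(n / 8) ^ 2) : ℝ) : ℂ) * (b n - unitCoeff n)) x := by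
    rw [← trig_unitCoeff hs x, lowPass, trig, trig, trig, ← Finset.sum_add_distrib]
    refine Finset.sum_congr rfl fun n _ => ?_
    rcases eq_or_ne n 0 with rfl | hn
    · simp
    · simp [unitCoeff, hn]
  have h2 : ‖trig s (fun n => ((Real.exp (-(n / 8) ^ 2) : ℝ) : ℂ) * (b n - unitCoeff n)) x‖ ≤ 1 / 2 := by
    refine (norm_trig_le _ _ _).trans ?_
    calc _ ≤ ∑ n ∈ s, Real.exp (-(n / 8) ^ 2) * ε := by
          refine Finset.sum_le_sum fun n hn => ?_
          rw [norm_mul, Complex.norm_real, Real.norm_eq_abs, abs_of_pos (Real.exp_pos _)]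
          exact mul_le_mul_of_nonneg_left
            (norm_le_of_sum_rpow_le (c := fun n => b n - unitCoeff n) hp hε0 hb hn) (Real.exp_pos _).le
      _ ≤ W * (1 / (2 * W)) := by
          rw [← Finset.sum_mul]
          exact mul_le_mul (h s) (hε.trans (min_le_right _ _)) hε0 hW.le
      _ = 1 / 2 := by field_simp
  have h3 := norm_sub_norm_le (1:ℂ) (-trig s (fun n => ((Real.exp (-(n / 8) ^ 2) : ℝ) : ℂ) * (b n - unitCoeff n)) x)
  rw [sub_neg_eq_add, ← h1, norm_neg, norm_one] at h3
  linarith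


/-! ### Tapers and localizing pairs. -/

/-- The quadratic taper at scale `2 ^ k`. -/
noncomputable def taper (k m : ℕ) : ℝ := max 0 (1 - m ^ 2 / 4 ^ k)

/-- The normalized difference of two consecutive tapers. -/
noncomputable def taperDiff (k m : ℕ) : ℝ := max 0 (1 / max 1 ((m:ℝ) ^ 2 / 4 ^ k) - 1 / 4)

lemma taper_antitone (k : ℕ) : Antitone (taper k) := fun m n h => by
  unfold taper; gcongr

lemma taperDiff_antitone (k : ℕ) : Antitone (taperDiff k) := fun m n h => by
  unfold taperDiff; gcongr

lemma taper_nonneg (k m : ℕ) : 0 ≤ taper k m := le_max_left _ _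
lemma taperDiff_nonneg (k m : ℕ) : 0 ≤ taperDiff k m := le_max_left _ _

lemma taper_le_one (k m : ℕ) : taper k m ≤ 1 :=
  max_le zero_le_one (by have : (0:ℝ) ≤ m ^ 2 / 4 ^ k := by positivity
                         linarith)

lemma taperDiff_le_one (k m : ℕ) : taperDiff k m ≤ 1 := by
  have h1 : (1:ℝ) ≤ max 1 ((m:ℝ) ^ 2 / 4 ^ k) := le_max_left _ _
  refine max_le zero_le_one ?_
  have : 1 / max 1 ((m:ℝ) ^ 2 / 4 ^ k) ≤ 1 := by rw [div_le_one (by linarith)]; exact h1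
  linarith

lemma taper_eq_zero {k m : ℕ} (h : 2 ^ k ≤ m) : taper k m = 0 := by
  have h1 : (2:ℝ) ^ k ≤ m := by exact_mod_cast h
  have h2 : (4:ℝ) ^ k ≤ m ^ 2 := by
    rw [show (4:ℝ) = 2 ^ 2 by norm_num, ← pow_mul, mul_comm, pow_mul]; gcongr
  refine max_eq_left (sub_nonpos.2 ?_)
  rw [le_div_iff₀ (by positivity)]; linarith

lemma taperDiff_eq_zero {k m : ℕ} (h : 2 ^ (k + 1) ≤ m) : taperDiff k m = 0 := by
  have h1 : (2:ℝ) ^ (k + 1) ≤ m := by exact_mod_cast h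
  have h2 : 4 * (4:ℝ) ^ k ≤ m ^ 2 := by
    rw [show 4 * (4:ℝ) ^ k = (2 ^ (k + 1)) ^ 2 by
      rw [← pow_mul, mul_comm (k + 1), pow_mul, pow_succ]; norm_num; ring]
    gcongr
  have h3 : (4:ℝ) ≤ m ^ 2 / 4 ^ k := by rw [le_div_iff₀ (by positivity)]; linarith
  refine max_eq_left (sub_nonpos.2 ?_)
  exact one_div_le_one_div_of_le (by norm_num) (h3.trans (le_max_right _ _))

/-- The reason for quadratic tapers: on the Fourier side `m²` is minus a second derivative, so
consecutive tapers of `Q` differ by the second derivative of a sum whose cut-off is again decreasing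
and supported below `2 ^ (k + 1)`. -/
lemma taper_succ_sub (k m : ℕ) : taper (k + 1) m - taper k m = 1 / 4 ^ k * (m ^ 2 * taperDiff k m) := by
  have e : (m:ℝ) ^ 2 / 4 ^ (k + 1) = m ^ 2 / 4 ^ k / 4 := by rw [pow_succ (4:ℝ) k, div_div]
  rw [taper, taper, taperDiff, e, ← mul_assoc, one_div_mul_eq_div]
  have h0 : (0:ℝ) ≤ m ^ 2 / 4 ^ k := by positivity
  generalize (m ^ 2 / 4 ^ k : ℝ) = t at h0 ⊢
  rcases le_total t 1 with h1 | h1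
  · rw [max_eq_left h1, max_eq_right (by linarith), max_eq_right (by linarith),
      max_eq_right (by norm_num)]
    ring
  · rw [max_eq_right h1, max_eq_left (by linarith : 1 - t ≤ 0)]
    rcases le_total t 4 with h4 | h4
    · rw [max_eq_right (by linarith), max_eq_right (sub_nonneg.2
        (one_div_le_one_div_of_le (by linarith) h4))]
      field_simp; ring
    · rw [max_eq_left (by linarith), max_eq_left (sub_nonpos.2
        (one_div_le_one_div_of_le (by norm_num) h4))]
      ring

/-- Coefficient sequences of trigonometric polynomials `P` (given by `b`) and `Q` (given by `c`) such
that `P` and `P Q` are close to one and the products of `P` with the partial sums of `Q` are bounded. -/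
structure LocalizingPair (p C ε : ℝ) (s S : Finset ℤ) (b c : ℤ → ℂ) : Prop where
  zero_mem : (0:ℤ) ∈ s
  add_mem : ∀ m ∈ s, ∀ n ∈ s, m + n ∈ S
  eq_zero : ∀ n, n ∉ s → b n = 0
  c_zero : c 0 = 0
  sum_sub_le : ∑ n ∈ s, ‖b n - unitCoeff n‖ ^ p ≤ ε ^ p
  sum_cv_sub_le : ∑ n ∈ S, ‖cv s c b n - unitCoeff n‖ ^ p ≤ ε ^ p
  sum_cut_le : ∀ m : ℕ, ∑ n ∈ S, ‖cv s (fun j => if j.natAbs ≤ m then c j else 0) b n‖ ^ p ≤ C ^ p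

lemma rpow_add_le_four_mul {x y p : ℝ} (hx : 0 ≤ x) (hy : 0 ≤ y) (hp : 0 ≤ p) (hp2 : p ≤ 2) :
    (x + y) ^ p ≤ 4 * (x ^ p + y ^ p) := by
  have h4 : (2:ℝ) ^ p ≤ 4 := by
    calc (2:ℝ) ^ p ≤ 2 ^ (2:ℝ) := Real.rpow_le_rpow_of_exponent_le (by norm_num) hp2
      _ = 4 := by norm_num
  have key : ∀ x y : ℝ, 0 ≤ x → x ≤ y → (x + y) ^ p ≤ 4 * (x ^ p + y ^ p) := fun x y hx h => by
    calc (x + y) ^ p ≤ (2 * y) ^ p := Real.rpow_le_rpow (by linarith) (by linarith) hp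
      _ = 2 ^ p * y ^ p := Real.mul_rpow (by norm_num) (by linarith)
      _ ≤ 4 * y ^ p := by have := Real.rpow_nonneg (hx.trans h) p; gcongr
      _ ≤ _ := by have := Real.rpow_nonneg hx p; linarith
  rcases le_total x y with h | h
  · exact key x y hx h
  · rw [add_comm x y, add_comm (x ^ p)]; exact key y x hy h

lemma rpow_add_le_add_rpow' {x y r : ℝ} (hx : 0 ≤ x) (hy : 0 ≤ y) (hr : 0 ≤ r) (hr1 : r ≤ 1) :
    (x + y) ^ r ≤ x ^ r + y ^ r := by
  lift x to NNReal using hx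
  lift y to NNReal using hy
  exact_mod_cast NNReal.rpow_add_le_add_rpow x y hr hr1

/-- The zero mode carries no band weight, every other coefficient of `P` is also a coefficient of `P
- 1`, and it is counted at most once over all scales. -/
lemma sum_sum_bandWeight_le {p ε : ℝ} {s : Finset ℤ} {b : ℤ → ℂ}
    (hb : ∑ n ∈ s, ‖b n - unitCoeff n‖ ^ p ≤ ε ^ p) (N : ℕ) :
    ∑ k ∈ Finset.range N, ∑ n ∈ s, bandWeight |n / (8 * 2 ^ k)| * ‖b n‖ ^ p ≤ ε ^ p := by
  rw [Finset.sum_comm]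
  refine le_trans (Finset.sum_le_sum fun n _ => ?_) hb
  rw [← Finset.sum_mul]
  rcases eq_or_ne n 0 with rfl | hn
  · simp only [Int.cast_zero, zero_div, abs_zero]
    simp only [bandWeight, zero_div, Finset.sum_const_zero, zero_mul]
    exact Real.rpow_nonneg (norm_nonneg _) _
  · have h := sum_bandWeight_le (abs_nonneg (n / 8 : ℝ)) N
    have e : ∀ k : ℕ, |(n / (8 * 2 ^ k) : ℝ)| = |(n / 8 : ℝ)| / 2 ^ k := fun k => by
      rw [← div_div, abs_div, abs_of_pos (by positivity : (0:ℝ) < 2 ^ k)]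
    simp only [e, unitCoeff, hn, if_false, sub_zero]
    exact mul_le_of_le_one_left (Real.rpow_nonneg (norm_nonneg _) _) h

lemma sum_norm_rpow_le {p ε : ℝ} (hp : 0 < p) (hp2 : p ≤ 2) (hε0 : 0 ≤ ε) (hε : ε ≤ 1) {s : Finset ℤ}
    {b : ℤ → ℂ} (hb : ∑ n ∈ s, ‖b n - unitCoeff n‖ ^ p ≤ ε ^ p) : ∑ n ∈ s, ‖b n‖ ^ p ≤ 8 := by
  have h1 : ∀ n, ‖b n‖ ^ p ≤ 4 * (‖b n - unitCoeff n‖ ^ p + ‖unitCoeff n‖ ^ p) := fun n => by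
    refine le_trans ?_ (rpow_add_le_four_mul (norm_nonneg _) (norm_nonneg _) hp.le hp2)
    have := norm_add_le (b n - unitCoeff n) (unitCoeff n)
    rw [sub_add_cancel] at this
    gcongr
  have h2 : ∑ n ∈ s, ‖unitCoeff n‖ ^ p ≤ 1 := by
    have : ∀ n : ℤ, ‖unitCoeff n‖ ^ p = if n = 0 then 1 else 0 := fun n => by
      unfold unitCoeff; split_ifs <;> simp [hp.ne']
    simp only [this, Finset.sum_ite_eq']
    split_ifs <;> norm_num
  have h3 : ε ^ p ≤ 1 := Real.rpow_le_one hε0 hε hp.le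
  refine (Finset.sum_le_sum fun n _ => h1 n).trans ?_
  rw [← Finset.mul_sum, Finset.sum_add_distrib]
  linarith


/-! ### Existence of the weight. -/

section
variable {p q C K ε : ℝ} {s A : Finset ℤ} {b c : ℤ → ℂ}

/-- A cut-off sum of `c`, controlled on the set where the ladder has not been killed at level `k`. -/
lemma exists_cut_majorant (hpq : p.HolderConjugate q) (hC : 0 ≤ C) (hK : 0 ≤ K)
    (hHY : ∀ (s : Finset ℤ) (c : ℤ → ℂ),
      ∫ x in (0:ℝ)..2 * π, ‖trig s c x‖ ^ q ≤ K * (∑ n ∈ s, ‖c n‖ ^ p) ^ (q / p))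
    (h : LocalizingPair p C ε s A b c) {S : Ladder} (hP : ∀ k, S.P k = lowPass s (8 * 2 ^ k) b 0)
    (hV : ∀ k x, ∃ V, HasSum (fun i : ℕ => ‖lowPass s (8 * 2 ^ k) b (i + 1) x‖ / (i.factorial : ℝ)) V ∧
        V ≤ 2 * √(S.G k x)) {a : ℝ} (ha : 12 ≤ a) (k : ℕ)
    {ρ : ℕ → ℝ} (hρ : Antitone ρ) (hρ1 : ∀ m, ρ m ≤ 1) (hρ0 : ∀ m, 0 ≤ ρ m)
    (hρM : ∀ m, 2 ^ (k + 1) ≤ m → ρ m = 0) :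
    ∃ T : ℝ → ℝ, Continuous T ∧ (∀ x, 0 ≤ T x) ∧
      ∫ x in (0:ℝ)..2 * π, T x ^ q ≤ 12 ^ q * (5 * (K * (4 * C) ^ q) + 2 * π) ∧
      ∀ x, S.b a k x < 1 → ‖trig s (fun n => (ρ n.natAbs : ℂ) * c n) x‖ ≤ 2 / ‖S.P k x‖ * T x := by
  obtain ⟨T, cT, T0, iT, hT⟩ := exists_majorant hpq.lt hC hK hpq.symm.lt hHY h.add_mem h.eq_zero
    h.sum_cut_le (by positivity : 0 < 2 ^ (k + 1)) hρ hρ1 hρ0 hρM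
  refine ⟨T, cT, T0, iT, fun x hx => ?_⟩
  -- The cut-off frequency `M = 2 ^ (k + 1)` is chosen so that the filter scale `4 M` is the ladder
  -- scale `8 * 2 ^ k`. Domination holds off the killed set since `3 V ≤ 6 √G ≤ 6 ‖P‖ / a ≤ ‖P‖ / 2`
  -- for `a ≥ 12`.
  have e : (4 * ((2 ^ (k + 1) : ℕ) : ℝ)) = 8 * 2 ^ k := by push_cast; ring
  rw [e, ← hP] at hT
  obtain ⟨V, hV1, hV2⟩ := hV k x
  have h1 := S.sqrt_G_le (by linarith) (S.one_lt_w_of_b_lt hx).le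
  have h2 : ‖S.P k x‖ / a ≤ ‖S.P k x‖ / 12 := by gcongr
  refine hT x V hV1 (by linarith) ?_
  rw [← S.sz_of_b_lt (by linarith) hx]
  exact S.sz_pos k x

lemma integral_sz_rpow_le (hpq : p.HolderConjugate q) (hK : 0 ≤ K) (hp2 : p ≤ 2)
    (hHY : ∀ (s : Finset ℤ) (c : ℤ → ℂ),
      ∫ x in (0:ℝ)..2 * π, ‖trig s c x‖ ^ q ≤ K * (∑ n ∈ s, ‖c n‖ ^ p) ^ (q / p))
    (hε0 : 0 ≤ ε) (hε : ε ≤ 1) (hb : ∑ n ∈ s, ‖b n - unitCoeff n‖ ^ p ≤ ε ^ p) {S : Ladder}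
    (hP : ∀ k, S.P k = lowPass s (8 * 2 ^ k) b 0) (hκ : S.κ ≤ 1 / 2) (k : ℕ) :
    ∫ x in (0:ℝ)..2 * π, S.sz k x ^ q ≤ K * 8 ^ (q / p) + 2 * π := by
  have hq0 : 0 < q := hpq.symm.pos
  have hp0 : 0 < p := hpq.pos
  have cs := (S.continuous_sz k).rpow_const (p := q) fun x => Or.inl (S.sz_pos k x).ne'
  have cP := (S.continuous_P k).norm.rpow_const (p := q) fun x => Or.inr hq0.le
  have h1 : ∀ x, S.sz k x ^ q ≤ ‖S.P k x‖ ^ q + 1 := fun x => by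
    have h2 := Real.rpow_nonneg (norm_nonneg (S.P k x)) q
    have h3 : S.κ ^ q ≤ 1 := Real.rpow_le_one S.κ_pos.le (by linarith) hq0.le
    rcases max_choice ‖S.P k x‖ S.κ with h | h <;> rw [Ladder.sz, h] <;> linarith
  refine (intervalIntegral.integral_mono (by positivity) (cs.intervalIntegrable _ _)
    (Continuous.intervalIntegrable (by fun_prop) _ _) h1).trans ?_
  rw [intervalIntegral.integral_add (cP.intervalIntegrable _ _)
    (continuous_const.intervalIntegrable _ _), intervalIntegral.integral_const, sub_zero, smul_eq_mul,
    mul_one]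
  refine add_le_add_left ?_ _
  rw [hP k]
  refine (hHY _ _).trans (mul_le_mul_of_nonneg_left ?_ hK)
  refine Real.rpow_le_rpow (by positivity) ?_ (by positivity)
  refine le_trans (Finset.sum_le_sum fun n _ => ?_) (sum_norm_rpow_le hp0 hp2 hε0 hε hb)
  refine Real.rpow_le_rpow (norm_nonneg _) ?_ hp0.le
  rw [norm_mul, Complex.norm_real, Real.norm_eq_abs, pow_zero, one_mul, abs_of_pos (Real.exp_pos _)]
  exact mul_le_of_le_one_left (norm_nonneg _) (Real.exp_le_one_iff.2 (neg_nonpos.2 (sq_nonneg _)))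

lemma trig_taper_zero (s : Finset ℤ) (hc : c 0 = 0) (x : ℝ) :
    trig s (fun n => (taper 0 n.natAbs : ℂ) * c n) x = 0 := by
  refine Finset.sum_eq_zero fun n _ => ?_
  rcases eq_or_ne n 0 with rfl | hn
  · simp [hc]
  · have h : taper 0 n.natAbs = 0 := taper_eq_zero (Int.natAbs_pos.2 hn)
    simp [h]

lemma trig_taper_succ_sub (s : Finset ℤ) (c : ℤ → ℂ) (k : ℕ) (x : ℝ) :
    trig s (fun n => (taper (k + 1) n.natAbs : ℂ) * c n) x -
      trig s (fun n => (taper k n.natAbs : ℂ) * c n) x =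
    -(1 / 4 ^ k) * trig s (fun n => n * I * (n * I * ((taperDiff k n.natAbs : ℂ) * c n))) x := by
  simp only [trig, ← Finset.sum_sub_distrib, Finset.mul_sum]
  refine Finset.sum_congr rfl fun n _ => ?_
  have h := congrArg (fun r : ℝ => (r : ℂ)) (taper_succ_sub k n.natAbs)
  have e : ((n.natAbs : ℝ) : ℂ) ^ 2 = (n : ℂ) ^ 2 := by
    rw [← Complex.ofReal_pow, Nat.cast_natAbs, Int.cast_abs, sq_abs]; push_cast; rfl
  push_cast at h e
  rw [e] at h
  linear_combination (c n * ex n x) * h + (1 / 4 ^ k * (n : ℂ) ^ 2 * taperDiff k n.natAbs * c n * ex n x) *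
    (Complex.I_sq)

/-- Existence of a weight almost equal to one, on which `P` has bounded negative moments and against
which a taper of `Q` has small integral. -/
lemma exists_weight (hpq : p.HolderConjugate q) (hp2 : p ≤ 2) (hq2 : 2 ≤ q) (hC : 0 ≤ C) (hK : 0 ≤ K)
    (hHY : ∀ (s : Finset ℤ) (c : ℤ → ℂ),
      ∫ x in (0:ℝ)..2 * π, ‖trig s c x‖ ^ q ≤ K * (∑ n ∈ s, ‖c n‖ ^ p) ^ (q / p))
    {θ : ℝ} (hθ : 0 < θ) (hθe : p / q + θ + 1 / q = 1) {n : ℕ} (hn1 : 1 ≤ n) (hn : (p + 1) / θ ≤ 2 * n) :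
    ∃ Z W ε₀ : ℝ, 0 ≤ Z ∧ 0 ≤ W ∧ 0 < ε₀ ∧ ε₀ ≤ 1 ∧ ∀ (s A : Finset ℤ) (b c : ℤ → ℂ) (ε : ℝ), 0 < ε → ε ≤ ε₀ →
      LocalizingPair p C ε s A b c → ∀ N : ℕ, ∃ X z : ℝ → ℝ, Continuous X ∧ (∀ x, 0 ≤ X x) ∧
        (∀ x, X x ≤ 1) ∧ Continuous z ∧ (∀ x, 0 < z x) ∧
        (∀ x, 0 < X x → z x = ‖lowPass s (8 * 2 ^ N) b 0 x‖) ∧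
        ∫ x in (0:ℝ)..2 * π, X x / z x ^ (2 * n) ≤ W ∧ ∫ x in (0:ℝ)..2 * π, (1 - X x) ≤ Z * ε ^ p ∧
        ‖∫ x in (0:ℝ)..2 * π, (X x : ℂ) * trig s (fun n => (taper N n.natAbs : ℂ) * c n) x‖ ≤ Z * ε ^ p := by
  have hq0 : 0 < q := hpq.symm.pos
  have hp0 : 0 < p := hpq.pos
  obtain ⟨a₀, ha₀, hmom⟩ := Ladder.exists_moment_bound hn1
  obtain ⟨ε₀, hε₀, hε₀1, hlow⟩ := exists_half_le_norm_lowPass hp0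
  set a := max a₀ 12 with ha
  have ha1 : a₀ ≤ a := le_max_left _ _
  have ha12 : 12 ≤ a := le_max_right _ _
  -- A common bound for the two kinds of functions paired with the losses: the majorants of cut-offs
  -- of `Q`, and `sz`, whose pairing measures the lost mass.
  set T₁ := 12 ^ q * (5 * (K * (4 * C) ^ q) + 2 * π) + (K * 8 ^ (q / p) + 2 * π) with hT₁
  have h1 : 0 ≤ 12 ^ q * (5 * (K * (4 * C) ^ q) + 2 * π) := by positivity
  have h2 : 0 < K * 8 ^ (q / p) + 2 * π := by positivity
  have hT₁0 : 0 < T₁ := by positivity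
  set U := 2 ^ q * (K * (16 * Real.exp 4) ^ q) with hU
  have hU0 : 0 ≤ U := by positivity
  set W := 2 * π * 2 ^ (2 * n) with hW
  have hW0 : 0 < W := by positivity
  set B := 2 * π + W with hB
  have hB0 : 0 < B := by positivity
  set Y := a ^ p * (B ^ θ * T₁ ^ (1 / q)) with hY
  have hY0 : 0 ≤ Y := by positivity
  refine ⟨10 ^ 6 * (Y * (U ^ (p / q) + 1)), W, ε₀, by positivity, hW0.le, hε₀, hε₀1,
    fun s A b c ε hε hεε₀ hLP N => ?_⟩
  have hε1 : ε ≤ 1 := hεε₀.trans hε₀1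
  -- Chosen so that the floor contributes `ε^p / (N + 1)` to each loss, hence at most `ε^p` over the
  -- `N` levels.
  set ι := (ε ^ p / (N + 1)) ^ (q / p) / (2 * π) with hι
  have hι0 : 0 < ι := by positivity
  have hιe : (2 * π * ι) ^ (p / q) = ε ^ p / (N + 1) := by
    rw [hι, mul_div_cancel₀ _ (by positivity), ← Real.rpow_mul (by positivity),
      show q / p * (p / q) = 1 by field_simp, Real.rpow_one]
  obtain ⟨S, hL, hP, hκ, hG, hV⟩ := exists_ladder hpq hq2 hK hHY s b hι0
    (hlow s b ε hε.le hεε₀ hLP.zero_mem hLP.sum_sub_le)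
  set β : ℕ → ℝ := fun k => ∑ n ∈ s, bandWeight |n / (8 * 2 ^ k)| * ‖b n‖ ^ p with hβ
  have hβ0 : ∀ k, 0 ≤ β k := fun k => Finset.sum_nonneg fun n _ =>
    mul_nonneg (bandWeight_nonneg (abs_nonneg _)) (by positivity)
  set A' : ℕ → ℝ := fun k => U * β k ^ (q / p) + 2 * π * ι with hA'
  have hA'0 : ∀ k, 0 < A' k := fun k => by
    have := hβ0 k
    positivity
  have hWk : ∀ k, ∫ x in (0:ℝ)..2 * π, S.X a k x / S.sz k x ^ (2 * n) ≤ W := fun k => by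
    refine (hmom a ha1 S k).trans ?_
    have hs := S.sz_pos 0
    have cs : Continuous fun x => 1 / S.sz 0 x ^ (2 * n) :=
      continuous_const.div ((S.continuous_sz 0).pow _) fun x => (pow_pos (hs x) _).ne'
    calc _ ≤ ∫ x in (0:ℝ)..2 * π, (2:ℝ) ^ (2 * n) := by
          refine intervalIntegral.integral_mono (by positivity) (cs.intervalIntegrable _ _)
            (continuous_const.intervalIntegrable _ _) fun x => ?_
          have h3 := hlow s b ε hε.le hεε₀ hLP.zero_mem hLP.sum_sub_le x
          have h4 : 1 / 2 ≤ S.sz 0 x := by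
            refine le_trans ?_ (le_max_left _ _)
            rw [hP, pow_zero, mul_one]; exact h3
          have h5 : (1 / 2 : ℝ) ^ (2 * n) ≤ S.sz 0 x ^ (2 * n) := by gcongr
          dsimp only
          rw [div_le_iff₀ (pow_pos (hs x) _)]
          calc (1:ℝ) = 2 ^ (2 * n) * (1 / 2) ^ (2 * n) := by rw [← mul_pow]; norm_num
            _ ≤ _ := by gcongr
      _ = W := by simp [hW]
  set D : ℕ → ℝ := fun k => a ^ p * (A' k ^ (p / q) * B ^ θ * T₁ ^ (1 / q)) with hD
  have hD0 : ∀ k, 0 ≤ D k := fun k => by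
    have := hA'0 k
    positivity
  have hpair : ∀ T : ℝ → ℝ, Continuous T → (∀ x, 0 ≤ T x) →
      ∫ x in (0:ℝ)..2 * π, T x ^ q ≤ T₁ → S.Paired a D T := fun T cT T0 iT =>
    ⟨cT, T0, fun k => S.integral_loss_mul_le (by linarith) hpq hp2 hθ hθe hn k (hA'0 k) hB0 hT₁0
      ((hG k).trans_eq (by simp only [hA', hU, hβ]; ring)) (by have := hWk k; linarith) cT T0 iT⟩
  have hsumD : ∑ k ∈ Finset.range N, D k ≤ Y * (U ^ (p / q) + 1) * ε ^ p := by
    have hpq1 : p / q ≤ 1 := by rw [div_le_one hq0]; linarith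
    have h3 : ∀ k, D k ≤ Y * (U ^ (p / q) * β k + ε ^ p / (N + 1)) := fun k => by
      -- Since `p / q ≤ 1` the power is subadditive, and it turns the Hausdorff–Young bound
      -- `β^(q/p)` into `β`.
      have h4 : A' k ^ (p / q) ≤ U ^ (p / q) * β k + ε ^ p / (N + 1) := by
        have h5 := hβ0 k
        refine (rpow_add_le_add_rpow' (by positivity) (by positivity) (by positivity) hpq1).trans_eq ?_
        rw [hιe, Real.mul_rpow hU0 (by positivity), ← Real.rpow_mul h5,
          show q / p * (p / q) = 1 by field_simp, Real.rpow_one]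
      calc D k = Y * A' k ^ (p / q) := by rw [hY, hD]; ring
        _ ≤ _ := by gcongr
    have h6 := sum_sum_bandWeight_le hLP.sum_sub_le N
    have h7 : (N : ℝ) * (ε ^ p / (N + 1)) ≤ ε ^ p := by
      rw [mul_div_assoc', div_le_iff₀ (by positivity)]
      nlinarith [Real.rpow_pos_of_pos hε p]
    calc _ ≤ ∑ k ∈ Finset.range N, Y * (U ^ (p / q) * β k + ε ^ p / (N + 1)) :=
          Finset.sum_le_sum fun k _ => h3 k
      _ = Y * (U ^ (p / q) * ∑ k ∈ Finset.range N, β k + N * (ε ^ p / (N + 1))) := by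
          rw [← Finset.mul_sum, Finset.sum_add_distrib, ← Finset.mul_sum, Finset.sum_const,
            Finset.card_range, nsmul_eq_mul]
      _ ≤ Y * (U ^ (p / q) * ε ^ p + ε ^ p) := by gcongr
      _ = _ := by ring
  refine ⟨S.X a N, S.sz N, S.continuous_X (by linarith) N, S.X_nonneg N, S.X_le_one N,
    S.continuous_sz N, S.sz_pos N, fun x hx => ?_, hWk N, ?_, ?_⟩
  · rw [S.sz_of_X_pos (by linarith) hx, hP]
  · have hsz : ∀ k, ∫ x in (0:ℝ)..2 * π, S.X a k x * S.b a k x / S.sz k x * S.sz k x ≤ D k := fun k =>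
      (hpair (S.sz k) (S.continuous_sz k) (fun x => (S.sz_pos k x).le)
        ((integral_sz_rpow_le hpq hK hp2 hHY hε.le hε1 hLP.sum_sub_le hP hκ k).trans
          (by linarith))).2.2 k
    have := S.integral_one_sub_X_le (by linarith) hsz N
    have h0 : 0 ≤ ∑ k ∈ Finset.range N, D k := Finset.sum_nonneg fun k _ => hD0 k
    linarith
  · have := S.norm_integral_X_mul_le (by linarith : 4 ≤ a) hL hD0
      (Q := fun k => trig s (fun n => (taper k n.natAbs : ℂ) * c n))
      (R := fun k => trig s (fun n => (taperDiff k n.natAbs : ℂ) * c n))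
      (R1 := fun k => trig s (fun n => n * I * ((taperDiff k n.natAbs : ℂ) * c n)))
      (R2 := fun k => trig s (fun n => n * I * (n * I * ((taperDiff k n.natAbs : ℂ) * c n))))
      (fun k => by fun_prop) (fun x => trig_taper_zero s hLP.c_zero x)
      (fun k x => trig_taper_succ_sub s c k x) (fun k x => hasDerivAt_trig _ _ _)
      (fun k x => hasDerivAt_trig _ _ _) (fun k => by fun_prop) (fun k => trig_periodic _ _)
      (fun k => trig_periodic _ _)
      (fun k => by
        obtain ⟨T, cT, T0, iT, hT⟩ := exists_cut_majorant hpq hC hK hHY hLP hP hV ha12 k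
          (taper_antitone (k + 1)) (taper_le_one _) (taper_nonneg _) fun m => taper_eq_zero
        exact ⟨T, hpair T cT T0 (by linarith), hT⟩)
      (fun k => by
        obtain ⟨T, cT, T0, iT, hT⟩ := exists_cut_majorant hpq hC hK hHY hLP hP hV ha12 k
          (taperDiff_antitone k) (taperDiff_le_one _) (taperDiff_nonneg _) fun m => taperDiff_eq_zero
        exact ⟨T, hpair T cT T0 (by linarith), hT⟩) N
    refine this.trans ?_
    linarith
end


/-! ### The contradiction for small `ε`. -/

lemma eventually_norm_trig_sub_le (s : Finset ℤ) (c : ℤ → ℂ) {m : ℕ → ℤ → ℝ}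
    (hm : ∀ n, Filter.Tendsto (fun N => m N n) Filter.atTop (nhds 1)) {η : ℝ} (hη : 0 < η) :
    ∀ᶠ N in Filter.atTop, ∀ x, ‖trig s (fun n => (m N n : ℂ) * c n) x - trig s c x‖ ≤ η := by
  have h : Filter.Tendsto (fun N => ∑ n ∈ s, |m N n - 1| * ‖c n‖) Filter.atTop (nhds 0) := by
    have := tendsto_finsetSum s fun n _ =>
      (((hm n).sub_const 1).abs.mul_const ‖c n‖)
    simpa using this
  filter_upwards [h.eventually (gt_mem_nhds hη)] with N hN x
  rw [← trig_sub]
  refine ((norm_trig_le _ _ _).trans_eq ?_).trans hN.le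
  refine Finset.sum_congr rfl fun n _ => ?_
  rw [← sub_one_mul, norm_mul, ← Complex.ofReal_one, ← Complex.ofReal_sub, Complex.norm_real,
    Real.norm_eq_abs]

lemma tendsto_taper (m : ℕ) : Filter.Tendsto (fun k => taper k m) Filter.atTop (nhds 1) := by
  have h : Filter.Tendsto (fun k : ℕ => (m:ℝ) ^ 2 * (1 / 4) ^ k) Filter.atTop (nhds 0) := by
    simpa using (tendsto_pow_atTop_nhds_zero_of_lt_one (by norm_num : (0:ℝ) ≤ 1 / 4)
      (by norm_num)).const_mul ((m:ℝ) ^ 2)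
  have h2 := (h.const_sub 1).max (tendsto_const_nhds (x := (0:ℝ)))
  simp only [sub_zero] at h2
  rw [max_eq_left zero_le_one] at h2
  refine h2.congr fun k => ?_
  rw [taper, max_comm, one_div_pow, mul_one_div]

lemma tendsto_gaussian (n : ℤ) :
    Filter.Tendsto (fun k : ℕ => (n / (8 * 2 ^ k) : ℝ) ^ 0 * Real.exp (-(n / (8 * 2 ^ k)) ^ 2))
      Filter.atTop (nhds 1) := by
  have h : Filter.Tendsto (fun k : ℕ => (n / 8 : ℝ) * (1 / 2) ^ k) Filter.atTop (nhds 0) := by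
    simpa using (tendsto_pow_atTop_nhds_zero_of_lt_one (by norm_num : (0:ℝ) ≤ 1 / 2)
      (by norm_num)).const_mul (n / 8 : ℝ)
  have h2 := (Real.continuous_exp.tendsto _).comp (h.pow 2).neg
  simp only [ne_eq, OfNat.ofNat_ne_zero, not_false_eq_true, zero_pow, neg_zero, Real.exp_zero] at h2
  refine h2.congr fun k => ?_
  rw [Function.comp_apply, pow_zero, one_mul, one_div_pow, mul_one_div, div_div]

lemma integral_norm_sub_sq_le {f g : ℝ → ℂ} (hf : Continuous f) (hg : Continuous g) :
    ∫ x in (0:ℝ)..2 * π, ‖f x - g x‖ ^ 2 ≤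
      2 * ((∫ x in (0:ℝ)..2 * π, ‖f x‖ ^ 2) + ∫ x in (0:ℝ)..2 * π, ‖g x‖ ^ 2) := by
  have c1 : Continuous fun x => ‖f x‖ ^ 2 := by fun_prop
  have c2 : Continuous fun x => ‖g x‖ ^ 2 := by fun_prop
  rw [← intervalIntegral.integral_add (c1.intervalIntegrable _ _) (c2.intervalIntegrable _ _),
    ← intervalIntegral.integral_const_mul]
  refine intervalIntegral.integral_mono (by positivity) (Continuous.intervalIntegrable (by fun_prop) _ _)
    (Continuous.intervalIntegrable (by fun_prop) _ _) fun x => ?_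
  have := norm_sub_le (f x) (g x)
  dsimp only
  nlinarith [sq_nonneg (‖f x‖ - ‖g x‖), norm_nonneg (f x - g x), norm_nonneg (f x), norm_nonneg (g x)]

/-- Where `P` has not been killed, `Q - 1` is controlled by `P (Q - 1)` and a negative moment of `P`. -/
lemma mul_norm_sub_one_le {P Q : ℂ} {X z ε δ B₀ : ℝ} {n : ℕ} (hn : 1 ≤ n) (hX : 0 ≤ X) (hX1 : X ≤ 1)
    (hz : 0 < z) (hε : 0 < ε) (hδ : 0 < δ) (hQ : ‖Q - 1‖ ≤ B₀) (hP : 0 < X → |z - ‖P‖| ≤ δ / 2) :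
    X * ‖Q - 1‖ ≤ ε * (X + X / z ^ (2 * n)) + ‖P * (Q - 1)‖ ^ 2 / ε +
      B₀ * δ ^ (2 * n) * (X / z ^ (2 * n)) := by
  have hB : 0 ≤ B₀ := (norm_nonneg _).trans hQ
  have hf : 0 ≤ ‖P * (Q - 1)‖ ^ 2 / ε := by positivity
  have hXz : 0 ≤ X / z ^ (2 * n) := by positivity
  rcases hX.eq_or_lt with h0 | h0
  · rw [← h0] at hXz ⊢; rw [zero_mul]; positivity
  have hPz := abs_le.1 (hP h0)
  -- For `z ≥ δ` one divides by `P`, since `‖P‖ ≥ z / 2`. For `z ≤ δ` the crude bound `B₀` is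
  -- enough, because there `X ≤ δ^(2n) * X / z^(2n)`.
  rcases le_total δ z with h | h
  · have h1 : z / 2 ≤ ‖P‖ := by linarith
    have h2 : z * ‖Q - 1‖ ≤ 2 * ‖P * (Q - 1)‖ := by
      rw [norm_mul]; nlinarith [norm_nonneg (Q - 1)]
    have h3 : ‖Q - 1‖ ≤ 2 * (1 / z * ‖P * (Q - 1)‖) := by
      rw [one_div_mul_eq_div, mul_div_assoc', le_div_iff₀ hz]; linarith
    have h4 : 2 * (1 / z * ‖P * (Q - 1)‖) ≤ ε * (1 / z) ^ 2 + ‖P * (Q - 1)‖ ^ 2 / ε := by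
      have h5 : 0 ≤ (ε * (1 / z) - ‖P * (Q - 1)‖) ^ 2 / ε := by positivity
      have h6 : (ε * (1 / z) - ‖P * (Q - 1)‖) ^ 2 / ε =
        ε * (1 / z) ^ 2 + ‖P * (Q - 1)‖ ^ 2 / ε - 2 * (1 / z * ‖P * (Q - 1)‖) := by
        field_simp; ring
      linarith
    have h7 : (1 / z) ^ 2 ≤ 1 + 1 / z ^ (2 * n) := by
      rw [← one_div_pow]
      rcases le_total (1 / z) 1 with h8 | h8
      · have h9 : (1 / z) ^ 2 ≤ 1 := pow_le_one₀ (by positivity) h8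
        have : 0 < (1 / z) ^ (2 * n) := by positivity
        linarith
      · have : (1 / z) ^ 2 ≤ (1 / z) ^ (2 * n) := pow_le_pow_right₀ h8 (by omega)
        linarith
    have h10 : 0 ≤ B₀ * δ ^ (2 * n) * (X / z ^ (2 * n)) := by positivity
    calc X * ‖Q - 1‖ ≤ X * (ε * (1 + 1 / z ^ (2 * n)) + ‖P * (Q - 1)‖ ^ 2 / ε) := by
          refine mul_le_mul_of_nonneg_left ((h3.trans h4).trans ?_) hX
          exact add_le_add_left (mul_le_mul_of_nonneg_left h7 hε.le) _
      _ = ε * (X + X / z ^ (2 * n)) + X * (‖P * (Q - 1)‖ ^ 2 / ε) := by ring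
      _ ≤ ε * (X + X / z ^ (2 * n)) + ‖P * (Q - 1)‖ ^ 2 / ε := by
          have := mul_le_of_le_one_left hf hX1
          linarith
      _ ≤ _ := by linarith
  · have h1 : X * ‖Q - 1‖ ≤ B₀ * δ ^ (2 * n) * (X / z ^ (2 * n)) := by
      have h2 : 1 ≤ δ ^ (2 * n) / z ^ (2 * n) := by
        rw [one_le_div (by positivity)]; gcongr
      calc X * ‖Q - 1‖ ≤ X * B₀ * 1 := by rw [mul_one]; gcongr
        _ ≤ X * B₀ * (δ ^ (2 * n) / z ^ (2 * n)) := by gcongr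
        _ = _ := by ring
    have : 0 ≤ ε * (X + X / z ^ (2 * n)) := by positivity
    linarith

/-- The weighted integral of a fine taper of `Q` is near `2π`, because `Q` is near one where `P` is
not small, and at the same time `O(ε^p)` by `exists_weight`. -/
lemma exists_not_localizingPair {p C : ℝ} (hp : 1 < p) (hp' : p < (1 + √5) / 2) (hC : 0 ≤ C) :
    ∃ ε : ℝ, 0 < ε ∧ ∀ (s A : Finset ℤ) (b c : ℤ → ℂ), ¬ LocalizingPair p C ε s A b c := by
  have h5 : √5 ^ 2 = 5 := Real.sq_sqrt (by norm_num)
  have h50 := Real.sqrt_nonneg 5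
  have hp2 : p < 2 := by nlinarith
  -- This inequality is `(p + 1) / q < 1`, that is `θ > 0`.
  have hgold : p ^ 2 < p + 1 := by nlinarith
  have hp1 : 0 < p - 1 := by linarith
  set q := p / (p - 1) with hq
  have hpq : p.HolderConjugate q := Real.HolderConjugate.conjExponent hp
  have hq2 : 2 ≤ q := by rw [hq, le_div_iff₀ hp1]; linarith
  obtain ⟨K, hK, hHY⟩ := exists_hausdorff_young hp hp2 hq
  set θ := 1 - (p + 1) / q with hθ
  have hθ0 : 0 < θ := by
    rw [hθ, sub_pos, div_lt_one (by linarith), hq, lt_div_iff₀ hp1]; nlinarith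
  obtain ⟨n₀, hn₀⟩ := exists_nat_ge ((p + 1) / θ)
  obtain ⟨Z, W, ε₀, hZ, hW, hε₀, hε₀1, hmain⟩ := exists_weight (n := n₀ + 1) hpq hp2.le hq2 hC hK.le hHY
    hθ0 (by rw [hθ]; ring) (Nat.le_add_left 1 n₀) (by push_cast; linarith [Nat.cast_nonneg (α := ℝ) n₀])
  set n := n₀ + 1 with hn
  have hn1 : 1 ≤ n := Nat.le_add_left 1 n₀
  have hπ := Real.pi_gt_three
  -- The total of the errors divided by `ε`: twice `Z` for the lost mass and the integral of the
  -- taper, `2π + W`, `8π` and 1 for `X |Q - 1|`, and `2π` for the taper error. The choice `ε V ≤ 1`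
  -- then contradicts `2π ≤ ε V`.
  set V := 2 * Z + 12 * π + W + 1 with hV
  have hV0 : 0 < V := by positivity
  refine ⟨min ε₀ (1 / V), by positivity, fun s A b c hLP => ?_⟩
  set ε := min ε₀ (1 / V) with hε
  have hε0 : 0 < ε := by positivity
  have hεε₀ : ε ≤ ε₀ := min_le_left _ _
  have hε1 : ε ≤ 1 := hεε₀.trans hε₀1
  have hεV : ε * V ≤ 1 := by
    rw [← le_div_iff₀ hV0]; exact min_le_right _ _
  set B₀ := (∑ n ∈ s, ‖c n‖) + 1 with hB₀
  have hB₀0 : 0 < B₀ := by positivity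
  -- The bound `B₀` is not uniform in `Q`, but `N` is chosen after `δ`, and the moment bound `W`
  -- does not depend on `N`.
  set δ := min 1 (ε / (B₀ * W + 1)) with hδ
  have hδ0 : 0 < δ := by positivity
  have hδn : B₀ * δ ^ (2 * n) * W ≤ ε := by
    have h1 : δ ^ (2 * n) ≤ δ := pow_le_of_le_one hδ0.le (min_le_left _ _) (by omega)
    have h2 : δ * (B₀ * W + 1) ≤ ε := by
      rw [← le_div_iff₀ (by positivity)]; exact min_le_right _ _
    calc B₀ * δ ^ (2 * n) * W ≤ B₀ * δ * W := by gcongr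
      _ ≤ δ * (B₀ * W + 1) := by nlinarith
      _ ≤ ε := h2
  obtain ⟨N, hN1, hN2⟩ := ((eventually_norm_trig_sub_le s b tendsto_gaussian (half_pos hδ0)).and
    (eventually_norm_trig_sub_le s c (fun m => tendsto_taper m.natAbs) hε0)).exists
  obtain ⟨X, z, cX, X0, X1, cz, z0, hXz, iW, iX, iQ⟩ := hmain s A b c ε hε0 hεε₀ hLP N
  set f : ℝ → ℂ := fun x => trig s b x * (trig s c x - 1) with hf
  have cf : Continuous f := by fun_prop
  have hA : (0:ℤ) ∈ A := by simpa using hLP.add_mem 0 hLP.zero_mem 0 hLP.zero_mem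
  have hfe : ∀ x, f x = trig A (fun n => cv s c b n - unitCoeff n) x -
      trig s (fun n => b n - unitCoeff n) x := fun x => by
    rw [trig_sub, trig_sub, trig_unitCoeff hA, trig_unitCoeff hLP.zero_mem]
    have h1 : trig A (cv s c b) x = trig s c x * trig s b x := by
      have := sum_mul_cv hLP.add_mem c b hLP.eq_zero (fun n => ex n x)
      rw [trig, Finset.sum_congr rfl fun n _ => mul_comm _ _]
      rw [this, trig, trig, Finset.sum_mul_sum]
      refine Finset.sum_congr rfl fun i _ => Finset.sum_congr rfl fun j _ => ?_
      rw [ex_add]; ring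
    rw [h1, hf]; ring
  -- Here `f = (P Q - 1) - (P - 1)`; since `p ≤ 2`, both parts have `ℓ²` norm at most `ε`, and
  -- Parseval gives `2 * (2π + 2π) = 8π`.
  have hf2 : ∫ x in (0:ℝ)..2 * π, ‖f x‖ ^ 2 ≤ 8 * π * ε ^ 2 := by
    simp only [hfe]
    refine (integral_norm_sub_sq_le (by fun_prop) (by fun_prop)).trans ?_
    rw [integral_norm_trig_sq, integral_norm_trig_sq]
    have h1 := sum_norm_sq_le (by linarith) hp2.le hε0.le hLP.sum_cv_sub_le
    have h2 := sum_norm_sq_le (by linarith) hp2.le hε0.le hLP.sum_sub_le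
    nlinarith
  have cXz : Continuous fun x => X x / z x ^ (2 * n) :=
    cX.div (cz.pow _) fun x => (pow_pos (z0 x) _).ne'
  have hpt : ∀ x, X x * ‖trig s c x - 1‖ ≤ ε * (X x + X x / z x ^ (2 * n)) + ‖f x‖ ^ 2 / ε +
      B₀ * δ ^ (2 * n) * (X x / z x ^ (2 * n)) := fun x => by
    refine mul_norm_sub_one_le hn1 (X0 x) (X1 x) (z0 x) hε0 hδ0 ?_ fun h => ?_
    · refine (norm_sub_le _ _).trans ?_
      rw [norm_one]
      exact add_le_add_left (norm_trig_le _ _ _) _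
    · rw [hXz x h]
      exact (abs_norm_sub_norm_le _ _).trans (hN1 x)
  have hiX : ∫ x in (0:ℝ)..2 * π, X x ≤ 2 * π := by
    calc _ ≤ ∫ x in (0:ℝ)..2 * π, (1:ℝ) := intervalIntegral.integral_mono (by positivity)
          (cX.intervalIntegrable _ _) (continuous_const.intervalIntegrable _ _) X1
      _ = 2 * π := by simp
  have hI1 : ∫ x in (0:ℝ)..2 * π, X x * ‖trig s c x - 1‖ ≤ ε * (2 * π + W) + 8 * π * ε + ε := by
    refine (intervalIntegral.integral_mono (by positivity)
      (Continuous.intervalIntegrable (by fun_prop) _ _)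
      (Continuous.intervalIntegrable (by fun_prop) _ _) hpt).trans ?_
    rw [intervalIntegral.integral_add (Continuous.intervalIntegrable (by fun_prop) _ _)
      (Continuous.intervalIntegrable (by fun_prop) _ _),
      intervalIntegral.integral_add (Continuous.intervalIntegrable (by fun_prop) _ _)
      (Continuous.intervalIntegrable (by fun_prop) _ _), intervalIntegral.integral_const_mul,
      intervalIntegral.integral_const_mul, intervalIntegral.integral_div,
      intervalIntegral.integral_add (cX.intervalIntegrable _ _) (cXz.intervalIntegrable _ _)]
    refine add_le_add (add_le_add ?_ ?_) ?_
    · exact mul_le_mul_of_nonneg_left (add_le_add hiX iW) hε0.le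
    · rw [div_le_iff₀ hε0]; linarith
    · exact (mul_le_mul_of_nonneg_left iW (by positivity)).trans hδn
  set R : ℝ → ℂ := trig s (fun n => (taper N n.natAbs : ℂ) * c n) with hR
  have cR : Continuous R := by rw [hR]; fun_prop
  have hI2 : ‖∫ x in (0:ℝ)..2 * π, (X x : ℂ) * (1 - R x)‖ ≤
      (ε * (2 * π + W) + 8 * π * ε + ε) + 2 * π * ε := by
    refine (intervalIntegral.norm_integral_le_of_norm_le (g := fun x => X x * ‖trig s c x - 1‖ + ε)
      (by positivity) (Filter.Eventually.of_forall fun x _ => ?_)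
      (Continuous.intervalIntegrable (by fun_prop) _ _)).trans ?_
    · rw [norm_mul, Complex.norm_real, Real.norm_eq_abs, abs_of_nonneg (X0 x)]
      have h1 : ‖1 - R x‖ ≤ ‖trig s c x - 1‖ + ε := by
        have h2 := norm_sub_le_norm_sub_add_norm_sub (R x) (trig s c x) 1
        rw [norm_sub_rev]
        linarith [hN2 x]
      calc X x * ‖1 - R x‖ ≤ X x * (‖trig s c x - 1‖ + ε) := mul_le_mul_of_nonneg_left h1 (X0 x)
        _ = X x * ‖trig s c x - 1‖ + X x * ε := by ring
        _ ≤ _ := by have := mul_le_of_le_one_left hε0.le (X1 x); linarith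
    · rw [intervalIntegral.integral_add (Continuous.intervalIntegrable (by fun_prop) _ _)
        (continuous_const.intervalIntegrable _ _), intervalIntegral.integral_const, smul_eq_mul, sub_zero]
      linarith
  have hsplit : ((2 * π : ℝ) : ℂ) = ((∫ x in (0:ℝ)..2 * π, (1 - X x) : ℝ) : ℂ) +
      ((∫ x in (0:ℝ)..2 * π, (X x : ℂ) * (1 - R x)) + ∫ x in (0:ℝ)..2 * π, (X x : ℂ) * R x) := by
    rw [← intervalIntegral.integral_ofReal,
      ← intervalIntegral.integral_add (Continuous.intervalIntegrable (by fun_prop) _ _)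
      (Continuous.intervalIntegrable (by fun_prop) _ _),
      ← intervalIntegral.integral_add (Continuous.intervalIntegrable (by fun_prop) _ _)
      (Continuous.intervalIntegrable (by fun_prop) _ _)]
    rw [intervalIntegral.integral_congr (g := fun _ => (1:ℂ)) fun x _ => by push_cast; ring]
    simp
  have hn1X : 0 ≤ ∫ x in (0:ℝ)..2 * π, (1 - X x) :=
    intervalIntegral.integral_nonneg (by positivity) fun x _ => sub_nonneg.2 (X1 x)
  have hfin := congrArg norm hsplit
  rw [Complex.norm_real, Real.norm_eq_abs, abs_of_pos (by positivity)] at hfin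
  have hfin2 := hfin.le.trans ((norm_add_le _ _).trans (add_le_add_right (norm_add_le _ _) _))
  rw [Complex.norm_real, Real.norm_eq_abs, abs_of_nonneg hn1X] at hfin2
  have hεp : ε ^ p ≤ ε := by
    calc ε ^ p ≤ ε ^ (1:ℝ) := Real.rpow_le_rpow_of_exponent_ge hε0 hε1 hp.le
      _ = ε := Real.rpow_one _
  have hZε : Z * ε ^ p ≤ Z * ε := mul_le_mul_of_nonneg_left hεp hZ
  have : 2 * π ≤ ε * V := by rw [hV]; linarith
  linarith


/-! ### Passage from functions on the circle to coefficient sequences. -/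

lemma fourierCoeff_sum_smul (s : Finset ℤ) (a : ℤ → ℂ) (n : ℤ) :
    fourierCoeff (⇑(∑ m ∈ s, a m • fourier m : C(AddCircle (2 * π), ℂ))) n =
      if n ∈ s then a n else 0 := by
  have hint : ∀ g : C(AddCircle (2 * π), ℂ), Integrable g (AddCircle.haarAddCircle (T := 2 * π)) :=
    fun g => g.continuous.integrable_of_hasCompactSupport (HasCompactSupport.of_compactSpace _)
  induction s using Finset.induction_on with
  | empty => simp [fourierCoeff]
  | insert m s hm ih =>
    rw [Finset.sum_insert hm, ContinuousMap.coe_add, fourierCoeff.add (hint _) (hint _), Pi.add_apply,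
      ih, ContinuousMap.coe_smul, fourierCoeff.const_smul, fourierCoeff_fourier]
    rcases eq_or_ne n m with rfl | h
    · simp [hm]
    · simp [h]

lemma IsTrigPoly.exists_eq_sum {f : C(AddCircle (2 * π), ℂ)} (hf : IsTrigPoly f) :
    ∃ s : Finset ℤ, (∀ n, n ∉ s → fourierCoeff f n = 0) ∧
      f = ∑ n ∈ s, fourierCoeff f n • fourier n := by
  obtain ⟨a, ha⟩ := Finsupp.mem_span_range_iff_exists_finsupp.1 hf
  rw [Finsupp.sum] at ha
  have h : ∀ n, fourierCoeff f n = if n ∈ a.support then a n else 0 := fun n => by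
    rw [← ha, fourierCoeff_sum_smul]
  refine ⟨a.support, fun n hn => by rw [h n, if_neg hn], ?_⟩
  conv_lhs => rw [← ha]
  exact Finset.sum_congr rfl fun n hn => by rw [h n, if_pos hn]

lemma sum_rpow_le_of_apNorm_lt {p ε : ℝ} (hp : 0 < p) {s : Finset ℤ} {a : ℤ → ℂ}
    {f : C(AddCircle (2 * π), ℂ)} (hf : f = ∑ n ∈ s, a n • fourier n) (h : ApNorm p f < ε) :
    ∑ n ∈ s, ‖a n‖ ^ p ≤ ε ^ p := by
  have e : ∀ n, fourierCoeff f n = if n ∈ s then a n else 0 := fun n => by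
    rw [hf, fourierCoeff_sum_smul]
  have h1 : ∑' n, ‖fourierCoeff f n‖ ^ p = ∑ n ∈ s, ‖a n‖ ^ p := by
    rw [tsum_eq_sum (s := s) fun n hn => by rw [e n, if_neg hn, norm_zero, Real.zero_rpow hp.ne']]
    exact Finset.sum_congr rfl fun n hn => by rw [e n, if_pos hn]
  have h0 : 0 ≤ ∑ n ∈ s, ‖a n‖ ^ p := by positivity
  rw [ApNorm, h1] at h
  calc ∑ n ∈ s, ‖a n‖ ^ p = ((∑ n ∈ s, ‖a n‖ ^ p) ^ (1 / p)) ^ p := by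
        rw [← Real.rpow_mul h0, one_div_mul_cancel hp.ne', Real.rpow_one]
    _ ≤ ε ^ p := by gcongr

lemma sum_smul_fourier_mul {s A : Finset ℤ} (hA : ∀ m ∈ s, ∀ n ∈ s, m + n ∈ A) (b c : ℤ → ℂ)
    (hb : ∀ n, n ∉ s → b n = 0) :
    (∑ n ∈ s, b n • fourier n : C(AddCircle (2 * π), ℂ)) * ∑ n ∈ s, c n • fourier n =
      ∑ n ∈ A, cv s c b n • fourier n := by
  ext x
  have h := sum_mul_cv hA c b hb (fun n => fourier n x)
  simp only [ContinuousMap.mul_apply, ContinuousMap.sum_apply, ContinuousMap.smul_apply, smul_eq_mul]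
  rw [mul_comm, Finset.sum_mul_sum, Finset.sum_congr rfl fun n (_ : n ∈ A) => mul_comm (cv s c b n) _, h]
  refine Finset.sum_congr rfl fun m _ => Finset.sum_congr rfl fun l _ => ?_
  rw [fourier_add]; ring

lemma sum_smul_fourier_sub_one {s : Finset ℤ} (hs : (0:ℤ) ∈ s) (a : ℤ → ℂ) :
    (∑ n ∈ s, a n • fourier n : C(AddCircle (2 * π), ℂ)) - 1 =
      ∑ n ∈ s, (a n - unitCoeff n) • fourier n := by
  have h1 : (∑ n ∈ s, unitCoeff n • fourier n : C(AddCircle (2 * π), ℂ)) = 1 := by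
    ext x
    simp [unitCoeff, hs]
  simp only [sub_smul, Finset.sum_sub_distrib, h1]

lemma partialFourierSum_eq {s : Finset ℤ} {f : C(AddCircle (2 * π), ℂ)}
    (hf : ∀ n, n ∉ s → fourierCoeff f n = 0) (m : ℕ) :
    partialFourierSum m f =
      ∑ n ∈ s, (if n.natAbs ≤ m then fourierCoeff f n else 0) • fourier n := by
  have h1 : ∀ n : ℤ, n ∈ Finset.Icc (-(m : ℤ)) m ↔ n.natAbs ≤ m := fun n => by
    rw [Finset.mem_Icc]; omega
  simp only [ite_smul, zero_smul]
  rw [← Finset.sum_filter, partialFourierSum]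
  symm
  refine Finset.sum_subset (fun n hn => (h1 n).2 (Finset.mem_filter.1 hn).2) fun n hn hn2 => ?_
  have : n ∉ s := fun h => hn2 (Finset.mem_filter.2 ⟨h, (h1 n).1 hn⟩)
  rw [hf n this, zero_smul]

theorem mainTheorem2 (p : ℝ) (hp : 1 < p) (hp' : p < (1 + √5) / 2) :
    ¬ ∃ C : ℝ, ∀ ε : ℝ, 0 < ε →
      ∃ P Q : C(AddCircle (2 * π), ℂ), IsTrigPoly P ∧ IsTrigPoly Q ∧
        fourierCoeff Q 0 = 0 ∧
        (∀ j : ℤ, ‖fourierCoeff Q j‖ < ε) ∧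
        ApNorm p (P - 1) < ε ∧
        ApNorm p (P * Q - 1) < ε ∧
        (∀ m : ℕ, ApNorm p (P * partialFourierSum m Q) < C) := by
  rintro ⟨C, hC⟩
  have hp0 : 0 < p := by linarith
  -- The sign of `C` is not known, so it is replaced by `max C 0`.
  obtain ⟨ε, hε, hno⟩ := exists_not_localizingPair hp hp' (le_max_right C 0)
  obtain ⟨P, Q, hP, hQ, hQ0, -, hP1, hPQ, hcut⟩ := hC ε hε
  obtain ⟨s₁, hs₁, eP⟩ := hP.exists_eq_sum
  obtain ⟨s₂, hs₂, eQ⟩ := hQ.exists_eq_sum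
  set b := fourierCoeff P with hb
  set c := fourierCoeff Q with hc
  -- Zero is included so that the constant one can be subtracted within the same index set.
  set s := insert 0 (s₁ ∪ s₂) with hs
  have h1s : s₁ ⊆ s := fun n hn => by simp [hs, hn]
  have h2s : s₂ ⊆ s := fun n hn => by simp [hs, hn]
  have h0s : (0:ℤ) ∈ s := by simp [hs]
  have hbs : ∀ n, n ∉ s → b n = 0 := fun n hn => hs₁ n fun h => hn (h1s h)
  have hcs : ∀ n, n ∉ s → c n = 0 := fun n hn => hs₂ n fun h => hn (h2s h)
  have eP' : P = ∑ n ∈ s, b n • fourier n := by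
    conv_lhs => rw [eP]
    exact Finset.sum_subset h1s fun n _ hn => by rw [hs₁ n hn, zero_smul]
  have eQ' : Q = ∑ n ∈ s, c n • fourier n := by
    conv_lhs => rw [eQ]
    exact Finset.sum_subset h2s fun n _ hn => by rw [hs₂ n hn, zero_smul]
  have hA : ∀ m ∈ s, ∀ n ∈ s, m + n ∈ Finset.image₂ (· + ·) s s := fun m hm n hn =>
    Finset.mem_image₂_of_mem hm hn
  have h0A : (0:ℤ) ∈ Finset.image₂ (· + ·) s s := by simpa using hA 0 h0s 0 h0s
  refine hno s (Finset.image₂ (· + ·) s s) b c ⟨h0s, hA, hbs, hQ0, ?_, ?_, fun m => ?_⟩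
  · refine sum_rpow_le_of_apNorm_lt hp0 ?_ hP1
    conv_lhs => rw [eP']
    exact sum_smul_fourier_sub_one h0s b
  · refine sum_rpow_le_of_apNorm_lt hp0 ?_ hPQ
    conv_lhs => rw [eP', eQ', sum_smul_fourier_mul hA b c hbs]
    exact sum_smul_fourier_sub_one h0A _
  · refine sum_rpow_le_of_apNorm_lt hp0 ?_ ((hcut m).trans_le (le_max_left C 0))
    conv_lhs => rw [partialFourierSum_eq hcs m, eP']
    exact sum_smul_fourier_mul hA b _ hbs
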